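/- Let $K$ be a field with a positive definite involution $\lambda\mapsto\overline\lambda$ (i.e. $\sum_{i=1}^n\overline{x_i}x_i=0$ implies all $x_i=0$, for every $n$). **The algebra $\mathcal A_0$.** Let $X=\{0,1\}^{\mathbb Z}$ with the shift $T(x)_i=x_{i+1}$, let $C_K(X)$ be the locally constant functions $X\to K$, and let $\mathcal A=C_K(X)\rtimes_T\mathbb Z$ ($tf=(f\circ T^{-1})t$, $t^*=t^{-1}$, $f^*=\overline f$). Let $E=\{x: x_0=1\}$, $Z=X\setminus E$, $s=\chi_Z t$, and let $\mathcal A_0$ be the unital $*$-subalgebra of $\mathcal A$ generated by $s$. Put $\mathcal B_0=C_K(X)\cap\mathcal A_0$ and $\mathcal B_i=\chi_{X\setminus(E\cup T(E)\cup\dots\cup T^{i-1}(E))}\mathcal B_0$ for $i\ge 0$. **The ring $\mathfrak R_0$.** For $k\ge1$ let $W_k=E\cap T^{-1}(Z)\cap\dots\cap T^{-k+1}(Z)\cap T^{-k}(E)$, $e_{ij}(W_k)=s^i\chi_{W_k}(s^*)^j$ ($0\le i,j<k$) and $h_k=\sum_i e_{ii}(W_k)$. Identify $h_k\mathcal A_0$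 with $M_k(K)$ through these matrix units, and put $\mathfrak R_0=\prod_{k\ge1}M_k(K)$ with the $*$-transpose involution. The algebra $\mathcal A_0$ is regarded as a subalgebra of $\mathfrak R_0$ through $\pi(a)=(h_ka)_k$. Let $\mathcal R_0$ be the $*$-regular closure of $\mathcal A_0$ in $\mathfrak R_0$, i.e. the smallest unital $*$-regular subring of $\mathfrak R_0$ containing $\pi(\mathcal A_0)$. **The algebras $\mathcal D$, $\mathcal Q$, $\mathcal E$.** Let $\mathcal B_0[[t;T]]$ be the ring of formal series $\sum_{i\ge0}b_it^i$ with $b_i\in\mathcal B_i$, and define $\pi_+:\mathcal B_0[[t;T]]\to\mathfrak R_0$ by $\pi_+(b)=(h_kb)_k$ (the terms with $i\ge k$ do not contribute to the $k$-th component). Let $\mathcal D_+$ be the division closure of $\bigoplus_{i\ge0}\mathcal B_it^i$ in $\mathcal B_0[[t;T]]$ (the smallest subring containing it and closed under inverses existing in $\mathcal B_0[[t;T]]$), and let $\mathcal D$ be the $*$-subalgebra of $\mathfrak R_0$ generated by $\pi_+(\mathcal D_+)$. Let $[0^i]=\{x: x_j=0 \text{ for } -i<j\le 0\}$, so that $s^i=\chi_{[0^i]}t^i$,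 and let $\mathcal S_0[[t;T]]=\{\sum_{i\ge0}\lambda_i s^i:\lambda_i\in K\}$ with the Hadamard (coefficientwise) product $\odot$ and the involution that conjugates the coefficients $\lambda_i$; it is identified with $(K[[x]],\odot)$ by $s\leftrightarrow x$. One has $\mathcal B_i=K\chi_{[0^i]}\oplus V_i'$, where $V_i'$ is spanned by the $\chi_C$ with $C=T^{-r}(Z)\cap\dots\cap Z\cap\dots\cap T^{q-1}(Z)$, $r,q\ge0$, subject to $q\ge i$ and ($q>i$ or $r>0$). Let $P:\mathcal B_0[[t;T]]\to\mathcal S_0[[t;T]]$ be the corresponding coefficientwise projection with kernel $\prod_iV_i't^i$, and let $\mathcal Q$ be the $*$-regular closure of $P(\mathcal D_+)$ in $(\mathcal S_0[[t;T]],\odot)$. Let $\Psi:\mathcal S_0[[t;T]]\to Z(\mathfrak R_0)$ be $\Psi(\sum_i\lambda_is^i)=(\lambda_{k-1}h_k)_{k\ge1}$, and let $p_E=\pi(\chi_E)=\pi(1-ss^*)$. Define $\mathcal E$ as the subalgebra of $\mathfrak R_0$ generated by $\mathcal D$ and $\Psi(\mathcal Q)p_E$. **The Ara–Goodearl algebras.**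 Let $\mathcal R^\circ\subseteq(K[[x]],\odot)$ be the algebra of rational series (the division closure of $K[x]$ in $K[[x]]$ for the usual product) with the Hadamard product, and let $\mathscr Q=\{a\odot b^{-1}: a,b\in\mathcal R^\circ,\ b \text{ a non-zero-divisor of } \mathcal R^\circ\}$ be its classical ring of quotients inside $(K[[x]],\odot)$. Let $\Sigma=\{f(s): f\in K[x],\ f(0)=1\}$, let $\mathscr T$ be the $*$-subalgebra of $\mathfrak R_0$ generated by the image of the universal localization $\Sigma^{-1}\mathcal A_0$ (that is, by $\pi(\mathcal A_0)$ and the inverses of the elements of $\pi(\Sigma)$), and let $\mathscr E$ be the $*$-subalgebra of $\mathfrak R_0$ generated by $\mathscr T$ and $\Psi(\mathscr Q)(1-ss^*)$. **Theorem.** $\mathcal E=\mathscr E=\mathcal R_0$ and $\mathscr Q=\mathcal Q$. -/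

import Mathlib

open scoped Polynomial

noncomputable section

set_option linter.unusedSectionVars false

namespace Lamplighter

/-! ### Closures inside rings -/

/-- The division closure of `S` in the ring `A`: the smallest subring containing `S` and closed
under the inverses that exist in `A`. -/
def divisionClosure {A : Type*} [Ring A] (S : Set A) : Subring A :=
  sInf {Q | S ⊆ Q ∧ ∀ x ∈ Q, ∀ y : A, x * y = 1 → y * x = 1 → y ∈ Q}

/-- A unital subring is a `*`-regular subring if it is closed under `*`, von Neumann regular,
and the involution is proper on it. -/
def IsStarRegularSubring {A : Type*} [Ring A] [StarRing A] (Q : Subring A) : Prop :=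
  (∀ x ∈ Q, star x ∈ Q) ∧ (∀ x ∈ Q, ∃ y ∈ Q, x * y * x = x) ∧
    ∀ x ∈ Q, star x * x = 0 → x = 0

/-- The `*`-regular closure of `S` in the `*`-regular ring `A`: the smallest unital `*`-regular
subring containing `S`. -/
def starRegularClosure {A : Type*} [Ring A] [StarRing A] (S : Set A) : Subring A :=
  sInf {Q | S ⊆ Q ∧ IsStarRegularSubring Q}

/-- The classical ring of quotients of a subring `S` of the commutative ring `A`, taken inside
`A`: all fractions `a * b⁻¹` with `a, b ∈ S` and `b` a non-zero-divisor of `S`. -/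
def classicalQuotients {A : Type*} [CommRing A] (S : Set A) : Set A :=
  {q | ∃ a ∈ S, ∃ b ∈ S, (∀ c ∈ S, b * c = 0 → c = 0) ∧ ∃ b' : A, b * b' = 1 ∧ q = a * b'}

/-! ### The crossed product `C_K(X) ⋊_T ℤ` -/

section CrossedProduct

variable {X : Type*} [TopologicalSpace X]

/-- `C_K(X)`, the algebra of locally constant functions `X → K`.  The homeomorphism `T` is
recorded because it gives the action of `ℤ`. -/
def Coef (_T : X ≃ₜ X) (K : Type*) : Type _ := LocallyConstant X K

variable (T : X ≃ₜ X) (K : Type*) [Field K]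

namespace Coef

instance : CommRing (Coef T K) := inferInstanceAs (CommRing (LocallyConstant X K))
instance : Algebra K (Coef T K) := inferInstanceAs (Algebra K (LocallyConstant X K))
instance : FunLike (Coef T K) X K := inferInstanceAs (FunLike (LocallyConstant X K) X K)

variable {T K}

@[ext] theorem ext {f g : Coef T K} (h : ∀ x, f x = g x) : f = g := LocallyConstant.ext h
@[simp] theorem add_apply (f g : Coef T K) (x : X) : (f + g) x = f x + g x := rfl
@[simp] theorem mul_apply (f g : Coef T K) (x : X) : (f * g) x = f x * g x := rfl
@[simp] theorem zero_apply (x : X) : (0 : Coef T K) x = 0 := rfl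
@[simp] theorem one_apply (x : X) : (1 : Coef T K) x = 1 := rfl
@[simp] theorem smul_apply (c : K) (f : Coef T K) (x : X) : (c • f) x = c * f x := rfl

/-- Pointwise involution. -/
instance [StarRing K] : StarRing (Coef T K) where
  star f := LocallyConstant.map star f
  star_involutive f := ext fun x => star_star (f x)
  star_mul f g := ext fun x => star_mul (f x) (g x)
  star_add f g := ext fun x => star_add (f x) (g x)

@[simp] theorem star_apply [StarRing K] (f : Coef T K) (x : X) : (star f) x = star (f x) := rfl

instance [StarRing K] : StarModule K (Coef T K) where
  star_smul c f := by ext x; simp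

/-- The action of `n : ℤ` on functions: `(n • f) x = f (T⁻ⁿ x)`, so `n • χ_U = χ_{Tⁿ U}`. -/
instance : MulSemiringAction (Multiplicative ℤ) (Coef T K) where
  smul n f := LocallyConstant.comap ⟨⇑(T ^ (-n.toAdd)), (T ^ (-n.toAdd)).continuous⟩ f
  one_smul f := rfl
  mul_smul m n f := by
    refine ext fun x => ?_
    change f ((T ^ (-(m.toAdd + n.toAdd))) x) = f ((T ^ (-n.toAdd)) ((T ^ (-m.toAdd)) x))
    rw [← Homeomorph.mul_apply, ← zpow_add, neg_add_rev]
  smul_zero _ := rfl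
  smul_add _ _ _ := rfl
  smul_one _ := rfl
  smul_mul _ _ _ := rfl

@[simp] theorem act_apply (n : Multiplicative ℤ) (f : Coef T K) (x : X) :
    (n • f) x = f ((T ^ (-n.toAdd)) x) := rfl

instance : SMulCommClass (Multiplicative ℤ) K (Coef T K) where
  smul_comm _ _ _ := rfl

theorem act_star [StarRing K] (n : Multiplicative ℤ) (f : Coef T K) :
    n • star f = star (n • f) := rfl

open Classical in
/-- The characteristic function of a clopen set `U` (only used for clopen sets; it is `0` on the
other ones). -/
def chi (T : X ≃ₜ X) (K : Type*) [Field K] (U : Set X) : Coef T K :=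
  if h : IsClopen U then (LocallyConstant.charFn K h : LocallyConstant X K) else (0 : Coef T K)

open Classical in
theorem chi_apply {U : Set X} (h : IsClopen U) (x : X) :
    chi T K U x = if x ∈ U then 1 else 0 := by
  have h1 : chi T K U = (LocallyConstant.charFn K h : LocallyConstant X K) := dif_pos h
  rw [h1]
  change Set.indicator U 1 x = _
  simp [Set.indicator_apply]

end Coef

/-- The crossed product `C_K(X) ⋊_T ℤ`: finite sums `∑ f_n tⁿ` with `t f = (f ∘ T⁻¹) t`. -/
abbrev CrossedProduct : Type _ := SkewMonoidAlgebra (Coef T K) (Multiplicative ℤ)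

namespace CrossedProduct

open SkewMonoidAlgebra Multiplicative

variable {T K}

/-- The monomial `f tⁿ`. -/
def mono (n : ℤ) (f : Coef T K) : CrossedProduct T K := single (ofAdd n) f

theorem mono_mul (m n : ℤ) (f g : Coef T K) :
    mono m f * mono n g = mono (m + n) (f * (ofAdd m • g)) := by
  simp [mono, single_mul_single]

theorem mono_add (n : ℤ) (f g : Coef T K) : mono n (f + g) = mono n f + mono n g := by
  simp [mono, single_add]

/-- The inclusion of `C_K(X)` in the crossed product. -/
def const : Coef T K →ₐ[K] CrossedProduct T K :=
  { (singleOneRingHom : Coef T K →+* CrossedProduct T K) with commutes' := fun _ => rfl }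

theorem const_apply (f : Coef T K) : const f = mono 0 f := rfl

/-- The involution, `(f tⁿ)* = t⁻ⁿ f* = T⁻ⁿ(f*) t⁻ⁿ`. -/
def starHom [StarRing K] : CrossedProduct T K →+ CrossedProduct T K :=
  (Finsupp.liftAddHom fun n : Multiplicative ℤ =>
      (singleAddHom n⁻¹).comp
        ((DistribSMul.toAddMonoidHom (Coef T K) n⁻¹).comp
          (starAddEquiv (R := Coef T K)).toAddMonoidHom)).comp
    (coeffAddEquiv (k := Coef T K) (G := Multiplicative ℤ)).toAddMonoidHom

theorem starHom_single [StarRing K] (n : Multiplicative ℤ) (f : Coef T K) :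
    starHom (single n f) = single n⁻¹ (n⁻¹ • star f) := by
  simp [starHom, singleAddHom, starAddEquiv, coeffAddEquiv]
  rfl

instance [StarRing K] : StarRing (CrossedProduct T K) where
  star := starHom
  star_involutive f := by
    change starHom (starHom f) = f
    induction f using SkewMonoidAlgebra.induction_on with
    | zero => simp
    | single g a => simp [starHom_single, ← Coef.act_star]
    | add f g hf hg => simp [hf, hg]
  star_mul f g := by
    change starHom (f * g) = starHom g * starHom f
    induction f using SkewMonoidAlgebra.induction_on with
    | zero => simp
    | add f f' hf hf' => simp [add_mul, mul_add, hf, hf']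
    | single a x =>
      induction g using SkewMonoidAlgebra.induction_on with
      | zero => simp
      | add f f' hf hf' => simp [add_mul, mul_add, hf, hf']
      | single b y =>
        simp only [single_mul_single, starHom_single]
        congr 1
        · exact mul_inv_rev a b
        · rw [star_mul, ← Coef.act_star, smul_mul', mul_inv_rev, mul_smul, mul_smul,
            inv_smul_smul]
  star_add := map_add starHom

theorem star_mono [StarRing K] (n : ℤ) (f : Coef T K) :
    star (mono n f) = mono (-n) (ofAdd (-n) • star f) := starHom_single _ _

instance [StarRing K] : StarModule K (CrossedProduct T K) where
  star_smul c f := by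
    change starHom (c • f) = star c • starHom f
    induction f using SkewMonoidAlgebra.induction_on with
    | zero => simp
    | single g a => 
      rw [SkewMonoidAlgebra.smul_single, starHom_single, starHom_single,
        SkewMonoidAlgebra.smul_single, star_smul, smul_comm]
    | add f g hf hg => simp [hf, hg]

end CrossedProduct

/-- The skew power series ring `C_K(X)[[t; T]]`: formal sums `∑_{i ≥ 0} b_i tⁱ` with
`t f = (f ∘ T⁻¹) t`. -/
@[ext] structure SkewSeries where
  /-- the coefficients `b_i` -/
  coeff : ℕ → Coef T K

namespace SkewSeries

open Multiplicative Finset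

variable {T K}

instance : Zero (SkewSeries T K) := ⟨⟨0⟩⟩
instance : One (SkewSeries T K) := ⟨⟨fun n => if n = 0 then 1 else 0⟩⟩
instance : Add (SkewSeries T K) := ⟨fun a b => ⟨a.coeff + b.coeff⟩⟩
instance : Neg (SkewSeries T K) := ⟨fun a => ⟨-a.coeff⟩⟩
instance : Mul (SkewSeries T K) :=
  ⟨fun a b => ⟨fun n => ∑ p ∈ HasAntidiagonal.antidiagonal n, a.coeff p.1 * (ofAdd (p.1 : ℤ) • b.coeff p.2)⟩⟩

@[simp] theorem coeff_zero (n : ℕ) : (0 : SkewSeries T K).coeff n = 0 := rfl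
theorem coeff_one (n : ℕ) : (1 : SkewSeries T K).coeff n = if n = 0 then 1 else 0 := rfl
@[simp] theorem coeff_add (a b : SkewSeries T K) (n : ℕ) :
    (a + b).coeff n = a.coeff n + b.coeff n := rfl
@[simp] theorem coeff_neg (a : SkewSeries T K) (n : ℕ) : (-a).coeff n = -a.coeff n := rfl
theorem coeff_mul (a b : SkewSeries T K) (n : ℕ) : (a * b).coeff n =
    ∑ p ∈ HasAntidiagonal.antidiagonal n, a.coeff p.1 * (ofAdd (p.1 : ℤ) • b.coeff p.2) := rfl

protected theorem mul_assoc (a b c : SkewSeries T K) : a * b * c = a * (b * c) := by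
  ext1; funext n
  simp only [coeff_mul, sum_mul, mul_sum, sum_sigma', smul_sum]
  refine sum_nbij' (fun p => ⟨(p.2.1, p.2.2 + p.1.2), (p.2.2, p.1.2)⟩)
    (fun p => ⟨(p.1.1 + p.2.1, p.2.2), (p.1.1, p.2.1)⟩) ?_ ?_ ?_ ?_ ?_
  · rintro ⟨⟨i, j⟩, ⟨k, l⟩⟩ h
    simp only [mem_sigma, HasAntidiagonal.mem_antidiagonal] at h ⊢
    obtain ⟨rfl, rfl⟩ := h
    constructor <;> simp [add_assoc]
  · rintro ⟨⟨i, j⟩, ⟨k, l⟩⟩ h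
    simp only [mem_sigma, HasAntidiagonal.mem_antidiagonal] at h ⊢
    obtain ⟨rfl, rfl⟩ := h
    constructor <;> simp [add_assoc]
  · rintro ⟨⟨i, j⟩, ⟨k, l⟩⟩ h
    simp only [mem_sigma, HasAntidiagonal.mem_antidiagonal] at h ⊢
    simp [h.2]
  · rintro ⟨⟨i, j⟩, ⟨k, l⟩⟩ h
    simp only [mem_sigma, HasAntidiagonal.mem_antidiagonal] at h ⊢
    simp [h.2]
  · rintro ⟨⟨i, j⟩, ⟨k, l⟩⟩ h
    simp only [mem_sigma, HasAntidiagonal.mem_antidiagonal] at h ⊢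
    obtain ⟨-, rfl⟩ := h
    rw [smul_mul', smul_smul, ← ofAdd_add, mul_assoc]
    push_cast
    rfl

instance : Ring (SkewSeries T K) where
  nsmul := nsmulRec
  zsmul := zsmulRec
  add_assoc a b c := by ext1; exact add_assoc _ _ _
  zero_add a := by ext1; exact zero_add _
  add_zero a := by ext1; exact add_zero _
  add_comm a b := by ext1; exact add_comm _ _
  neg_add_cancel a := by ext1; exact neg_add_cancel _
  mul_assoc := SkewSeries.mul_assoc
  one_mul a := by
    ext1; funext n
    rw [coeff_mul, sum_eq_single (0, n)]
    · simp [coeff_one]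
    · rintro ⟨i, j⟩ h hne
      have : i ≠ 0 := by
        rintro rfl
        simp only [HasAntidiagonal.mem_antidiagonal] at h
        exact hne (by simp [← h])
      simp [coeff_one, this]
    · simp
  mul_one a := by
    ext1; funext n
    rw [coeff_mul, sum_eq_single (n, 0)]
    · simp [coeff_one]
    · rintro ⟨i, j⟩ h hne
      have : j ≠ 0 := by
        rintro rfl
        simp only [HasAntidiagonal.mem_antidiagonal] at h
        exact hne (by simp [← h])
      simp [coeff_one, this]
    · simp
  left_distrib a b c := by ext1; funext n; simp [coeff_mul, mul_add, sum_add_distrib]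
  right_distrib a b c := by ext1; funext n; simp [coeff_mul, add_mul, sum_add_distrib]
  zero_mul a := by ext1; funext n; simp [coeff_mul]
  mul_zero a := by ext1; funext n; simp [coeff_mul]

end SkewSeries

end CrossedProduct

/-! ### The algebra attached to a clopen set and a clopen partition of its complement -/

/-- A homeomorphism `T` of `X`, a non-empty clopen set `E` and a finite partition `P` of its
complement into clopen sets. -/
structure Datum (X : Type*) [TopologicalSpace X] where
  /-- the homeomorphism -/
  T : X ≃ₜ X
  /-- the clopen set -/
  E : Set X
  /-- the partition of its complement -/
  P : Set (Set X)
  isClopen_E : IsClopen E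
  nonempty_E : E.Nonempty
  finite_P : P.Finite
  isClopen_P : ∀ Z ∈ P, IsClopen Z
  nonempty_P : ∀ Z ∈ P, Z.Nonempty
  disjoint_P : P.PairwiseDisjoint id
  sUnion_P : ⋃₀ P = Eᶜ

namespace Datum

open SkewMonoidAlgebra Multiplicative CrossedProduct

variable {X : Type*} [TopologicalSpace X] (D : Datum X) (K : Type*) [Field K] [StarRing K]

/-- The translate `Tⁿ(U)`. -/
def tr (n : ℤ) (U : Set X) : Set X := {x | (D.T ^ (-n)) x ∈ U}

theorem mem_tr (n : ℤ) (U : Set X) (x : X) : x ∈ D.tr n U ↔ (D.T ^ (-n)) x ∈ U := Iff.rfl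

theorem tr_eq_image (n : ℤ) (U : Set X) : D.tr n U = (D.T ^ n) '' U := by
  ext x
  constructor
  · intro h
    refine ⟨_, h, ?_⟩
    rw [← Homeomorph.mul_apply, ← zpow_add]; simp
  · rintro ⟨y, hy, rfl⟩
    rw [mem_tr, ← Homeomorph.mul_apply, ← zpow_add]; simpa using hy

theorem isClopen_tr {U : Set X} (h : IsClopen U) (n : ℤ) : IsClopen (D.tr n U) :=
  h.preimage (D.T ^ (-n)).continuous

/-- `χ_U` as an element of `C_K(X)`. -/
abbrev chi (U : Set X) : Coef D.T K := Coef.chi D.T K U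

/-- The `*`-algebra `B = A(E, P)`: the unital `*`-subalgebra of `C_K(X) ⋊_T ℤ` generated by the
partial isometries `χ_Z t`, `Z ∈ P`. -/
def B : StarSubalgebra K (CrossedProduct D.T K) :=
  StarAlgebra.adjoin K ((fun Z => mono 1 (D.chi K Z)) '' D.P)

/-- `B₀ = C_K(X) ∩ B`. -/
def B₀ : Subalgebra K (Coef D.T K) := (D.B K).toSubalgebra.comap const

/-- `X ∖ (E ∪ T(E) ∪ ⋯ ∪ T^{i-1}(E))`. -/
def off (i : ℕ) : Set X := {x | ∀ j < i, x ∉ D.tr j D.E}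

/-- `B_i = χ_{X ∖ (E ∪ ⋯ ∪ T^{i-1}(E))} B₀`, for `i ≥ 0`. -/
def Bpart (i : ℕ) : Set (Coef D.T K) := {f | ∃ b ∈ D.B₀ K, f = D.chi K (D.off i) * b}

/-- `s = χ_{X ∖ E} t`. -/
def s : CrossedProduct D.T K := mono 1 (D.chi K D.Eᶜ)

/-! #### `B₀[[t; T]]` is a ring -/

theorem isClopen_off (i : ℕ) : IsClopen (D.off i) := by
  have : D.off i = ⋂ j ∈ Set.Iio i, (D.tr j D.E)ᶜ := by ext; simp [off]
  rw [this]
  exact (Set.finite_Iio i).isClopen_biInter fun j _ => (D.isClopen_tr D.isClopen_E _).compl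

theorem chi_inter {U V : Set X} (hU : IsClopen U) (hV : IsClopen V) :
    D.chi K (U ∩ V) = D.chi K U * D.chi K V := by
  classical
  ext x
  simp only [Coef.mul_apply, Coef.chi_apply hU, Coef.chi_apply hV, Coef.chi_apply (hU.inter hV)]
  by_cases h1 : x ∈ U <;> by_cases h2 : x ∈ V <;> simp [h1, h2]

theorem chi_tr {U : Set X} (hU : IsClopen U) (n : ℤ) :
    D.chi K (D.tr n U) = ofAdd n • D.chi K U := by
  classical
  ext x
  rw [Coef.act_apply, Coef.chi_apply hU, Coef.chi_apply (D.isClopen_tr hU n)]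
  rfl

theorem star_chi (U : Set X) : star (D.chi K U) = D.chi K U := by
  classical
  by_cases hU : IsClopen U
  · ext x
    rw [Coef.star_apply, Coef.chi_apply hU]
    split_ifs <;> simp
  · have h0 : D.chi K U = 0 := dif_neg hU
    rw [h0, star_zero]

theorem off_add (i j : ℕ) : D.off (i + j) = D.off i ∩ D.tr i (D.off j) := by
  ext x
  simp only [off, Set.mem_inter_iff, mem_tr, Set.mem_ofPred_eq, ← Homeomorph.mul_apply, ← zpow_add]
  constructor
  · intro h
    refine ⟨fun k hk => h k (by omega), fun k hk => ?_⟩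
    have := h (i + k) (by omega)
    rwa [show -(k : ℤ) + -(i : ℤ) = -((i + k : ℕ) : ℤ) by push_cast; ring]
  · rintro ⟨h1, h2⟩ k hk
    by_cases hki : k < i
    · exact h1 k hki
    · have := h2 (k - i) (by omega)
      rwa [show -((k - i : ℕ) : ℤ) + -(i : ℤ) = -(k : ℤ) by omega] at this

theorem s_mem : D.s K ∈ D.B K := by
  classical
  have h : D.chi K D.Eᶜ = ∑ Z ∈ D.finite_P.toFinset, D.chi K Z := by
    ext x
    have hs : (∑ Z ∈ D.finite_P.toFinset, D.chi K Z) x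
        = ∑ Z ∈ D.finite_P.toFinset, (if x ∈ Z then (1 : K) else 0) := by
      have : ∀ F : Finset (Set X), (∀ Z ∈ F, IsClopen Z) → (∑ Z ∈ F, D.chi K Z) x
          = ∑ Z ∈ F, (if x ∈ Z then (1 : K) else 0) := by
        intro F
        induction F using Finset.induction_on with
        | empty => intro _; rfl
        | insert a F ha ih =>
          intro hF
          rw [Finset.sum_insert ha, Finset.sum_insert ha, Coef.add_apply,
            ih fun Z hZ => hF Z (Finset.mem_insert_of_mem hZ),
            Coef.chi_apply (hF a (Finset.mem_insert_self _ _))]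
      exact this _ fun Z hZ => D.isClopen_P Z (by simpa using hZ)
    rw [hs, Coef.chi_apply D.isClopen_E.compl]
    by_cases hx : x ∈ D.Eᶜ
    · rw [if_pos hx]
      have hx' := hx
      rw [← D.sUnion_P] at hx'
      obtain ⟨Z, hZ, hxZ⟩ := hx'
      rw [Finset.sum_eq_single Z]
      · rw [if_pos hxZ]
      · intro Z' hZ' hne
        rw [if_neg]
        intro hxZ'
        exact Set.disjoint_left.1 (D.disjoint_P (by simpa using hZ') hZ hne) hxZ' hxZ
      · intro h
        exact absurd hZ (by simpa using h)
    · rw [if_neg hx]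
      refine (Finset.sum_eq_zero fun Z hZ => ?_).symm
      rw [if_neg]
      intro hxZ
      apply hx
      rw [← D.sUnion_P]
      exact ⟨Z, by simpa using hZ, hxZ⟩
  have h2 : D.s K = ∑ Z ∈ D.finite_P.toFinset, mono 1 (D.chi K Z) := by
    unfold s
    rw [h]
    exact map_sum (AddMonoidHom.mk' (mono (T := D.T) (K := K) 1) (mono_add 1)) _ _
  rw [h2]
  exact sum_mem fun Z hZ => StarAlgebra.subset_adjoin K _ ⟨Z, by simpa using hZ, rfl⟩

theorem s_pow (i : ℕ) : D.s K ^ i = mono i (D.chi K (D.off i)) := by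
  induction i with
  | zero =>
    have : D.chi K (D.off 0) = 1 := by
      classical
      ext x
      rw [Coef.chi_apply (D.isClopen_off 0)]
      simp [off]
    rw [this, pow_zero]
    rfl
  | succ i ih =>
    have h1 : D.off 1 = D.Eᶜ := by
      ext x
      simp only [off, mem_tr, Set.mem_ofPred_eq, Set.mem_compl_iff, Nat.lt_one_iff, forall_eq]
      rfl
    rw [pow_succ, ih, s, mono_mul, ← D.chi_tr K D.isClopen_E.compl, off_add, h1,
      ← D.chi_inter K (D.isClopen_off i) (D.isClopen_tr D.isClopen_E.compl _)]
    push_cast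
    rfl

theorem act_mem (i : ℕ) {c : Coef D.T K} (hc : c ∈ D.B₀ K) :
    D.chi K (D.off i) * (ofAdd (i : ℤ) • c) ∈ D.B₀ K := by
  have hs : D.s K ^ i * const c * star (D.s K ^ i) ∈ D.B K :=
    mul_mem (mul_mem (pow_mem (D.s_mem K) i) hc) (star_mem (pow_mem (D.s_mem K) i))
  have hidem : D.chi K (D.off i) * D.chi K (D.off i) = D.chi K (D.off i) := by
    rw [← D.chi_inter K (D.isClopen_off i) (D.isClopen_off i), Set.inter_self]
  rw [s_pow, const_apply, mono_mul, star_mono, mono_mul, star_chi, smul_smul, ← ofAdd_add,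
    add_zero, add_neg_cancel, ofAdd_zero, one_smul, mul_right_comm, hidem] at hs
  exact hs

theorem Bpart_mul {i j : ℕ} {b c : Coef D.T K} (hb : b ∈ D.Bpart K i) (hc : c ∈ D.Bpart K j) :
    b * (ofAdd (i : ℤ) • c) ∈ D.Bpart K (i + j) := by
  obtain ⟨b, hb, rfl⟩ := hb
  obtain ⟨c, hc, rfl⟩ := hc
  refine ⟨b * (D.chi K (D.off i) * (ofAdd (i : ℤ) • c)), mul_mem hb (D.act_mem K i hc), ?_⟩
  have hidem : D.chi K (D.off i) * D.chi K (D.off i) = D.chi K (D.off i) := by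
    rw [← D.chi_inter K (D.isClopen_off i) (D.isClopen_off i), Set.inter_self]
  rw [off_add, D.chi_inter K (D.isClopen_off i) (D.isClopen_tr (D.isClopen_off j) _),
    D.chi_tr K (D.isClopen_off j), smul_mul']
  linear_combination (-(ofAdd (i : ℤ) • D.chi K (D.off j)) * b * (ofAdd (i : ℤ) • c)) * hidem

theorem Bpart_add {i : ℕ} {b c : Coef D.T K} (hb : b ∈ D.Bpart K i) (hc : c ∈ D.Bpart K i) :
    b + c ∈ D.Bpart K i := by
  obtain ⟨b, hb, rfl⟩ := hb
  obtain ⟨c, hc, rfl⟩ := hc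
  exact ⟨b + c, add_mem hb hc, by ring⟩

theorem Bpart_zero (i : ℕ) : 0 ∈ D.Bpart K i := ⟨0, zero_mem _, by simp⟩

theorem one_mem_Bpart : 1 ∈ D.Bpart K 0 := by
  classical
  refine ⟨1, one_mem _, ?_⟩
  ext x
  rw [Coef.mul_apply, Coef.chi_apply (D.isClopen_off 0)]
  simp [off]

/-- The ring `B₀[[t; T]]` of formal sums `∑_{i ≥ 0} b_i tⁱ` with `b_i ∈ B_i`. -/
def Bseries : Subring (SkewSeries D.T K) where
  carrier := {b | ∀ i, b.coeff i ∈ D.Bpart K i}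
  mul_mem' {a b} ha hb n := by
    rw [SkewSeries.coeff_mul]
    refine Finset.sum_induction _ (· ∈ D.Bpart K n) (fun _ _ => D.Bpart_add K)
      (D.Bpart_zero K n) ?_
    rintro ⟨i, j⟩ h
    obtain rfl := Finset.HasAntidiagonal.mem_antidiagonal.1 h
    exact D.Bpart_mul K (ha i) (hb j)
  one_mem' n := by
    rw [SkewSeries.coeff_one]
    split_ifs with h
    · subst h; exact D.one_mem_Bpart K
    · exact D.Bpart_zero K n
  add_mem' ha hb i := D.Bpart_add K (ha i) (hb i)
  zero_mem' i := D.Bpart_zero K i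
  neg_mem' {a} ha i := by
    obtain ⟨b, hb, h⟩ := ha i
    exact ⟨-b, neg_mem hb, by rw [SkewSeries.coeff_neg, h, mul_neg]⟩

/-- `B₊ = ⊕_{i ≥ 0} B_i tⁱ`, as a subset of `B₀[[t; T]]`. -/
def Bplus : Set (D.Bseries K) := {b | ∃ N, ∀ i, N < i → b.1.coeff i = 0}

/-- `D₊`, the division closure of `B₊` in `B₀[[t; T]]`. -/
def Dplus : Subring (D.Bseries K) := divisionClosure (D.Bplus K)

/-! #### The product of matrix algebras -/

/-- The non-empty sets `W = E ∩ T⁻¹(Z₁) ∩ ⋯ ∩ T^{-k+1}(Z_{k-1}) ∩ T⁻ᵏ(E)` with `k ≥ 1` and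
`Z_j ∈ P`.  The length `k = |W|`, which is determined by `W`, is recorded along with `W`. -/
structure Tower where
  /-- the length `|W|` -/
  len : ℕ
  /-- the set `W` -/
  base : Set X
  one_le_len : 1 ≤ len
  nonempty : base.Nonempty
  exists_pieces : ∃ Z : ℕ → Set X, (∀ j, 1 ≤ j → j < len → Z j ∈ D.P) ∧
    base = D.E ∩ {x | ∀ j, 1 ≤ j → j < len → x ∈ D.tr (-j) (Z j)} ∩ D.tr (-len) D.E

/-- The matrix units `e_{ij}(W) = (χ_{X∖E} t)ⁱ χ_W (t⁻¹ χ_{X∖E})ʲ` of the crossed product. -/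
def unit (W : D.Tower) (i j : ℕ) : CrossedProduct D.T K :=
  D.s K ^ i * const (D.chi K W.base) * star (D.s K) ^ j

/-- `h_W = ∑_i e_{ii}(W)`. -/
def h (W : D.Tower) : CrossedProduct D.T K := ∑ i : Fin W.len, D.unit K W i i

/-- `∏_W M_{|W|}(K)`, with the `*`-transpose involution in each factor. -/
abbrev MatrixProduct : Type _ := ∀ W : D.Tower, Matrix (Fin W.len) (Fin W.len) K

/-- `r` is the image `π(a) = (h_W a)_W` of `a` in `∏_W M_{|W|}(K)`, where `h_W B` is identified
with `M_{|W|}(K)` by means of the matrix units `e_{ij}(W)`. -/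
def IsImage (a : CrossedProduct D.T K) (r : D.MatrixProduct K) : Prop :=
  ∀ W : D.Tower, D.h K W * a = ∑ i, ∑ j, r W i j • D.unit K W i j

/-- `r` is the image `π₊(b) = (h_W b)_W` of the series `b = ∑ b_i tⁱ`.  The terms with `i ≥ |W|`
do not contribute to the component at `W`. -/
def IsSeriesImage (b : D.Bseries K) (r : D.MatrixProduct K) : Prop :=
  ∀ W : D.Tower, D.h K W * ∑ i ∈ Finset.range W.len, mono (i : ℤ) (b.1.coeff i) =
    ∑ i, ∑ j, r W i j • D.unit K W i j

/-- `π(B)`. -/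
def imageB : Set (D.MatrixProduct K) := {r | ∃ a ∈ D.B K, D.IsImage K a r}

/-- `R_B`, the `*`-regular closure of `B` (that is, of `π(B)`) in `∏_W M_{|W|}(K)`. -/
def R : Subring (D.MatrixProduct K) := starRegularClosure (D.imageB K)

/-- The `*`-subalgebra `D` of `∏_W M_{|W|}(K)` generated by `π₊(D₊)`. -/
def algD : StarSubalgebra K (D.MatrixProduct K) :=
  StarAlgebra.adjoin K {r | ∃ b ∈ D.Dplus K, D.IsSeriesImage K b r}

/-! #### Special terms -/

/-- `S₀ = E ∪ ⋃ {Z ∈ P | Z ∩ T⁻¹(E) ≠ ∅}`. -/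
def S₀ : Set X := D.E ∪ ⋃₀ {Z | Z ∈ D.P ∧ (Z ∩ D.tr (-1) D.E).Nonempty}

/-- `S₁ = E ∪ ⋃ {Z ∈ P | T⁻¹(Z) ∩ E ≠ ∅}`. -/
def S₁ : Set X := D.E ∪ ⋃₀ {Z | Z ∈ D.P ∧ (D.tr (-1) Z ∩ D.E).Nonempty}

/-- The sets `𝒲_i`, `i ≥ 0`: for `i > 0` the sets
`S = T^{i-1}(Z_{i-1}) ∩ ⋯ ∩ Z₀` with `Z_j ∈ P` and `E ∩ T⁻ⁱ(S) ∩ T^{-i-1}(E) ≠ ∅`;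
for `i = 0` the single set `S₀ ∪ T⁻¹(S₁)` if `E ∩ T⁻¹(E) ≠ ∅`, and nothing otherwise. -/
def special : ℕ → Set (Set X)
  | 0 => {S | (D.E ∩ D.tr (-1) D.E).Nonempty ∧ S = D.S₀ ∪ D.tr (-1) D.S₁}
  | i + 1 => {S | (∃ Z : ℕ → Set X, (∀ j < i + 1, Z j ∈ D.P) ∧
        S = {x | ∀ j < i + 1, x ∈ D.tr j (Z j)}) ∧
      (D.E ∩ D.tr (-(i + 1)) S ∩ D.tr (-(i + 1) - 1) D.E).Nonempty}

theorem special_disjoint {i : ℕ} {S S' : Set X} (h : S ∈ D.special i) (h' : S' ∈ D.special i)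
    (hne : S ≠ S') : Disjoint S S' := by
  cases i with
  | zero => exact absurd (h.2.trans h'.2.symm) hne
  | succ i =>
    obtain ⟨⟨Z, hZ, rfl⟩, -⟩ := h
    obtain ⟨⟨Z', hZ', rfl⟩, -⟩ := h'
    rw [Set.disjoint_left]
    intro x hx hx'
    apply hne
    have : ∀ j < i + 1, Z j = Z' j := fun j hj => by
      by_contra hn
      exact Set.disjoint_left.1 (D.disjoint_P (hZ j hj) (hZ' j hj) hn) (hx j hj) (hx' j hj)
    ext y
    exact forall₂_congr fun j hj => by rw [this j hj]

theorem special_clopen {i : ℕ} {S : Set X} (h : S ∈ D.special i) : IsClopen S := by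
  cases i with
  | zero =>
    rw [h.2]
    have key : ∀ F : Set (Set X), F ⊆ D.P → IsClopen (⋃₀ F) := fun F hF => by
      rw [Set.sUnion_eq_biUnion]
      exact (D.finite_P.subset hF).isClopen_biUnion fun Z hZ => D.isClopen_P Z (hF hZ)
    exact (D.isClopen_E.union (key _ fun Z hZ => hZ.1)).union
      (D.isClopen_tr (D.isClopen_E.union (key _ fun Z hZ => hZ.1)) _)
  | succ i =>
    obtain ⟨⟨Z, hZ, rfl⟩, -⟩ := h
    have : {x | ∀ j < i + 1, x ∈ D.tr j (Z j)} = ⋂ j ∈ Set.Iio (i + 1), D.tr j (Z j) := by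
      ext x; simp
    rw [this]
    exact (Set.finite_Iio _).isClopen_biInter fun j hj => D.isClopen_tr (D.isClopen_P _ (hZ j hj)) _

theorem special_finite (i : ℕ) : (D.special i).Finite := by
  cases i with
  | zero => exact (Set.finite_singleton (D.S₀ ∪ D.tr (-1) D.S₁)).subset fun S h => h.2
  | succ i =>
    have := D.finite_P.to_subtype
    refine (Set.finite_range fun Z : Fin (i + 1) → D.P =>
      {x | ∀ j : Fin (i + 1), x ∈ D.tr j (Z j)}).subset ?_
    rintro S ⟨⟨Z, hZ, rfl⟩, -⟩
    refine ⟨fun j => ⟨Z j, hZ j j.2⟩, ?_⟩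
    ext x
    exact ⟨fun h j hj => h ⟨j, hj⟩, fun h j => h j j.2⟩

/-- `V_i = span {χ_S | S ∈ 𝒲_i}`. -/
def V (i : ℕ) : Submodule K (Coef D.T K) := Submodule.span K (D.chi K '' D.special i)

theorem chi_mul_chi {i : ℕ} {S S' : Set X} (h : S ∈ D.special i) (h' : S' ∈ D.special i) :
    D.chi K S * D.chi K S' = if S = S' then D.chi K S else 0 := by
  classical
  rw [← D.chi_inter K (D.special_clopen h) (D.special_clopen h')]
  split_ifs with he
  · rw [← he, Set.inter_self]
  · rw [Set.disjoint_iff_inter_eq_empty.1 (D.special_disjoint h h' he)]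
    ext x
    rw [Coef.chi_apply isClopen_empty]
    simp

theorem V_mul {i : ℕ} {a b : Coef D.T K} (ha : a ∈ D.V K i) (hb : b ∈ D.V K i) :
    a * b ∈ D.V K i := by
  have : a * b ∈ D.V K i * D.V K i := Submodule.mul_mem_mul ha hb
  unfold V at this
  rw [Submodule.span_mul_span] at this
  refine Submodule.span_le.2 ?_ this
  rintro _ ⟨_, ⟨S, hS, rfl⟩, _, ⟨S', hS', rfl⟩, rfl⟩
  classical
  change D.chi K S * D.chi K S' ∈ D.V K i
  rw [D.chi_mul_chi K hS hS']
  split_ifs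
  · exact Submodule.subset_span ⟨S, hS, rfl⟩
  · exact zero_mem _

theorem V_star {i : ℕ} {a : Coef D.T K} (ha : a ∈ D.V K i) : star a ∈ D.V K i := by
  induction ha using Submodule.span_induction with
  | mem x hx =>
    obtain ⟨S, hS, rfl⟩ := hx
    rw [star_chi]
    exact Submodule.subset_span ⟨S, hS, rfl⟩
  | zero => rw [star_zero]; exact zero_mem _
  | add x y _ _ hx hy => rw [star_add]; exact add_mem hx hy
  | smul c x _ hx => rw [star_smul]; exact Submodule.smul_mem _ _ hx

/-- The coefficients `e_i = ∑_{S ∈ 𝒲_i} χ_S` of the identity for the Hadamard product. -/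
def specialUnit (i : ℕ) : Coef D.T K := ∑ S ∈ (D.special_finite i).toFinset, D.chi K S

theorem specialUnit_mem (i : ℕ) : D.specialUnit K i ∈ D.V K i :=
  sum_mem fun S hS => Submodule.subset_span ⟨S, by simpa using hS, rfl⟩

theorem specialUnit_mul {i : ℕ} {a : Coef D.T K} (ha : a ∈ D.V K i) :
    D.specialUnit K i * a = a := by
  classical
  induction ha using Submodule.span_induction with
  | mem x hx =>
    obtain ⟨S, hS, rfl⟩ := hx
    rw [specialUnit, Finset.sum_mul, Finset.sum_eq_single S]
    · rw [D.chi_mul_chi K hS hS, if_pos rfl]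
    · intro S' hS' hne
      rw [D.chi_mul_chi K (by simpa using hS') hS, if_neg hne]
    · intro h
      exact absurd hS (by simpa using h)
  | zero => rw [mul_zero]
  | add x y _ _ hx hy => rw [mul_add, hx, hy]
  | smul c x _ hx => rw [mul_smul_comm, hx]

/-- `S[[t; T]]`: the series `∑ b_i tⁱ` with `b_i ∈ V_i`, with the Hadamard (coefficientwise)
product and the coefficientwise involution. -/
def specialSeries : NonUnitalStarSubalgebra K (ℕ → Coef D.T K) where
  carrier := {q | ∀ i, q i ∈ D.V K i}
  add_mem' ha hb i := add_mem (ha i) (hb i)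
  zero_mem' _ := zero_mem _
  mul_mem' ha hb i := D.V_mul K (ha i) (hb i)
  smul_mem' c _ ha i := Submodule.smul_mem _ c (ha i)
  star_mem' ha i := D.V_star K (ha i)

/-- `(S[[t; T]], ⊙)` is a commutative ring; its identity is `∑_i (∑_{S ∈ 𝒲_i} χ_S) tⁱ`. -/
instance : CommRing (D.specialSeries K) where
  __ := (inferInstance : NonUnitalCommRing (D.specialSeries K))
  one := ⟨D.specialUnit K, D.specialUnit_mem K⟩
  one_mul a := Subtype.ext (funext fun i => D.specialUnit_mul K (a.2 i))
  mul_one a := Subtype.ext (funext fun i => by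
    change a.1 i * D.specialUnit K i = a.1 i
    rw [mul_comm]
    exact D.specialUnit_mul K (a.2 i))

/-- `C = T^{-r}(Z_{-r}) ∩ ⋯ ∩ Z₀ ∩ ⋯ ∩ T^{s-1}(Z_{s-1})` with `Z_j ∈ P`, non-empty. -/
def IsCylinder (r s : ℕ) (C : Set X) : Prop :=
  C.Nonempty ∧ ∃ Z : ℤ → Set X, (∀ j, -(r : ℤ) ≤ j → j < s → Z j ∈ D.P) ∧
    C = {x | ∀ j, -(r : ℤ) ≤ j → j < s → x ∈ D.tr j (Z j)}

open Classical in
/-- The complement `V'_i` of `V_i` in `B_i`: for `i ≥ 1` the span of all `χ_C` with `C` as above,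
`s ≥ i`, and `s > i` or `r > 0`; for `i = 0` it is the span of all `χ_C` with `r + s ≥ 1` if
`E ∩ T⁻¹(E) ≠ ∅`, and `B₀` otherwise. -/
def V' (i : ℕ) : Submodule K (Coef D.T K) :=
  if i = 0 then
    if (D.E ∩ D.tr (-1) D.E).Nonempty then
      Submodule.span K (D.chi K '' {C | ∃ r s : ℕ, 1 ≤ r + s ∧ D.IsCylinder r s C})
    else Subalgebra.toSubmodule (D.B₀ K)
  else Submodule.span K
    (D.chi K '' {C | ∃ r s : ℕ, i ≤ s ∧ (i < s ∨ 0 < r) ∧ D.IsCylinder r s C})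

/-- `q = P(x)`, where `P : B₀[[t; T]] → S[[t; T]]` is the projection along `∏ V'_i tⁱ`. -/
def IsProj (x : D.Bseries K) (q : D.specialSeries K) : Prop :=
  ∀ i, x.1.coeff i - q.1 i ∈ D.V' K i

/-- The algebra `Q`: the `*`-regular closure of `P(D₊)` in `(S[[t; T]], ⊙, ⁻)`. -/
def algQ : Subring (D.specialSeries K) :=
  starRegularClosure {q | ∃ x ∈ D.Dplus K, D.IsProj K x q}

/-- `Ψ(q) = (λ_{S(W)} h_W)_W`, where `λ_{S(W)}` is the coefficient of `χ_{S(W)} t^{|W|-1}` in `q`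
and `S(W) ∈ 𝒲_{|W|-1}` is the special set with `W = E ∩ T^{-|W|+1}(S(W)) ∩ T^{-|W|}(E)`.  As the
sets in `𝒲_{|W|-1}` are disjoint, this coefficient is the value of the function `q_{|W|-1}` at any
point of `S(W)`, for instance at any point of `T^{|W|-1}(W) ⊆ S(W)`. -/
def psi (q : D.specialSeries K) : D.MatrixProduct K := fun W =>
  q.1 (W.len - 1) ((D.T ^ (W.len - 1)) W.nonempty.some) •
    (1 : Matrix (Fin W.len) (Fin W.len) K)

/-- The algebra `ℰ`: the subalgebra of `∏_W M_{|W|}(K)` generated by `D` and `Ψ(Q) p_E`, where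
`p_E = π(χ_E)`. -/
def algE : Subalgebra K (D.MatrixProduct K) :=
  Algebra.adjoin K ((D.algD K : Set (D.MatrixProduct K)) ∪
    {r | ∃ q ∈ D.algQ K, ∃ p, D.IsImage K (const (D.chi K D.E)) p ∧ r = D.psi K q * p})

/-! #### Localization at the polynomials in `s` with constant term `1` -/

/-- The image in `∏_W M_{|W|}(K)` of the universal localization `Σ⁻¹B`, where `Σ` consists of the
elements `f(s)` with `f ∈ K[x]`, `f(0) = 1`: it is generated by `π(B)` and the inverses of the
elements `π(f(s))`. -/
def locB : Subalgebra K (D.MatrixProduct K) :=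
  Algebra.adjoin K (D.imageB K ∪
    {r | ∃ f : K[X], f.coeff 0 = 1 ∧ ∃ y, D.IsImage K (Polynomial.aeval (D.s K) f) y ∧
      y * r = 1 ∧ r * y = 1})

/-- The `*`-algebra generated by the image of `Σ⁻¹B` (and its adjoint). -/
def algT : StarSubalgebra K (D.MatrixProduct K) :=
  StarAlgebra.adjoin K (D.locB K : Set (D.MatrixProduct K))

end Datum

/-! ### The first lamplighter approximating algebra -/

/-- The two-sided shift on `{0,1}^ℤ`, `T(x)_i = x_{i+1}`. -/
def shift : (ℤ → Fin 2) ≃ₜ (ℤ → Fin 2) where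
  toFun x i := x (i + 1)
  invFun x i := x (i - 1)
  left_inv x := by ext i; simp
  right_inv x := by ext i; simp
  continuous_toFun := by fun_prop
  continuous_invFun := by fun_prop

/-- `E₀ = [1]` and `P₀ = {[0]}`, cylinder sets at the coordinate `0`. -/
def datum₀ : Datum (ℤ → Fin 2) where
  T := shift
  E := {x | x 0 = 1}
  P := {{x | x 0 = 0}}
  isClopen_E := (isClopen_discrete {(1 : Fin 2)}).preimage (continuous_apply 0)
  nonempty_E := ⟨fun _ => 1, rfl⟩
  finite_P := Set.finite_singleton _
  isClopen_P := by
    rintro Z rfl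
    exact (isClopen_discrete {(0 : Fin 2)}).preimage (continuous_apply 0)
  nonempty_P := by
    rintro Z rfl
    exact ⟨fun _ => 0, rfl⟩
  disjoint_P := Set.pairwiseDisjoint_singleton _ _
  sUnion_P := by
    rw [Set.sUnion_singleton]
    ext x
    change x 0 = 0 ↔ ¬ x 0 = 1
    generalize x 0 = a
    revert a
    decide

/-- `[0 ⋯ 0]` (`i` zeros, at the coordinates `-i+1, …, 0`), so that
`sⁱ = χ_{[0 ⋯ 0]} tⁱ`. -/
def zeros (i : ℕ) : Set (ℤ → Fin 2) := {x | ∀ j : ℕ, j < i → x (-j) = 0}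

theorem shift_pow (n : ℤ) (x : ℤ → Fin 2) (i : ℤ) : (shift ^ n) x i = x (i + n) := by
  induction n using Int.induction_on generalizing x with
  | zero => simp
  | succ n ih =>
    rw [zpow_add, zpow_one, Homeomorph.mul_apply, ih]
    change x (i + n + 1) = _
    rw [add_assoc]
  | pred n ih =>
    rw [sub_eq_add_neg, zpow_add, zpow_neg_one, Homeomorph.mul_apply, ih]
    change x (i + -n - 1) = _
    rw [sub_eq_add_neg, add_assoc]

theorem mem_tr₀ (n : ℤ) (U : Set (ℤ → Fin 2)) (x : ℤ → Fin 2) :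
    x ∈ datum₀.tr n U ↔ (fun i => x (i + -n)) ∈ U := by
  rw [Datum.mem_tr]
  have : (datum₀.T ^ (-n)) x = fun i => x (i + -n) := funext fun i => shift_pow _ _ _
  rw [this]

/-- The sets `[0 ⋯ 0]` are the special sets of the first lamplighter approximating algebra. -/
theorem special₀ (i : ℕ) : datum₀.special i = {zeros i} := by
  cases i with
  | zero =>
    have hne : (datum₀.E ∩ datum₀.tr (-1) datum₀.E).Nonempty :=
      ⟨fun _ => 1, rfl, (mem_tr₀ _ _ _).2 rfl⟩
    have huniv : datum₀.S₀ ∪ datum₀.tr (-1) datum₀.S₁ = zeros 0 := by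
      have h0 : zeros 0 = Set.univ := by
        ext x
        simp [zeros]
      rw [h0, Set.eq_univ_iff_forall]
      intro x
      left
      by_cases hx : x 0 = 1
      · exact Or.inl hx
      · refine Or.inr ⟨{x | x 0 = 0}, ⟨rfl, fun i => if i = 0 then 0 else 1, rfl,
          (mem_tr₀ _ _ _).2 ?_⟩, ?_⟩
        · change (if (0 : ℤ) + - -1 = 0 then (0 : Fin 2) else 1) = 1
          norm_num
        · change x 0 = 0
          revert hx
          generalize x 0 = a
          revert a
          decide
    ext S
    rw [Set.mem_singleton_iff, ← huniv]
    exact ⟨fun h => h.2, fun h => ⟨hne, h⟩⟩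
  | succ i =>
    have key : ∀ Z : ℕ → Set (ℤ → Fin 2), (∀ j < i + 1, Z j ∈ datum₀.P) →
        {x | ∀ j < i + 1, x ∈ datum₀.tr j (Z j)} = zeros (i + 1) := by
      intro Z hZ
      ext x
      refine forall₂_congr fun j hj => ?_
      have : Z j = {x | x 0 = 0} := hZ j hj
      rw [this, mem_tr₀]
      change x (0 + -(j : ℤ)) = 0 ↔ _
      rw [zero_add]
    ext S
    rw [Set.mem_singleton_iff]
    constructor
    · rintro ⟨⟨Z, hZ, rfl⟩, -⟩
      exact key Z hZ
    · rintro rfl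
      refine ⟨⟨fun _ => {x | x 0 = 0}, fun _ _ => rfl, (key _ fun _ _ => rfl).symm⟩,
        fun n => if 1 ≤ n ∧ n ≤ i + 1 then 0 else 1, ⟨?_, (mem_tr₀ _ _ _).2 ?_⟩,
          (mem_tr₀ _ _ _).2 ?_⟩
      · change (if (1 : ℤ) ≤ 0 ∧ (0 : ℤ) ≤ i + 1 then (0 : Fin 2) else 1) = 1
        norm_num
      · intro j hj
        exact if_pos (by constructor <;> omega)
      · exact if_neg (by omega)

section

variable (K : Type*) [Field K]

/-- The algebra `R°` of rational series inside `(K[[x]], ⊙)`.  The Hadamard algebra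
`(K[[x]], ⊙)` is `ℕ → K` with the coefficientwise operations; the rational series form the
division closure of `K[x]` in `K[[x]]` (for the ordinary product). -/
def rationalHadamard : Set (ℕ → K) :=
  {a | ∃ f ∈ divisionClosure (Set.range fun p : K[X] => (p : PowerSeries K)),
    ∀ n, a n = PowerSeries.coeff n f}

/-- Every non-zero-divisor of `R°` is invertible in `(K[[x]], ⊙)`, so `classicalQuotients R°` is
the classical ring of quotients of `R°`. -/
theorem isUnit_of_regular {b : ℕ → K}
    (h : ∀ c ∈ rationalHadamard K, b * c = 0 → c = 0) : IsUnit b := by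
  classical
  rw [Pi.isUnit_iff]
  intro n
  rw [isUnit_iff_ne_zero]
  intro hn
  have h1 := h (Pi.single n 1) ⟨((Polynomial.X ^ n : K[X]) : PowerSeries K),
    Subring.mem_sInf.2 fun Q hQ => hQ.1 ⟨_, rfl⟩, fun m => by
      rw [Polynomial.coeff_coe, Polynomial.coeff_X_pow, Pi.single_apply]⟩ (by
      ext m
      by_cases hm : m = n
      · subst hm; simp [hn]
      · simp [hm])
  have := congrFun h1 n
  simp at this

/-- The classical ring of quotients `𝒬` of `R°` in `(K[[x]], ⊙)`. -/
def agQ : Set (ℕ → K) := classicalQuotients (rationalHadamard K)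

variable [StarRing K]

/-- The identification of `K[[x]]` with `S₀[[t; T]]`, `∑ a_i xⁱ ↦ ∑ a_i sⁱ`, where
`sⁱ = χ_{[0 ⋯ 0]} tⁱ`. -/
def ofPowerSeries (a : ℕ → K) : datum₀.specialSeries K :=
  ⟨fun i => a i • datum₀.chi K (zeros i), fun i => Submodule.smul_mem _ _
    (Submodule.subset_span ⟨zeros i, by rw [special₀]; rfl, rfl⟩)⟩

/-- The `*`-subalgebra of `∏_k M_k(K)` generated by the `*`-algebra `datum₀.algT K` and
`Ψ(𝒬)(1 - s s*)`. -/
def agE : StarSubalgebra K (datum₀.MatrixProduct K) :=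
  StarAlgebra.adjoin K ((datum₀.algT K : Set (datum₀.MatrixProduct K)) ∪
    {r | ∃ a ∈ agQ K, ∃ p, datum₀.IsImage K (1 - datum₀.s K * star (datum₀.s K)) p ∧
      r = datum₀.psi K (ofPowerSeries K a) * p})

end

end Lamplighter

end

open scoped Polynomial

noncomputable section

set_option linter.unusedSectionVars false

namespace Lamplighter

/-! ### The theorem of Skolem, Mahler and Lech in characteristic zero -/

section SkolemMahlerLech

open Matrix

/-! Every algebra in the theorem is compared with one explicit algebra A (`toeplitzAlgebra`): the
*-algebra generated by the lower triangular Toeplitz matrices f(s), f a rational series, and by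
Ψ(𝒬)p_E. The heart of the matter is that A is *-regular.

The corner p_E A p_E equals Ψ(𝒬)p_E (`corner_eq`). Indeed A acts on the columns spanned over 𝒬 by
the truncations of rational series and by their reversals; the first column of an element of A is of
this kind, and the top entry of such a column, as a function of k-1, lies in 𝒬. The ring 𝒬 is
regular (`agQSubring_regular`): positive definiteness forces characteristic zero, so by Skolem,
Mahler and Lech the zero set of a linear recurrence is eventually periodic, and zero coefficients
can be replaced by 1 within the rational series. Positive definiteness also makes the involution
proper on the product of matrix algebras, and a Gram–Schmidt argument carries regularity from the
corner to the ideal generated by p_E (`regular_of_mem_ideal`).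

Modulo this ideal s is invertible with inverse s*: 1-ss* is p_E, and 1-s*s = e p_E e* with e =
(1-s*s)(1-s)⁻¹p_E, the family of matrix units e_{k-1,0}. Every class is then a fraction f(s)s⁻ʲ,
which is zero or invertible. Regularity of A follows by lifting relative inverses
(`regular_of_regular_sub`).

Conversely, a *-regular subring containing π(𝒜₀) contains the inverses of its invertible elements,
hence all f(s); the identity e* f(s) p_E = Ψ(f)p_E puts the rational Hadamard algebra into its
corner, and relative inverses then produce 𝒬 there. So A is the *-regular closure. As for 𝒬 itself,
the i-th coefficient of P(b) is the lower left entry of π₊(b) in size i+1, which lies in 𝒬 by the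
computation of the corner, while P fixes every rational series in s. The two generated algebras are
compared with A on generators. -/

theorem norm_pow_div_factorial_le (p : ℕ) [hp : Fact p.Prime] (h3 : 3 ≤ p) {j k : ℕ}
    (hkj : k ≤ j) : ‖(p : ℚ_[p]) ^ j / (j.factorial : ℚ_[p])‖ ≤ ((p : ℝ)⁻¹) ^ (k / 2) := by
  have hp1 : (1 : ℝ) < p := by exact_mod_cast hp.out.one_lt
  have hp0 : (0 : ℝ) < p := by linarith
  have hf : ((j.factorial : ℕ) : ℚ_[p]) ≠ 0 := by exact_mod_cast j.factorial_ne_zero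
  -- Legendre's formula gives (p-1) v_p(j!) ≤ j, and p - 1 ≥ 2. Hence |pʲ/j!| ≤ p^(-j/2), which
  -- tends to 0.
  have hv : 2 * padicValNat p j.factorial ≤ j := by
    have h1 := sub_one_mul_padicValNat_factorial (p := p) j
    have h2 : 2 * padicValNat p j.factorial ≤ (p - 1) * padicValNat p j.factorial :=
      Nat.mul_le_mul_right _ (by omega)
    omega
  rw [norm_div, Padic.norm_p_pow, Padic.norm_eq_zpow_neg_valuation hf, Padic.valuation_natCast,
    ← zpow_sub₀ hp0.ne', ← zpow_natCast, ← _root_.zpow_neg_one, ← _root_.zpow_mul]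
  refine zpow_le_zpow_right₀ hp1.le ?_
  omega

open Polynomial in
/-- A sequence `∑_j C(n, j) pʲ c_j` with infinitely many zeros vanishes. -/
theorem eq_zero_of_infinite_zeros (p : ℕ) [hp : Fact p.Prime] (h3 : 3 ≤ p) (c b : ℕ → ℤ)
    (hb : ∀ n, b n = ∑ j ∈ Finset.range (n + 1), (n.choose j : ℤ) * ((p : ℤ) ^ j * c j))
    (hinf : {n | b n = 0}.Infinite) (m : ℕ) : b m = 0 := by
  have hp1 : (1 : ℝ) < p := by exact_mod_cast hp.out.one_lt
  -- The sequence is interpolated by the polynomials Σ a_j n(n-1)⋯(n-j+1) with a_j = pʲc_j/j!.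
  -- Dividing by the monic polynomial D with k of the zeros as roots leaves no remainder, so only
  -- the small coefficients a_j with j ≥ k contribute to b(m).
  have key : ∀ k : ℕ, ‖((b m : ℤ) : ℚ_[p])‖ ≤ ((p : ℝ)⁻¹) ^ (k / 2) := by
    intro k
    obtain ⟨Z, hZ, hZk⟩ := hinf.exists_subset_card_eq k
    -- Binomial coefficients C(n, j) vanish for j > n, so cutting the sum at J is exact at m and at
    -- all the chosen zeros.
    set J := m + Z.sup id + 1 with hJ
    set D : ℤ[X] := ∏ z ∈ Z, (X - C (z : ℤ)) with hD
    have hDm : D.Monic := monic_prod_of_monic _ _ fun z _ => monic_X_sub_C _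
    have hDd : D.natDegree = k := by
      rw [hD, natDegree_prod_of_monic _ _ fun z _ => monic_X_sub_C _]
      simp only [natDegree_X_sub_C, Finset.sum_const, hZk, smul_eq_mul, mul_one]
    set a : ℕ → ℚ_[p] := fun j => (p : ℚ_[p]) ^ j / (j.factorial : ℚ_[p]) * (c j : ℚ_[p]) with ha
    let φ : ℤ →+* ℚ_[p] := Int.castRingHom _
    have hev : ∀ n < J, ∑ j ∈ Finset.range J, a j * φ ((descPochhammer ℤ j).eval (n : ℤ))
        = ((b n : ℤ) : ℚ_[p]) := by
      intro n hn
      rw [hb n, ← Finset.sum_subset (Finset.range_subset_range.2 (by omega : n + 1 ≤ J))]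
      · push_cast
        refine Finset.sum_congr rfl fun j hj => ?_
        have hf : ((j.factorial : ℕ) : ℚ_[p]) ≠ 0 := by exact_mod_cast j.factorial_ne_zero
        rw [descPochhammer_eval_eq_descFactorial, Nat.descFactorial_eq_factorial_mul_choose]
        simp only [ha, φ]
        push_cast
        field_simp
        rw [map_mul, map_natCast, map_natCast]
        ring
      · intro j _ hj
        rw [descPochhammer_eval_eq_descFactorial, Nat.descFactorial_of_lt (by simpa using hj)]
        simp
    set R : ℚ_[p][X] := ∑ j ∈ Finset.range J, C (a j) * (descPochhammer ℤ j %ₘ D).map φ with hR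
    have hsplit : ∀ n : ℤ, ∑ j ∈ Finset.range J, a j * φ ((descPochhammer ℤ j).eval n) =
        R.eval (n : ℚ_[p]) + φ (D.eval n) *
          ∑ j ∈ Finset.range J, a j * φ ((descPochhammer ℤ j /ₘ D).eval n) := by
      intro n
      rw [hR, eval_finsetSum, Finset.mul_sum, ← Finset.sum_add_distrib]
      refine Finset.sum_congr rfl fun j _ => ?_
      conv_lhs => rw [← modByMonic_add_div (descPochhammer ℤ j) D]
      have : (n : ℚ_[p]) = φ n := rfl
      rw [eval_mul, eval_C, this, eval_map_apply, eval_add, eval_mul, map_add, map_mul]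
      ring
    have hDz : ∀ z ∈ Z, D.eval (z : ℤ) = 0 := fun z hz => by
      rw [hD, eval_prod]
      exact Finset.prod_eq_zero hz (by simp)
    -- The remainder has degree less than k and vanishes at the k chosen zeros.
    have hR0 : R = 0 := by
      have hinj : Function.Injective (fun n : ℕ => (n : ℚ_[p])) := Nat.cast_injective
      refine eq_zero_of_degree_lt_of_eval_finset_eq_zero (Z.map ⟨_, hinj⟩) ?_ ?_
      · rw [Finset.card_map, hZk, hR]
        refine (degree_sum_le _ _).trans_lt ((Finset.sup_lt_iff (by
          exact WithBot.bot_lt_coe k)).2 fun j _ => ?_)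
        have h1 : (descPochhammer ℤ j %ₘ D).degree < k := by
          refine (degree_modByMonic_lt _ hDm).trans_le ?_
          rw [degree_eq_natDegree hDm.ne_zero, hDd]
        refine (degree_mul_le _ _).trans_lt ?_
        refine (add_le_add degree_C_le degree_map_le).trans_lt ?_
        rwa [zero_add]
      · intro x hx
        obtain ⟨z, hz, rfl⟩ := Finset.mem_map.1 hx
        have hzJ : z < J := by
          have : z ≤ Z.sup id := Finset.le_sup (f := id) hz
          omega
        have h1 := hsplit z
        rw [hDz z hz, map_zero, zero_mul, add_zero, hev z hzJ] at h1
        have h2 : b z = 0 := hZ hz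
        rw [h2] at h1
        simpa using h1.symm
    rw [← hev m (by omega), hsplit, hR0, eval_zero, zero_add, norm_mul]
    have hφ : ∀ z : ℤ, ‖φ z‖ ≤ 1 := fun z => Padic.norm_int_le_one z
    refine (mul_le_of_le_one_left (norm_nonneg _) (hφ _)).trans ?_
    refine IsUltrametricDist.norm_sum_le_of_forall_le_of_nonneg (by positivity) fun j _ => ?_
    -- Since deg D = k, the quotient vanishes for j < k; for j ≥ k its values are integers and only
    -- the bound on pʲ/j! matters.
    by_cases hjk : j < k
    · have : descPochhammer ℤ j /ₘ D = 0 := by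
        rw [divByMonic_eq_zero_iff hDm, degree_eq_natDegree hDm.ne_zero, hDd,
          degree_eq_natDegree (monic_descPochhammer ℤ j).ne_zero, descPochhammer_natDegree]
        exact_mod_cast hjk
      rw [this]
      simp only [eval_zero, map_zero, mul_zero, norm_zero]
      positivity
    · rw [norm_mul, ha, norm_mul]
      refine (mul_le_of_le_one_right (by positivity) (hφ _)).trans
        ((mul_le_of_le_one_right (norm_nonneg _) (hφ _)).trans ?_)
      exact norm_pow_div_factorial_le p h3 (not_lt.1 hjk)
  have h0 : ((b m : ℤ) : ℚ_[p]) = 0 := by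
    rw [← norm_le_zero_iff]
    have hlim : Filter.Tendsto (fun k : ℕ => ((p : ℝ)⁻¹) ^ k) Filter.atTop (nhds 0) :=
      tendsto_pow_atTop_nhds_zero_of_lt_one (by positivity) (inv_lt_one_of_one_lt₀ hp1)
    refine ge_of_tendsto' hlim fun k => ?_
    simpa using key (2 * k)
  exact_mod_cast h0

variable {n : Type*} [Fintype n] [DecidableEq n]

/-- The binomial expansion of (1 + pB)^m exhibits the sequence as Σ C(m, j) pʲ (u · Bʲv). -/
theorem dotProduct_pow_eq_zero_of_infinite_zeros (p : ℕ) [hp : Fact p.Prime] (h3 : 3 ≤ p)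
    (B : Matrix n n ℤ) (u v : n → ℤ)
    (hinf : {m | u ⬝ᵥ ((1 + (p : ℤ) • B) ^ m *ᵥ v) = 0}.Infinite) (m : ℕ) :
    u ⬝ᵥ ((1 + (p : ℤ) • B) ^ m *ᵥ v) = 0 := by
  refine eq_zero_of_infinite_zeros p h3 (fun j => u ⬝ᵥ (B ^ j *ᵥ v)) _ (fun m => ?_) hinf m
  rw [add_comm, (Commute.one_right ((p : ℤ) • B)).add_pow]
  rw [Matrix.sum_mulVec, dotProduct_sum]
  refine Finset.sum_congr rfl fun j _ => ?_
  have : ((p : ℤ) • B) ^ j * 1 ^ (m - j) * ((m.choose j : ℕ) : Matrix n n ℤ)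
      = ((m.choose j : ℤ) * (p : ℤ) ^ j) • B ^ j := by
    rw [one_pow, mul_one, _root_.smul_pow, mul_comm (m.choose j : ℤ), mul_smul, smul_mul_assoc,
      ← nsmul_eq_mul', natCast_zsmul]
  rw [this, smul_mulVec, dotProduct_smul, smul_eq_mul, mul_assoc]

/-- At an integer point x with det M(x) ≠ 0 and a prime p not dividing this determinant, M(x) is
invertible modulo p, so its N-th power is 1 modulo p for N the order of GL_n(𝔽_p). The same holds at
every integer point congruent to x modulo p, and the p-adic lemma applies there. These points are
Zariski dense. It matters below that N is chosen before u, v and r. -/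
theorem mvPolynomial_zeros {ι : Type*} (M : Matrix n n (MvPolynomial ι ℤ)) (hM : M.det ≠ 0) :
    ∃ N : ℕ, 0 < N ∧ ∀ u v : n → MvPolynomial ι ℤ, ∀ r : ℕ,
      {m | u ⬝ᵥ (M ^ (r + N * m) *ᵥ v) = 0}.Infinite →
        ∀ m, u ⬝ᵥ (M ^ (r + N * m) *ᵥ v) = 0 := by
  obtain ⟨x, hx⟩ : ∃ x : ι → ℤ, MvPolynomial.eval x M.det ≠ 0 := by
    by_contra! h
    exact hM (MvPolynomial.funext fun x => by simp [h x])
  -- The bound |det| + 3 ensures both that p does not divide the determinant and that p ≥ 3.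
  obtain ⟨p, hpl, hp⟩ := Nat.exists_infinite_primes ((MvPolynomial.eval x M.det).natAbs + 3)
  have : Fact p.Prime := ⟨hp⟩
  have hpd : ¬ (p : ℤ) ∣ MvPolynomial.eval x M.det := fun h => by
    have := Nat.le_of_dvd (Int.natAbs_pos.2 hx) (Int.natCast_dvd.1 h)
    omega
  let ev : (ι → ℤ) → MvPolynomial ι ℤ →+* ℤ := fun τ => MvPolynomial.eval τ
  let red : Matrix n n ℤ →+* Matrix n n (ZMod p) := (Int.castRingHom (ZMod p)).mapMatrix
  let M₀ : Matrix n n (ZMod p) := red ((ev x).mapMatrix M)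
  have hunit : IsUnit M₀ := by
    rw [Matrix.isUnit_iff_isUnit_det, isUnit_iff_ne_zero]
    change ((Int.castRingHom (ZMod p)).mapMatrix ((ev x).mapMatrix M)).det ≠ 0
    rw [← RingHom.map_det, ← RingHom.map_det]
    intro h
    exact hpd ((ZMod.intCast_zmod_eq_zero_iff_dvd _ p).1 h)
  have hfin : Finite (Matrix n n (ZMod p)) := by unfold Matrix; infer_instance
  have : Finite (Matrix n n (ZMod p))ˣ := inferInstance
  refine ⟨Nat.card (Matrix n n (ZMod p))ˣ, Nat.card_pos, fun u v r hinf => ?_⟩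
  set N := Nat.card (Matrix n n (ZMod p))ˣ with hN
  have hMN : M₀ ^ N = 1 := by
    obtain ⟨U, hU⟩ := hunit
    rw [← hU, ← Units.val_pow_eq_pow_val, hN, pow_card_eq_one', Units.val_one]
  have hevdot : ∀ (τ : ι → ℤ) (k : ℕ), ev τ (u ⬝ᵥ (M ^ k *ᵥ v)) =
      (fun i => ev τ (u i)) ⬝ᵥ (((ev τ).mapMatrix M) ^ k *ᵥ fun i => ev τ (v i)) := by
    intro τ k
    rw [RingHom.map_dotProduct, ← map_pow]
    congr 1
    funext i
    exact RingHom.map_mulVec _ _ _ _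
  have hspec : ∀ τ : ι → ℤ, (∀ i, (p : ℤ) ∣ τ i - x i) → ∀ m,
      ev τ (u ⬝ᵥ (M ^ (r + N * m) *ᵥ v)) = 0 := by
    intro τ hτ m
    have hred : red ((ev τ).mapMatrix M) = M₀ := by
      have hcomp : (Int.castRingHom (ZMod p)).comp (ev τ) = (Int.castRingHom (ZMod p)).comp (ev x) := by
        refine MvPolynomial.ringHom_ext (fun z => by simp [ev]) fun i => ?_
        simp only [ev, RingHom.comp_apply, MvPolynomial.eval_X]
        have := (ZMod.intCast_zmod_eq_zero_iff_dvd _ p).2 (hτ i)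
        push_cast at this
        exact sub_eq_zero.1 this
      ext i j
      exact DFunLike.congr_fun hcomp (M i j)
    set Mt := (ev τ).mapMatrix M with hMt
    have hdiv : ∀ i j, ∃ b : ℤ, (Mt ^ N) i j = (1 : Matrix n n ℤ) i j + p * b := by
      intro i j
      have h1 : red (Mt ^ N) = red 1 := by rw [map_pow, hred, hMN, map_one]
      have h2 : (((Mt ^ N) i j : ℤ) : ZMod p) = (((1 : Matrix n n ℤ) i j : ℤ) : ZMod p) :=
        congrFun (congrFun h1 i) j
      obtain ⟨b, hb⟩ := (ZMod.intCast_eq_intCast_iff_dvd_sub _ _ p).1 h2.symm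
      exact ⟨b, by linarith⟩
    choose B hB using hdiv
    have hMB : Mt ^ N = 1 + (p : ℤ) • (Matrix.of B) := by
      ext i j
      simp [hB]
    have hform : ∀ m, ev τ (u ⬝ᵥ (M ^ (r + N * m) *ᵥ v)) =
        (fun i => ev τ (u i)) ᵥ* Mt ^ r ⬝ᵥ ((1 + (p : ℤ) • (Matrix.of B)) ^ m *ᵥ
          fun i => ev τ (v i)) := by
      intro m
      rw [hevdot, ← hMB, ← pow_mul, pow_add, ← Matrix.dotProduct_mulVec, Matrix.mulVec_mulVec]
    rw [hform]
    refine dotProduct_pow_eq_zero_of_infinite_zeros p (by omega) _ _ _ (hinf.mono fun m hm => ?_) m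
    have hm' : u ⬝ᵥ (M ^ (r + N * m) *ᵥ v) = 0 := hm
    change _ = (0 : ℤ)
    rw [← hform, hm', map_zero]
  intro m
  -- A polynomial vanishing on a product of infinite sets, here the residue classes x_i + pℤ, is
  -- zero.
  refine MvPolynomial.funext_set (fun i => {t : ℤ | (p : ℤ) ∣ t - x i}) (fun i => ?_)
    fun τ hτ => ?_
  · have hinj : Function.Injective fun k : ℤ => x i + p * k := fun k l h => by
      have hp0 : (p : ℤ) ≠ 0 := by exact_mod_cast hp.ne_zero
      exact mul_left_cancel₀ hp0 (add_left_cancel h)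
    refine (Set.infinite_range_of_injective hinj).mono ?_
    rintro _ ⟨k, rfl⟩
    exact ⟨k, by ring⟩
  · rw [map_zero]
    exact hspec τ (fun i => hτ i trivial) m

/-- Clearing the denominators of M, u and v multiplies the k-th term by a nonzero factor d cᵏ e,
which does not change its vanishing. -/
theorem fractionField_zeros {ι : Type*} {F : Type*} [Field F] [Algebra (MvPolynomial ι ℤ) F]
    [IsFractionRing (MvPolynomial ι ℤ) F] (M : Matrix n n F) (hM : M.det ≠ 0) :
    ∃ N : ℕ, 0 < N ∧ ∀ u v : n → F, ∀ r : ℕ,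
      {m | u ⬝ᵥ (M ^ (r + N * m) *ᵥ v) = 0}.Infinite →
        ∀ m, u ⬝ᵥ (M ^ (r + N * m) *ᵥ v) = 0 := by
  let A := MvPolynomial ι ℤ
  let φ : A →+* F := algebraMap A F
  have hφ : Function.Injective φ := IsFractionRing.injective A F
  have clear : ∀ {κ : Type _} [Finite κ] (f : κ → F), ∃ (c : A) (g : κ → A), φ c ≠ 0 ∧
      ∀ i, φ (g i) = φ c * f i := by
    intro κ _ f
    obtain ⟨c, hc⟩ := IsLocalization.exist_integer_multiples_of_finite (nonZeroDivisors A) f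
    choose g hg using hc
    refine ⟨c, g, ?_, fun i => ?_⟩
    · exact (map_ne_zero_iff φ hφ).2 (nonZeroDivisors.coe_ne_zero c)
    · rw [← Algebra.smul_def]; exact hg i
  obtain ⟨c, M', hc, hM'⟩ := clear fun ij : n × n => M ij.1 ij.2
  obtain ⟨M₁, hM₁⟩ : ∃ M₁ : Matrix n n A, ∀ i j, M₁ i j = M' (i, j) :=
    ⟨Matrix.of fun i j => M' (i, j), fun _ _ => rfl⟩
  have hmap : φ.mapMatrix M₁ = φ c • M := by
    ext i j
    simp [hM₁, hM']
  have hdet : M₁.det ≠ 0 := by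
    intro h
    have h1 := RingHom.map_det φ M₁
    rw [h, map_zero, hmap, Matrix.det_smul] at h1
    exact mul_ne_zero (pow_ne_zero _ hc) hM h1.symm
  obtain ⟨N, hN, H⟩ := mvPolynomial_zeros M₁ hdet
  refine ⟨N, hN, fun u v r hinf => ?_⟩
  obtain ⟨d, u', hd, hu'⟩ := clear u
  obtain ⟨e, v', he, hv'⟩ := clear v
  have hform : ∀ k, φ (u' ⬝ᵥ (M₁ ^ k *ᵥ v')) = φ d * φ c ^ k * φ e * (u ⬝ᵥ (M ^ k *ᵥ v)) := by
    intro k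
    have h1 : φ ∘ u' = φ d • u := funext hu'
    have h2 : φ ∘ (M₁ ^ k *ᵥ v') = (φ c • M) ^ k *ᵥ (φ e • v) := by
      funext i
      have h3 : φ ∘ v' = φ e • v := funext hv'
      rw [Function.comp_apply, RingHom.map_mulVec, ← hmap, ← map_pow, ← h3]
      rfl
    rw [RingHom.map_dotProduct, h1, h2, _root_.smul_pow, smul_mulVec, mulVec_smul, smul_dotProduct,
      dotProduct_smul, dotProduct_smul]
    simp only [smul_eq_mul]
    ring
  have hiff : ∀ k, u' ⬝ᵥ (M₁ ^ k *ᵥ v') = 0 ↔ u ⬝ᵥ (M ^ k *ᵥ v) = 0 := by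
    intro k
    rw [← map_eq_zero_iff φ hφ, hform]
    simp [hc, hd, he]
  simp only [← hiff] at hinf ⊢
  exact H u' v' r hinf

end SkolemMahlerLech

/-! ### Descent from an arbitrary field of characteristic zero -/

section SkolemMahlerLech
open Matrix

/-- Restriction of scalars turns M into a matrix G over F. An element of L vanishes if all F-linear
functionals kill it, and each functional yields a scalar sequence over F governed by the same G; the
period N depends on G alone, so it serves all functionals at once. -/
theorem zeros_of_finiteDimensional {ι F L : Type*} [Field F] [Algebra (MvPolynomial ι ℤ) F]
    [IsFractionRing (MvPolynomial ι ℤ) F] [Field L] [Algebra F L] [FiniteDimensional F L]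
    {n : Type*} [Fintype n] [DecidableEq n] (M : Matrix n n L) (hM : M.det ≠ 0) (u v : n → L) :
    ∃ N : ℕ, 0 < N ∧ ∀ r : ℕ, {m | u ⬝ᵥ (M ^ (r + N * m) *ᵥ v) = 0}.Infinite →
      ∀ m, u ⬝ᵥ (M ^ (r + N * m) *ᵥ v) = 0 := by
  classical
  let g : (n → L) →ₗ[F] (n → L) := M.mulVecLin.restrictScalars F
  let b := Module.finBasis F (n → L)
  let G := LinearMap.toMatrix b b g
  have hGdet : G.det ≠ 0 := by
    rw [LinearMap.det_toMatrix]
    have hinj : Function.Injective g := Matrix.mulVec_injective_of_isUnit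
      ((Matrix.isUnit_iff_isUnit_det _).2 (isUnit_iff_ne_zero.2 hM))
    have hb : Function.Bijective g := ⟨hinj, LinearMap.injective_iff_surjective.1 hinj⟩
    exact (LinearEquiv.isUnit_det' (LinearEquiv.ofBijective g hb)).ne_zero
  obtain ⟨N, hN, H⟩ := fractionField_zeros (ι := ι) G hGdet
  refine ⟨N, hN, fun r hinf m => ?_⟩
  have hg : ∀ k w, (g ^ k) w = M ^ k *ᵥ w := by
    intro k w
    induction k with
    | zero => simp
    | succ k ih => rw [pow_succ', Module.End.mul_apply, ih, pow_succ', ← Matrix.mulVec_mulVec]; rfl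
  rw [← Module.forall_dual_apply_eq_zero_iff F]
  intro φ
  let ℓ : (n → L) →ₗ[F] F := φ.comp ((dotProductBilin F L u).restrictScalars F)
  have hℓ : ∀ k, φ (u ⬝ᵥ (M ^ k *ᵥ v)) = (fun i => ℓ (b i)) ⬝ᵥ (G ^ k *ᵥ ⇑(b.repr v)) := by
    intro k
    have h1 : G ^ k *ᵥ ⇑(b.repr v) = b.repr ((g ^ k) v) := by
      rw [show G ^ k = LinearMap.toMatrix b b (g ^ k) from LinearMap.toMatrix_pow b g k,
        LinearMap.toMatrix_mulVec_repr]
    have h2 : φ (u ⬝ᵥ (M ^ k *ᵥ v)) = ℓ ((g ^ k) v) := by rw [hg]; rfl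
    rw [h1, h2, dotProduct]
    conv_lhs => rw [← b.sum_repr ((g ^ k) v)]
    rw [map_sum]
    refine Finset.sum_congr rfl fun i _ => ?_
    rw [map_smul, smul_eq_mul, mul_comm]
  rw [hℓ]
  refine H _ _ r (hinf.mono fun m hm => ?_) m
  change _ = _
  rw [← hℓ, show u ⬝ᵥ (M ^ (r + N * m) *ᵥ v) = 0 from hm, map_zero]

/-- K is algebraic over the fraction field F of a polynomial ring over ℤ, given by a transcendence
basis. The finitely many entries of M, u and v generate a finite extension of F. -/
theorem field_zeros {K : Type*} [Field K] [CharZero K] {n : Type*} [Fintype n] [DecidableEq n]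
    (M : Matrix n n K) (hM : M.det ≠ 0) (u v : n → K) :
    ∃ N : ℕ, 0 < N ∧ ∀ r : ℕ, {m | u ⬝ᵥ (M ^ (r + N * m) *ᵥ v) = 0}.Infinite →
      ∀ m, u ⬝ᵥ (M ^ (r + N * m) *ᵥ v) = 0 := by
  obtain ⟨ι, x, hx⟩ := exists_isTranscendenceBasis' ℤ K
  let A := MvPolynomial ι ℤ
  let f : A →ₐ[ℤ] K := MvPolynomial.aeval x
  have hf : Function.Injective f := hx.1
  let _ : Algebra A K := f.toRingHom.toAlgebra
  have : FaithfulSMul A K := (faithfulSMul_iff_algebraMap_injective A K).2 hf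
  let F := FractionRing A
  let _ : Algebra F K := FractionRing.liftAlgebra A K
  have : IsScalarTower A F K := FractionRing.isScalarTower_liftAlgebra A K
  have halg : Algebra.IsAlgebraic F K := by
    rw [← IsFractionRing.comap_isAlgebraic_iff (A := A)]
    have h1 := hx.isAlgebraic
    let e : A ≃ₐ[ℤ] Algebra.adjoin ℤ (Set.range x) := hx.1.aevalEquiv
    refine Algebra.IsAlgebraic.of_ringHom_of_comp_eq (e : A →+* Algebra.adjoin ℤ (Set.range x))
      (RingHom.id K) e.surjective (fun _ _ h => h) ?_
    ext a
    · simp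
    · simp [e]
      rfl
  let S : Set K := (Set.range fun ij : n × n => M ij.1 ij.2) ∪ (Set.range u ∪ Set.range v)
  have hS : Finite S := Set.toFinite S
  let L := IntermediateField.adjoin F S
  have : FiniteDimensional F L := IntermediateField.finiteDimensional_adjoin fun y _ =>
    Algebra.IsIntegral.isIntegral y
  have hL : ∀ y ∈ S, y ∈ L := fun y hy => IntermediateField.subset_adjoin F S hy
  obtain ⟨M', hM'⟩ : ∃ M' : Matrix n n L, ∀ i j, (M' i j : K) = M i j :=
    ⟨Matrix.of fun i j => ⟨M i j, hL _ (Or.inl ⟨(i, j), rfl⟩)⟩, fun _ _ => rfl⟩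
  obtain ⟨u', hu'⟩ : ∃ u' : n → L, ∀ i, (u' i : K) = u i :=
    ⟨fun i => ⟨u i, hL _ (Or.inr (Or.inl ⟨i, rfl⟩))⟩, fun _ => rfl⟩
  obtain ⟨v', hv'⟩ : ∃ v' : n → L, ∀ i, (v' i : K) = v i :=
    ⟨fun i => ⟨v i, hL _ (Or.inr (Or.inr ⟨i, rfl⟩))⟩, fun _ => rfl⟩
  let φ : L →+* K := algebraMap L K
  have hφ : Function.Injective φ := φ.injective
  have hmap : φ.mapMatrix M' = M := by
    ext i j
    exact hM' i j
  have hdet : M'.det ≠ 0 := by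
    intro h
    have h1 := RingHom.map_det φ M'
    rw [h, map_zero, hmap] at h1
    exact hM h1.symm
  obtain ⟨N, hN, H⟩ := zeros_of_finiteDimensional (ι := ι) (F := F) M' hdet u' v'
  have hform : ∀ k, φ (u' ⬝ᵥ (M' ^ k *ᵥ v')) = u ⬝ᵥ (M ^ k *ᵥ v) := by
    intro k
    have h1 : φ ∘ u' = u := funext hu'
    have h2 : φ ∘ (M' ^ k *ᵥ v') = M ^ k *ᵥ v := by
      funext i
      have h3 : φ ∘ v' = v := funext hv'
      rw [Function.comp_apply, RingHom.map_mulVec, ← hmap, ← map_pow, ← h3]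
      rfl
    rw [RingHom.map_dotProduct, h1, h2]
  have hiff : ∀ k, u ⬝ᵥ (M ^ k *ᵥ v) = 0 ↔ u' ⬝ᵥ (M' ^ k *ᵥ v') = 0 := by
    intro k
    rw [← hform, map_eq_zero_iff φ hφ]
  refine ⟨N, hN, fun r hinf => ?_⟩
  simp only [hiff] at hinf ⊢
  exact H r hinf

end SkolemMahlerLech

/-! ### Shift-invariant spaces of sequences -/

section Shift

variable {K : Type*} [Field K]

/-- The shift `(σ a) n = a (n + 1)` on sequences. -/
def seqShift (K : Type*) [Field K] : (ℕ → K) →ₗ[K] (ℕ → K) := LinearMap.funLeft K K Nat.succ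

@[simp] theorem seqShift_apply (a : ℕ → K) (n : ℕ) : seqShift K a n = a (n + 1) := rfl

theorem seqShift_pow_apply (a : ℕ → K) (k n : ℕ) : (seqShift K ^ k) a n = a (n + k) := by
  induction k generalizing n with
  | zero => rfl
  | succ k ih => rw [pow_succ', Module.End.mul_apply, seqShift_apply, ih]; congr 1; omega

/-- `a` lies in a finite-dimensional shift-invariant space of sequences. -/
def IsRecurrent (a : ℕ → K) : Prop :=
  ∃ V : Submodule K (ℕ → K), FiniteDimensional K V ∧ (∀ v ∈ V, seqShift K v ∈ V) ∧ a ∈ V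

/-- In each residue class modulo N, the property holds everywhere or only finitely often. -/
theorem eventually_periodic_of_dichotomy {P : ℕ → Prop} {N : ℕ} (hN : 0 < N)
    (h : ∀ r, {m | P (r + N * m)}.Infinite → ∀ m, P (r + N * m)) :
    ∃ n₀, ∀ n, n₀ ≤ n → (P n ↔ P (n + N)) := by
  have h1 : ∀ r, ∃ n₀, ∀ m, n₀ ≤ m → (P (r + N * m) ↔ P (r + N * (m + 1))) := by
    intro r
    by_cases hr : {m | P (r + N * m)}.Infinite
    · exact ⟨0, fun m _ => by simp only [h r hr]⟩
    · obtain ⟨B, hB⟩ := (Set.not_infinite.1 hr).bddAbove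
      refine ⟨B + 1, fun m hm => iff_of_false (fun hP => ?_) fun hP => ?_⟩
      · have := hB hP; omega
      · have := hB hP; omega
  choose n₀ hn₀ using h1
  -- Beyond this bound the quotient n / N exceeds the threshold of the residue class of n.
  refine ⟨N * (Finset.range N).sup n₀, fun n hn => ?_⟩
  have h2 := hn₀ (n % N) (n / N) ((Finset.le_sup (f := n₀)
    (Finset.mem_range.2 (Nat.mod_lt n hN))).trans ((Nat.le_div_iff_mul_le hN).2 (by
      rwa [mul_comm])))
  rwa [mul_add, mul_one, ← add_assoc, Nat.mod_add_div] at h2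

/-- Fitting's argument: the ranges of the powers of the shift on V stabilise, and on the stable
range the shift is surjective, hence bijective. This provides the nonzero determinant required by
`field_zeros`, at the price of dropping the first k terms. -/
theorem exists_bijective_shift {a : ℕ → K} (ha : IsRecurrent a) :
    ∃ (k : ℕ) (V : Submodule K (ℕ → K)) (_ : FiniteDimensional K V)
      (f : V →ₗ[K] V), Function.Bijective f ∧ (∀ v, (f v : ℕ → K) = seqShift K v) ∧
      (seqShift K ^ k) a ∈ V := by
  obtain ⟨V, hfd, hV, ha⟩ := ha
  let g : V →ₗ[K] V := (seqShift K).restrict hV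
  obtain ⟨k, hk⟩ := Filter.eventually_atTop.1 (LinearMap.eventually_iInf_range_pow_eq g)
  have hrange : LinearMap.range (g ^ k) = LinearMap.range (g ^ (k + 1)) :=
    (hk k le_rfl).symm.trans (hk (k + 1) (by omega))
  have hgk : ∀ (j : ℕ) (v : V), ((g ^ j) v : ℕ → K) = (seqShift K ^ j) v := by
    intro j v
    induction j with
    | zero => rfl
    | succ j ih => rw [pow_succ', Module.End.mul_apply, pow_succ', Module.End.mul_apply, ← ih]; rfl
  let W : Submodule K (ℕ → K) := (LinearMap.range (g ^ k)).map V.subtype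
  have hW : ∀ w ∈ W, seqShift K w ∈ W := by
    rintro _ ⟨_, ⟨v, rfl⟩, rfl⟩
    refine ⟨(g ^ k) (g v), ⟨_, rfl⟩, ?_⟩
    rw [← Module.End.mul_apply, ← pow_succ, pow_succ', Module.End.mul_apply]
    rfl
  have hWfd : FiniteDimensional K W := inferInstance
  let f : W →ₗ[K] W := (seqShift K).restrict hW
  have hsurj : Function.Surjective f := by
    rintro ⟨_, ⟨w, hw, rfl⟩⟩
    rw [SetLike.mem_coe, hrange] at hw
    obtain ⟨v, rfl⟩ := hw
    refine ⟨⟨((g ^ k) v : V), ⟨_, ⟨v, rfl⟩, rfl⟩⟩, Subtype.ext ?_⟩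
    exact (congrArg Subtype.val (LinearMap.congr_fun (pow_succ' g k) v)).symm
  refine ⟨k, W, hWfd, f, ⟨LinearMap.injective_iff_surjective.2 hsurj, hsurj⟩, fun _ => rfl,
    ⟨(g ^ k) ⟨a, ha⟩, ⟨_, rfl⟩, hgk k ⟨a, ha⟩⟩⟩

/-- The zero set of a linear recurrence sequence over a field of characteristic zero is
eventually periodic. -/
theorem IsRecurrent.zeros_eventually_periodic [CharZero K] {a : ℕ → K} (ha : IsRecurrent a) :
    ∃ N n₀ : ℕ, 0 < N ∧ ∀ n, n₀ ≤ n → (a n = 0 ↔ a (n + N) = 0) := by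
  classical
  obtain ⟨k, V, hfd, f, hf, hfv, hk⟩ := exists_bijective_shift ha
  let b := Module.finBasis K V
  let M := LinearMap.toMatrix b b f
  have hMdet : M.det ≠ 0 := by
    rw [LinearMap.det_toMatrix]
    exact (LinearEquiv.isUnit_det' (LinearEquiv.ofBijective f hf)).ne_zero
  let v : V := ⟨(seqShift K ^ k) a, hk⟩
  have hpow : ∀ j, (((f ^ j) v : V) : ℕ → K) = (seqShift K ^ (k + j)) a := by
    intro j
    induction j with
    | zero => rfl
    | succ j ih => rw [pow_succ', Module.End.mul_apply, hfv, ih, ← add_assoc, pow_succ' _ (k + j),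
        Module.End.mul_apply]
  -- Evaluation at 0 recovers the sequence: a (k + j) is ℓ applied to the j-th iterate of the shift
  -- on v.
  let ℓ : V →ₗ[K] K := (LinearMap.proj 0).comp V.subtype
  have hform : ∀ j, (fun i => ℓ (b i)) ⬝ᵥ Matrix.mulVec (M ^ j) ⇑(b.repr v) = a (k + j) := by
    intro j
    have h1 : Matrix.mulVec (M ^ j) ⇑(b.repr v) = b.repr ((f ^ j) v) := by
      rw [show M ^ j = LinearMap.toMatrix b b (f ^ j) from LinearMap.toMatrix_pow b f j,
        LinearMap.toMatrix_mulVec_repr]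
    have h2 : ℓ ((f ^ j) v) = a (k + j) := by
      change (((f ^ j) v : V) : ℕ → K) 0 = _
      rw [hpow, seqShift_pow_apply, zero_add]
    rw [h1, ← h2, dotProduct]
    conv_rhs => rw [← b.sum_repr ((f ^ j) v)]
    rw [map_sum]
    refine Finset.sum_congr rfl fun i _ => ?_
    rw [map_smul, smul_eq_mul, mul_comm]
  obtain ⟨N, hN, H⟩ := field_zeros M hMdet (fun i => ℓ (b i)) ⇑(b.repr v)
  simp only [hform] at H
  obtain ⟨n₀, hn₀⟩ := eventually_periodic_of_dichotomy (P := fun j => a (k + j) = 0) hN H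
  refine ⟨N, k + n₀, hN, fun n hn => ?_⟩
  have := hn₀ (n - k) (by omega)
  rwa [show k + (n - k) = n by omega, show k + (n - k + N) = n + N by omega] at this

end Shift

/-! ### Rational series -/

section Rational

open Polynomial

variable (K : Type*) [Field K]

/-- The power series `N / D` with `N, D` polynomials and `D(0) ≠ 0`. -/
def ratSeries : Subring (PowerSeries K) where
  carrier := {f | ∃ N D : K[X], D.coeff 0 ≠ 0 ∧ (D : PowerSeries K) * f = N}
  mul_mem' := by
    rintro f g ⟨N, D, hD, h⟩ ⟨N', D', hD', h'⟩
    refine ⟨N * N', D * D', by simp [mul_coeff_zero, hD, hD'], ?_⟩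
    rw [coe_mul, coe_mul, ← h, ← h']
    ring
  one_mem' := ⟨1, 1, by simp, by simp⟩
  add_mem' := by
    rintro f g ⟨N, D, hD, h⟩ ⟨N', D', hD', h'⟩
    refine ⟨N * D' + N' * D, D * D', by simp [mul_coeff_zero, hD, hD'], ?_⟩
    rw [coe_mul, coe_add, coe_mul, coe_mul, ← h, ← h']
    ring
  zero_mem' := ⟨0, 1, by simp, by simp⟩
  neg_mem' := by
    rintro f ⟨N, D, hD, h⟩
    exact ⟨-N, D, hD, by rw [coe_neg, ← h, mul_neg]⟩

variable {K}

theorem coe_mem_ratSeries (p : K[X]) : (p : PowerSeries K) ∈ ratSeries K := ⟨p, 1, by simp, by simp⟩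

theorem C_mem_ratSeries (c : K) : PowerSeries.C c ∈ ratSeries K := by
  rw [← coe_C]; exact coe_mem_ratSeries _

theorem inv_mem_ratSeries {f : PowerSeries K} (hf : f ∈ ratSeries K)
    (h0 : PowerSeries.constantCoeff f ≠ 0) : f⁻¹ ∈ ratSeries K := by
  obtain ⟨N, D, hD, h⟩ := hf
  refine ⟨D, N, ?_, ?_⟩
  · have h1 := congrArg PowerSeries.constantCoeff h
    rw [map_mul, constantCoeff_coe, constantCoeff_coe] at h1
    rw [← h1]
    exact mul_ne_zero hD h0
  · rw [← h, mul_assoc, PowerSeries.mul_inv_cancel _ h0, mul_one]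

/-- A series is invertible in K[[x]] exactly when its constant term is nonzero, so the fractions N /
D with D(0) ≠ 0 are already closed under the available inverses. -/
theorem divisionClosure_eq_ratSeries :
    divisionClosure (Set.range fun p : K[X] => (p : PowerSeries K)) = ratSeries K := by
  apply le_antisymm
  · refine sInf_le ⟨?_, fun x hx y hxy _ => ?_⟩
    · rintro _ ⟨p, rfl⟩
      exact coe_mem_ratSeries p
    · have h0 : PowerSeries.constantCoeff x ≠ 0 := by
        intro h
        have := congrArg PowerSeries.constantCoeff hxy
        rw [map_mul, h, zero_mul, map_one] at this
        exact zero_ne_one this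
      have : y = x⁻¹ := by
        rw [← mul_one x⁻¹, ← hxy, ← mul_assoc, PowerSeries.inv_mul_cancel _ h0, one_mul]
      rw [this]
      exact inv_mem_ratSeries hx h0
  · rintro f ⟨N, D, hD, h⟩
    refine Subring.mem_sInf.2 fun Q hQ => ?_
    have hD' : PowerSeries.constantCoeff (D : PowerSeries K) ≠ 0 := by
      rwa [constantCoeff_coe]
    have hf : f = (D : PowerSeries K)⁻¹ * N := by
      rw [← h, ← mul_assoc, PowerSeries.inv_mul_cancel _ hD', one_mul]
    rw [hf]
    exact Q.mul_mem (hQ.2 _ (hQ.1 ⟨D, rfl⟩) _ (PowerSeries.mul_inv_cancel _ hD')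
      (PowerSeries.inv_mul_cancel _ hD')) (hQ.1 ⟨N, rfl⟩)

theorem mem_ratSeries_of_coeff_eq_zero {f : PowerSeries K} {D : K[X]} (hD : D.coeff 0 ≠ 0) (d : ℕ)
    (h : ∀ n, d ≤ n → PowerSeries.coeff n ((D : PowerSeries K) * f) = 0) : f ∈ ratSeries K := by
  refine ⟨PowerSeries.trunc d ((D : PowerSeries K) * f), D, hD, ?_⟩
  ext n
  rw [coeff_coe, PowerSeries.coeff_trunc]
  split_ifs with hn
  · rfl
  · exact h n (not_lt.1 hn)

/-- Multiplication by the reversed polynomial is, up to a delay by deg u, the recurrence operator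
u(σ). This is the dictionary between rational series and recurrences. -/
theorem coeff_reverse_mul_mk (u : K[X]) (a : ℕ → K) {n : ℕ} (hn : u.natDegree ≤ n) :
    PowerSeries.coeff n ((u.reverse : PowerSeries K) * PowerSeries.mk a) =
      ∑ i ∈ Finset.range (u.natDegree + 1), u.coeff i * a (n - u.natDegree + i) := by
  rw [PowerSeries.coeff_mul,
    Finset.Nat.sum_antidiagonal_eq_sum_range_succ
      (fun i j => PowerSeries.coeff i (u.reverse : PowerSeries K) *
        PowerSeries.coeff j (PowerSeries.mk a)),
    ← Finset.sum_range_reflect _ (u.natDegree + 1)]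
  symm
  refine Finset.sum_subset_zero_on_sdiff (Finset.range_subset_range.2 (by omega)) ?_ ?_
  · intro i hi
    simp only [Finset.mem_sdiff, Finset.mem_range] at hi
    rw [coeff_coe, coeff_reverse, revAt_eq_self_of_lt (by omega),
      coeff_eq_zero_of_natDegree_lt (by omega), zero_mul]
  · intro i hi
    simp only [Finset.mem_range] at hi
    rw [coeff_coe, coeff_reverse, revAt_le (by omega), PowerSeries.coeff_mk]
    congr 2; omega

theorem aeval_seqShift_apply (u : K[X]) (a : ℕ → K) (n : ℕ) :
    aeval (seqShift K) u a n = ∑ i ∈ Finset.range (u.natDegree + 1), u.coeff i * a (n + i) := by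
  rw [aeval_eq_sum_range, LinearMap.sum_apply, Finset.sum_apply]
  refine Finset.sum_congr rfl fun i _ => ?_
  rw [LinearMap.smul_apply, Pi.smul_apply, seqShift_pow_apply, smul_eq_mul]

/-- By Cayley–Hamilton the characteristic polynomial χ of the shift on V annihilates the sequence;
the reversal of χ, with constant term 1, is therefore a denominator. -/
theorem mk_mem_ratSeries_of_isRecurrent {a : ℕ → K} (ha : IsRecurrent a) :
    PowerSeries.mk a ∈ ratSeries K := by
  obtain ⟨V, hfd, hV, ha⟩ := ha
  let g : V →ₗ[K] V := (seqShift K).restrict hV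
  let χ := g.charpoly
  have hχ : χ.Monic := LinearMap.charpoly_monic g
  have hgk : ∀ (j : ℕ) (v : V), ((g ^ j) v : ℕ → K) = (seqShift K ^ j) v := by
    intro j v
    induction j with
    | zero => rfl
    | succ j ih => rw [pow_succ', Module.End.mul_apply, pow_succ', Module.End.mul_apply, ← ih]; rfl
  have hrec : ∀ n, ∑ i ∈ Finset.range (χ.natDegree + 1), χ.coeff i * a (n + i) = 0 := by
    intro n
    have h1 : aeval g χ = 0 := LinearMap.aeval_self_charpoly g
    rw [aeval_eq_sum_range] at h1
    have h2 := LinearMap.congr_fun h1 ⟨a, ha⟩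
    rw [LinearMap.sum_apply] at h2
    have h3 := congrFun (congrArg Subtype.val h2) n
    rw [AddSubmonoidClass.coe_finsetSum, Finset.sum_apply] at h3
    rw [← show _ = (0 : K) from h3]
    refine Finset.sum_congr rfl fun i _ => ?_
    rw [LinearMap.smul_apply, Submodule.coe_smul, hgk, Pi.smul_apply, seqShift_pow_apply,
      smul_eq_mul]
  refine mem_ratSeries_of_coeff_eq_zero (D := χ.reverse) ?_ χ.natDegree fun n hn => ?_
  · rw [coeff_zero_reverse, hχ.leadingCoeff]
    exact one_ne_zero
  · rw [coeff_reverse_mul_mk χ a hn, hrec]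

/-- The sequences g for which D·g is a polynomial of bounded degree form a finite-dimensional space,
and it is shift-invariant because x·D·(σg) = D·g - g(0)D. -/
theorem isRecurrent_of_mem_ratSeries {f : PowerSeries K} (hf : f ∈ ratSeries K) :
    IsRecurrent fun n => PowerSeries.coeff n f := by
  obtain ⟨N, D, hD, h⟩ := hf
  have hD0 : (D : PowerSeries K) ≠ 0 := by
    intro h0
    rw [coe_eq_zero_iff] at h0
    exact hD (by rw [h0, coeff_zero])
  let L : (ℕ → K) →ₗ[K] PowerSeries K :=
    { toFun := fun g => (D : PowerSeries K) * PowerSeries.mk g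
      map_add' := fun g g' => by
        rw [← mul_add]; congr 1
      map_smul' := fun c g => by
        rw [RingHom.id_apply, ← mul_smul_comm]; congr 1 }
  have hL : Function.Injective L := by
    intro g g' hgg
    have := mul_left_cancel₀ hD0 hgg
    funext n
    simpa using congrArg (PowerSeries.coeff n) this
  let M := max N.natDegree D.natDegree + 1
  let P : Submodule K (PowerSeries K) := (degreeLT K M).map (coeToPowerSeries.algHom K).toLinearMap
  have hP : FiniteDimensional K P := inferInstance
  have hmem : ∀ g, g ∈ P.comap L ↔ ∃ q : K[X], q.degree < M ∧
      (D : PowerSeries K) * PowerSeries.mk g = q := by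
    intro g
    constructor
    · rintro ⟨q, hq, hqg⟩
      refine ⟨q, mem_degreeLT.1 hq, ?_⟩
      have : L g = (q : PowerSeries K) := by rw [← hqg]; simp
      exact this
    · rintro ⟨q, hq, hqg⟩
      refine ⟨q, mem_degreeLT.2 hq, ?_⟩
      simp only [AlgHom.toLinearMap_apply, coeToPowerSeries.algHom_apply, Algebra.algebraMap_self,
        PowerSeries.map_id]
      exact hqg.symm
  have hfin : FiniteDimensional K (P.comap L) :=
    Module.Finite.of_injective (L.restrict (p := P.comap L) (q := P) fun _ hx => hx)
      fun x y hxy => Subtype.ext (hL (congrArg Subtype.val hxy))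
  refine ⟨P.comap L, hfin, fun g hg => ?_, ?_⟩
  · rw [hmem] at hg ⊢
    obtain ⟨q, hq, hqg⟩ := hg
    set r : K[X] := q - C (g 0) * D with hr
    have hX : PowerSeries.X * ((D : PowerSeries K) * PowerSeries.mk (seqShift K g)) = (r : PowerSeries K) := by
      have h1 : PowerSeries.mk g = PowerSeries.X * PowerSeries.mk (seqShift K g) +
          PowerSeries.C (g 0) := by
        ext n
        cases n with
        | zero => simp
        | succ n => simp [PowerSeries.coeff_succ_X_mul]
      rw [h1] at hqg
      rw [hr, coe_sub, coe_mul, coe_C, ← hqg]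
      ring
    have hr0 : r.coeff 0 = 0 := by
      rw [← coeff_coe, ← hX]
      simp
    have hrX : r = X * r.divX := by
      conv_lhs => rw [← divX_mul_X_add r, hr0, C_0, add_zero, mul_comm]
    refine ⟨r.divX, ?_, ?_⟩
    · have hrdeg : r.degree < M := by
        refine (degree_sub_le _ _).trans_lt (max_lt hq ?_)
        refine (degree_mul_le _ _).trans_lt ?_
        refine (add_le_add degree_C_le degree_le_natDegree).trans_lt ?_
        rw [zero_add]
        exact_mod_cast (by simp only [M]; omega : D.natDegree < M)
      by_cases h0 : r = 0
      · rw [h0, divX_zero, degree_zero]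
        exact WithBot.bot_lt_coe M
      · exact (degree_divX_lt h0).trans hrdeg
    · apply mul_left_cancel₀ (PowerSeries.X_ne_zero (R := K))
      rw [hX, ← coe_X, ← coe_mul, ← hrX]
  · rw [hmem]
    refine ⟨N, ?_, ?_⟩
    · refine degree_le_natDegree.trans_lt ?_
      exact_mod_cast (by simp only [M]; omega : N.natDegree < M)
    · rw [← h]
      congr 1
      ext n
      rw [PowerSeries.coeff_mk]

theorem mem_rationalHadamard {a : ℕ → K} :
    a ∈ rationalHadamard K ↔ PowerSeries.mk a ∈ ratSeries K := by
  unfold rationalHadamard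
  rw [divisionClosure_eq_ratSeries]
  constructor
  · rintro ⟨f, hf, h⟩
    convert hf
    ext n
    rw [PowerSeries.coeff_mk, h]
  · exact fun h => ⟨_, h, fun n => (PowerSeries.coeff_mk _ _).symm⟩

theorem mem_rationalHadamard_iff_isRecurrent {a : ℕ → K} :
    a ∈ rationalHadamard K ↔ IsRecurrent a := by
  rw [mem_rationalHadamard]
  refine ⟨fun h => ?_, mk_mem_ratSeries_of_isRecurrent⟩
  have := isRecurrent_of_mem_ratSeries h
  simpa using this

theorem coeff_mem_rationalHadamard {f : PowerSeries K} (hf : f ∈ ratSeries K) :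
    (fun n => PowerSeries.coeff n f) ∈ rationalHadamard K := by
  rw [mem_rationalHadamard]
  convert hf
  ext n
  rw [PowerSeries.coeff_mk]

/-- The shift is multiplicative for the Hadamard product, so the product of two shift-invariant
spaces is shift-invariant, and it stays finite-dimensional. -/
theorem IsRecurrent.mul {a b : ℕ → K} (ha : IsRecurrent a) (hb : IsRecurrent b) :
    IsRecurrent (a * b) := by
  obtain ⟨V, hV, hVs, ha⟩ := ha
  obtain ⟨W, hW, hWs, hb⟩ := hb
  refine ⟨V * W, ?_, fun v hv => ?_, Submodule.mul_mem_mul ha hb⟩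
  · exact Module.Finite.iff_fg.2 ((Module.Finite.iff_fg.1 hV).mul (Module.Finite.iff_fg.1 hW))
  · induction hv using Submodule.mul_induction_on' with
    | mem_mul_mem v hv w hw => exact Submodule.mul_mem_mul (hVs v hv) (hWs w hw)
    | add x _ y _ hx hy => rw [map_add]; exact add_mem hx hy

variable (K) in
/-- The rational series form a subring of `(K[[x]], ⊙)`. -/
def rationalSubring : Subring (ℕ → K) where
  carrier := rationalHadamard K
  mul_mem' {a b} ha hb := by
    rw [mem_rationalHadamard_iff_isRecurrent] at ha hb ⊢
    exact ha.mul hb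
  one_mem' := by
    rw [mem_rationalHadamard]
    refine ⟨1, 1 - X, by simp, ?_⟩
    rw [coe_sub, coe_one, coe_X, mul_comm]
    exact PowerSeries.mk_one_mul_one_sub_eq_one K
  add_mem' {a b} ha hb := by
    rw [mem_rationalHadamard] at ha hb ⊢
    exact add_mem ha hb
  zero_mem' := by
    rw [mem_rationalHadamard]
    exact zero_mem _
  neg_mem' {a} ha := by
    rw [mem_rationalHadamard] at ha ⊢
    exact neg_mem ha

theorem const_mem_rationalSubring (c : K) : (fun _ => c) ∈ rationalSubring K := by
  change _ ∈ rationalHadamard K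
  rw [mem_rationalHadamard]
  refine ⟨C c, 1 - X, by simp, ?_⟩
  have h1 : (PowerSeries.mk fun _ : ℕ => c) = PowerSeries.C c * PowerSeries.mk 1 := by
    ext n; simp
  rw [h1, coe_sub, coe_one, coe_X, coe_C, mul_comm, mul_assoc,
    PowerSeries.mk_one_mul_one_sub_eq_one K, mul_one]

theorem star_mem_ratSeries [StarRing K] {f : PowerSeries K} (hf : f ∈ ratSeries K) :
    PowerSeries.map (starRingEnd K) f ∈ ratSeries K := by
  obtain ⟨N, D, hD, h⟩ := hf
  refine ⟨N.map (starRingEnd K), D.map (starRingEnd K), ?_, ?_⟩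
  · rw [coeff_map]
    exact (_root_.map_ne_zero _).2 hD
  · rw [polynomial_map_coe, polynomial_map_coe, ← map_mul, h]

theorem star_mem_rationalSubring [StarRing K] {a : ℕ → K} (ha : a ∈ rationalSubring K) :
    star a ∈ rationalSubring K := by
  have h1 := star_mem_ratSeries (mem_rationalHadamard.1 ha)
  refine mem_rationalHadamard.2 ?_
  convert h1
  ext n
  simp [starRingEnd_apply]

open Classical in
/-- The indicator function of the zero set of a rational series is rational. -/
theorem zeroIndicator_mem_rationalSubring [CharZero K] {a : ℕ → K} (ha : a ∈ rationalSubring K) :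
    (fun n => if a n = 0 then (1 : K) else 0) ∈ rationalSubring K := by
  obtain ⟨N, n₀, hN, h⟩ :=
    (mem_rationalHadamard_iff_isRecurrent.1 ha).zeros_eventually_periodic
  refine mem_rationalHadamard.2 ?_
  -- An eventually periodic sequence times 1 - x^N is a polynomial.
  refine mem_ratSeries_of_coeff_eq_zero (D := 1 - X ^ N) (by simp [hN.ne]) (n₀ + N) fun n hn => ?_
  rw [coe_sub, coe_one, coe_pow, coe_X, sub_mul, one_mul, map_sub, PowerSeries.coeff_X_pow_mul',
    if_pos (by omega), PowerSeries.coeff_mk, PowerSeries.coeff_mk]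
  have := h (n - N) (by omega)
  rw [Nat.sub_add_cancel (by omega)] at this
  simp only [this, sub_self]

theorem seqShift_mem_rationalSubring {a : ℕ → K} (ha : a ∈ rationalSubring K) :
    seqShift K a ∈ rationalSubring K := by
  obtain ⟨V, hfd, hV, h⟩ := mem_rationalHadamard_iff_isRecurrent.1 ha
  exact mem_rationalHadamard_iff_isRecurrent.2 ⟨V, hfd, hV, hV a h⟩

theorem aeval_seqShift_mem_rationalSubring (u : K[X]) {a : ℕ → K} (ha : a ∈ rationalSubring K) :
    aeval (seqShift K) u a ∈ rationalSubring K := by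
  obtain ⟨V, hfd, hV, h⟩ := mem_rationalHadamard_iff_isRecurrent.1 ha
  refine mem_rationalHadamard_iff_isRecurrent.2 ⟨V, hfd, hV, ?_⟩
  rw [aeval_eq_sum_range, LinearMap.sum_apply]
  refine sum_mem fun i _ => ?_
  rw [LinearMap.smul_apply]
  refine V.smul_mem _ ?_
  clear * - h hV
  induction i with
  | zero => exact h
  | succ i ih => rw [pow_succ', Module.End.mul_apply]; exact hV _ ih

/-- Every non-zero polynomial in the shift maps the rational series onto themselves. -/
theorem exists_aeval_seqShift_eq {u : K[X]} (hu : u ≠ 0) {g : ℕ → K}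
    (hg : g ∈ rationalSubring K) : ∃ g' ∈ rationalSubring K, aeval (seqShift K) u g' = g := by
  have hr : PowerSeries.constantCoeff (u.reverse : PowerSeries K) ≠ 0 := by
    rw [constantCoeff_coe, coeff_zero_reverse]
    exact leadingCoeff_ne_zero.2 hu
  -- Since u(σ) is multiplication by the reversal of u followed by dropping deg u coefficients, a
  -- preimage is x^(deg u)·g divided by that reversal.
  obtain ⟨f, hf⟩ : ∃ f : PowerSeries K, f = PowerSeries.X ^ u.natDegree * PowerSeries.mk g *
    (u.reverse : PowerSeries K)⁻¹ := ⟨_, rfl⟩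
  have hfr : f ∈ ratSeries K := by
    rw [hf, ← coe_X, ← coe_pow]
    exact mul_mem (mul_mem (coe_mem_ratSeries _) (mem_rationalHadamard.1 hg))
      (inv_mem_ratSeries (coe_mem_ratSeries _) hr)
  refine ⟨_, coeff_mem_rationalHadamard hfr, ?_⟩
  funext n
  have h1 := coeff_reverse_mul_mk u (fun n => PowerSeries.coeff n f)
    (Nat.le_add_left u.natDegree n)
  have h2 : (PowerSeries.mk fun n => PowerSeries.coeff n f) = f := by
    ext n
    rw [PowerSeries.coeff_mk]
  rw [Nat.add_sub_cancel] at h1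
  rw [aeval_seqShift_apply, ← h1, h2, hf, mul_comm (_ * _) (_⁻¹), ← mul_assoc,
    PowerSeries.mul_inv_cancel _ hr, one_mul, PowerSeries.coeff_X_pow_mul, PowerSeries.coeff_mk]

/-! ### The ring of quotients of the algebra of rational series -/

/-- An element with an inverse in the ambient Hadamard algebra is automatically a non-zero-divisor,
so that condition may be dropped. -/
theorem mem_agQ {q : ℕ → K} : q ∈ agQ K ↔ ∃ a ∈ rationalSubring K, ∃ b ∈ rationalSubring K,
    ∃ b' : ℕ → K, b * b' = 1 ∧ q = a * b' := by
  constructor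
  · rintro ⟨a, ha, b, hb, -, b', h1, h2⟩
    exact ⟨a, ha, b, hb, b', h1, h2⟩
  · rintro ⟨a, ha, b, hb, b', h1, h2⟩
    refine ⟨a, ha, b, hb, fun c _ hc => ?_, b', h1, h2⟩
    rw [← one_mul c, ← h1, mul_right_comm, hc, zero_mul]

variable (K) in
/-- `𝒬` as a subring of `(K[[x]], ⊙)`. -/
def agQSubring : Subring (ℕ → K) where
  carrier := agQ K
  mul_mem' := by
    intro p q hp hq
    rw [mem_agQ] at hp hq ⊢
    obtain ⟨a, ha, b, hb, b', h1, rfl⟩ := hp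
    obtain ⟨c, hc, d, hd, d', h2, rfl⟩ := hq
    exact ⟨a * c, mul_mem ha hc, b * d, mul_mem hb hd, b' * d',
      by rw [mul_mul_mul_comm, h1, h2, one_mul], by ring⟩
  one_mem' := mem_agQ.2 ⟨1, one_mem _, 1, one_mem _, 1, one_mul _, (one_mul _).symm⟩
  add_mem' := by
    intro p q hp hq
    rw [mem_agQ] at hp hq ⊢
    obtain ⟨a, ha, b, hb, b', h1, rfl⟩ := hp
    obtain ⟨c, hc, d, hd, d', h2, rfl⟩ := hq
    exact ⟨a * d + c * b, add_mem (mul_mem ha hd) (mul_mem hc hb), b * d, mul_mem hb hd, b' * d',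
      by rw [mul_mul_mul_comm, h1, h2, one_mul],
      by linear_combination (-a * b') * h2 + (-c * d') * h1⟩
  zero_mem' := mem_agQ.2 ⟨0, zero_mem _, 1, one_mem _, 1, one_mul _, (zero_mul _).symm⟩
  neg_mem' := by
    intro p hp
    rw [mem_agQ] at hp ⊢
    obtain ⟨a, ha, b, hb, b', h1, rfl⟩ := hp
    exact ⟨-a, neg_mem ha, b, hb, b', h1, by ring⟩

theorem mem_agQSubring {q : ℕ → K} : q ∈ agQSubring K ↔ q ∈ agQ K := Iff.rfl

theorem rationalSubring_le_agQSubring : rationalSubring K ≤ agQSubring K := fun a ha =>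
  mem_agQ.2 ⟨a, ha, 1, one_mem _, 1, one_mul _, (mul_one _).symm⟩

theorem star_mem_agQSubring [StarRing K] {q : ℕ → K} (hq : q ∈ agQSubring K) :
    star q ∈ agQSubring K := by
  obtain ⟨a, ha, b, hb, b', h1, rfl⟩ := mem_agQ.1 hq
  refine mem_agQ.2 ⟨star a, star_mem_rationalSubring ha, star b, star_mem_rationalSubring hb,
    star b', ?_, ?_⟩
  · rw [← star_mul, mul_comm b', h1, star_one]
  · rw [star_mul, mul_comm]

/-- Adding to a the indicator of its zero set gives a rational series d without zero coefficients,
and b d⁻¹ is then a relative inverse of a b⁻¹. This is where the theorem of Skolem, Mahler and Lech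
enters. -/
theorem agQSubring_regular [CharZero K] {q : ℕ → K} (hq : q ∈ agQSubring K) :
    ∃ y ∈ agQSubring K, q * y * q = q := by
  classical
  obtain ⟨a, ha, b, hb, b', h1, rfl⟩ := mem_agQ.1 hq
  have hd := add_mem ha (zeroIndicator_mem_rationalSubring ha)
  set d := a + fun n => if a n = 0 then (1 : K) else 0 with hd'
  have hd0 : ∀ n, d n ≠ 0 := by
    intro n
    simp only [hd', Pi.add_apply]
    split_ifs with h <;> simp [h]
  refine ⟨b * fun n => (d n)⁻¹, mem_agQ.2 ⟨b, hb, d, hd, _, ?_, rfl⟩, ?_⟩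
  · funext n
    exact mul_inv_cancel₀ (hd0 n)
  · funext n
    have h1n : b n * b' n = 1 := congrFun h1 n
    simp only [Pi.mul_apply]
    by_cases han : a n = 0
    · simp [han]
    · have hdn : d n = a n := by simp [hd', han]
      rw [hdn]
      rw [show a n * b' n * (b n * (a n)⁻¹) * (a n * b' n)
        = (a n * (a n)⁻¹) * (b n * b' n) * (a n * b' n) by ring, mul_inv_cancel₀ han, h1n,
        one_mul, one_mul]

end Rational

/-! ### Regularity of the ideal generated by a projection -/

section Corner

variable {R : Type*} [Ring R] [StarRing R]

/-- With g a relative inverse of w*w, which lies in the corner, v = w g w* w - w satisfies w*v = 0,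
hence v*v = 0 and v = 0 by properness. So w g w* is the range projection of w. -/
theorem exists_projection_of_corner {E : Subring R}
    (hproper : ∀ x : R, star x * x = 0 → x = 0) (hstar : ∀ x ∈ E, star x ∈ E) {p : R}
    (hps : star p = p)
    (hreg : ∀ x ∈ E, ∃ g ∈ E, (p * x * p) * g * (p * x * p) = p * x * p)
    {w : R} (hw : w ∈ E) (hwp : w * p = w) :
    ∃ g ∈ E, w * g * star w * w = w ∧ star (w * g * star w) = w * g * star w := by
  have hpw : p * star w = star w := by
    conv_lhs => rw [← hps, ← star_mul, hwp]
  obtain ⟨g, hg, hgw⟩ := hreg (star w * w) (mul_mem (hstar w hw) hw)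
  have hcorner : p * (star w * w) * p = star w * w := by
    rw [← mul_assoc, hpw, mul_assoc, hwp]
  rw [hcorner] at hgw
  have h1 : w * g * star w * w = w := by
    have hv : star w * (w * g * star w * w - w) = 0 := by
      rw [mul_sub, sub_eq_zero]
      simp only [mul_assoc] at hgw ⊢
      exact hgw
    have hvv : star (w * g * star w * w - w) * (w * g * star w * w - w) = 0 := by
      have : star (w * g * star w * w - w) = (star (g * star w * w) - 1) * star w := by
        rw [sub_mul, one_mul, ← star_mul, star_sub]
        simp only [mul_assoc]
      rw [this, mul_assoc, hv, mul_zero]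
    exact sub_eq_zero.1 (hproper _ hvv)
  refine ⟨g, hg, h1, ?_⟩
  -- With Q = w g w*, this reads QQ* = Q*; taking adjoints gives QQ* = Q, so Q is self-adjoint.
  have h2 : w * g * star w * star (w * g * star w) = star (w * g * star w) := by
    have h3 : star (w * g * star w) = w * star g * star w := by
      simp only [star_mul, star_star, mul_assoc]
    rw [h3, ← mul_assoc, ← mul_assoc, h1]
  generalize w * g * star w = Q at h2 ⊢
  have h4 : Q * star Q = Q := by simpa only [star_mul, star_star] using congrArg star h2
  rw [← h2, h4]

/-- Gram–Schmidt: yz is kept a projection fixing all the yd treated so far. A new d contributes the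
component w of yd orthogonal to it, and the range projection of w, again of the form y·(…), is
added. -/
theorem exists_relative_inverse_on_list {E : Subring R}
    (hproper : ∀ x : R, star x * x = 0 → x = 0) (hstar : ∀ x ∈ E, star x ∈ E) {p : R}
    (hps : star p = p)
    (hreg : ∀ x ∈ E, ∃ g ∈ E, (p * x * p) * g * (p * x * p) = p * x * p)
    {y : R} (hy : y ∈ E) (l : List R) (hl : ∀ d ∈ l, d ∈ E ∧ d * p = d) :
    ∃ z ∈ E, star (y * z) = y * z ∧ y * z * (y * z) = y * z ∧
      ∀ d ∈ l, y * z * (y * d) = y * d := by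
  induction l with
  | nil => exact ⟨0, zero_mem _, by simp, by simp, by simp⟩
  | cons d l ih =>
    obtain ⟨z, hz, hzs, hzi, hzl⟩ := ih fun d hd => hl d (List.mem_cons_of_mem _ hd)
    obtain ⟨hd, hdp⟩ := hl d List.mem_cons_self
    have hd' : d - z * (y * d) ∈ E := sub_mem hd (mul_mem hz (mul_mem hy hd))
    obtain ⟨d', hd'E, hd'eq⟩ : ∃ d' ∈ E, d' = d - z * (y * d) := ⟨_, hd', rfl⟩
    obtain ⟨w, hw⟩ : ∃ w, w = y * d' := ⟨_, rfl⟩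
    have hwE : w ∈ E := hw ▸ mul_mem hy hd'E
    have hwp : w * p = w := by
      rw [hw, hd'eq, mul_assoc, sub_mul, mul_assoc, mul_assoc, hdp]
    obtain ⟨g, hg, hg1, hg2⟩ := exists_projection_of_corner hproper hstar hps hreg hwE hwp
    obtain ⟨P, hP⟩ : ∃ P, P = y * z := ⟨_, rfl⟩
    rw [← hP] at hzs hzi hzl
    have hwd : w = y * d - P * (y * d) := by rw [hw, hd'eq, hP]; noncomm_ring
    have hPw : P * w = 0 := by rw [hwd, mul_sub, ← mul_assoc P P, hzi, sub_self]
    have hwP : star w * P = 0 := by rw [← hzs, ← star_mul, hPw, star_zero]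
    obtain ⟨Q, hQ⟩ : ∃ Q, Q = w * g * star w := ⟨_, rfl⟩
    rw [← hQ] at hg1 hg2
    have hPQ : P * Q = 0 := by rw [hQ, ← mul_assoc, ← mul_assoc, hPw, zero_mul, zero_mul]
    have hQP : Q * P = 0 := by rw [hQ, mul_assoc, hwP, mul_zero]
    have hQQ : Q * Q = Q := by
      have h1 : Q * (w * g * star w) = w * g * star w := by
        rw [← mul_assoc, ← mul_assoc, hg1]
      rwa [← hQ] at h1
    have hyz : y * (z + d' * g * star w) = P + Q := by
      rw [mul_add, ← hP, ← mul_assoc, ← mul_assoc, ← hw, ← hQ]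
    refine ⟨z + d' * g * star w,
      add_mem hz (mul_mem (mul_mem hd'E hg) (hstar _ hwE)), ?_, ?_, ?_⟩
    · rw [hyz, star_add, hzs, hg2]
    · rw [hyz, add_mul, mul_add, mul_add, hzi, hPQ, hQP, hQQ, add_zero, zero_add]
    · intro e he
      rw [hyz, add_mul]
      rcases List.mem_cons.1 he with rfl | he
      · have h1 : y * e = P * (y * e) + w := by rw [hwd]; abel
        have h2 : Q * (y * e) = w := by
          conv_lhs => rw [h1]
          rw [mul_add, ← mul_assoc, hQP, zero_mul, zero_add, hg1]
        rw [h2, ← h1]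
      · have h2 : Q * (y * e) = 0 := by
          rw [← hzl e he, ← mul_assoc, hQP, zero_mul]
        rw [hzl e he, h2, add_zero]

/-- If the corner `pEp` is regular, then every element of the ideal `EpE` has a relative inverse
in `E`. -/
theorem regular_of_mem_ideal {E : Subring R}
    (hproper : ∀ x : R, star x * x = 0 → x = 0) (hstar : ∀ x ∈ E, star x ∈ E) {p : R}
    (hpE : p ∈ E) (hps : star p = p) (hpp : p * p = p)
    (hreg : ∀ x ∈ E, ∃ g ∈ E, (p * x * p) * g * (p * x * p) = p * x * p)
    {y : R} (hy : y ∈ AddSubgroup.closure {r | ∃ c ∈ E, ∃ d ∈ E, r = c * p * d}) :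
    ∃ z ∈ E, y * z * y = y := by
  obtain ⟨l, hl, hyl⟩ : ∃ l : List (R × R), (∀ cd ∈ l, cd.1 ∈ E ∧ cd.2 ∈ E) ∧
      y = (l.map fun cd => cd.1 * p * cd.2).sum := by
    induction hy using AddSubgroup.closure_induction with
    | mem x hx =>
      obtain ⟨c, hc, d, hd, rfl⟩ := hx
      exact ⟨[(c, d)], by simp [hc, hd], by simp⟩
    | zero => exact ⟨[], by simp, by simp⟩
    | add x y _ _ hx hy =>
      obtain ⟨l, hl, rfl⟩ := hx
      obtain ⟨l', hl', rfl⟩ := hy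
      refine ⟨l ++ l', fun cd h => ?_, by simp⟩
      rcases List.mem_append.1 h with h | h
      · exact hl cd h
      · exact hl' cd h
    | neg x _ hx =>
      obtain ⟨l, hl, rfl⟩ := hx
      refine ⟨l.map fun cd => (-cd.1, cd.2), ?_, ?_⟩
      · intro cd h
        obtain ⟨cd', h', rfl⟩ := List.mem_map.1 h
        exact ⟨neg_mem (hl _ h').1, (hl _ h').2⟩
      · rw [List.map_map, List.sum_neg, List.map_map]
        congr 2
        funext cd
        simp
  have hyE : y ∈ E := by
    rw [hyl]
    refine list_sum_mem fun x hx => ?_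
    obtain ⟨cd, h, rfl⟩ := List.mem_map.1 hx
    exact mul_mem (mul_mem (hl _ h).1 hpE) (hl _ h).2
  -- Writing y = Σ c p d, one has y* = Σ d* p c*. If yz fixes every y d* p, then (yz - 1)y y* = 0,
  -- and properness gives (yz - 1)y = 0.
  obtain ⟨z, hz, -, -, hzl⟩ := exists_relative_inverse_on_list hproper hstar hps hreg hyE
    (l.map fun cd => star cd.2 * p) (by
      intro d hd
      obtain ⟨cd, h, rfl⟩ := List.mem_map.1 hd
      exact ⟨mul_mem (hstar _ (hl _ h).2) hpE, by rw [mul_assoc, hpp]⟩)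
  refine ⟨z, hz, ?_⟩
  obtain ⟨t, ht⟩ : ∃ t, t = y * z - 1 := ⟨_, rfl⟩
  have ht0 : ∀ cd ∈ l, t * y * (star cd.2 * p) = 0 := by
    intro cd h
    have := hzl _ (List.mem_map_of_mem (f := fun cd : R × R => star cd.2 * p) h)
    rw [ht, sub_mul, sub_mul, one_mul, mul_assoc (y * z), this, sub_self]
  have hstar_y : star y = (l.map fun cd => star cd.2 * p * star cd.1).sum := by
    rw [hyl]
    change starAddEquiv _ = _
    rw [map_list_sum, List.map_map]
    congr 2
    funext cd
    change star (cd.1 * p * cd.2) = _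
    rw [star_mul, star_mul, hps, mul_assoc]
  have hty : t * y * star y = 0 := by
    rw [hstar_y, ← List.sum_map_mul_left]
    refine List.sum_eq_zero fun x hx => ?_
    obtain ⟨cd, h, rfl⟩ := List.mem_map.1 hx
    rw [← mul_assoc, ht0 cd h, zero_mul]
  have h0 : star (t * y) = 0 := by
    apply hproper
    rw [star_star, star_mul, ← mul_assoc, hty, zero_mul]
  have h1 : t * y = 0 := star_eq_zero.1 h0
  rw [ht, sub_mul, one_mul, sub_eq_zero] at h1
  exact h1

/-- Lifting of relative inverses: when y is a relative inverse of r modulo an ideal, the defect r -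
ryr lies in the ideal, and regularity of the defect suffices. -/
theorem regular_of_regular_sub {R : Type*} [Ring R] {r y z : R}
    (h : (r - r * y * r) * z * (r - r * y * r) = r - r * y * r) :
    r * (y + (1 - y * r) * z * (1 - r * y)) * r = r := by
  have h1 : r * (y + (1 - y * r) * z * (1 - r * y)) * r =
      r * y * r + (r - r * y * r) * z * (r - r * y * r) := by noncomm_ring
  rw [h1, h]
  abel

end Corner

/-! ### Toeplitz matrices -/

section Toeplitz

open Matrix

variable {K : Type*} [Field K]

/-- The index `0` of a tower. -/
def zeroIdx (W : datum₀.Tower) : Fin W.len := ⟨0, W.one_le_len⟩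

variable (K) in
/-- Families of column vectors, on which `∏_W M_{|W|}(K)` acts. -/
abbrev VectorProduct : Type _ := ∀ W : datum₀.Tower, Fin W.len → K

/-- The action of `∏_W M_{|W|}(K)` on families of column vectors. -/
def act (x : datum₀.MatrixProduct K) : VectorProduct K →+ VectorProduct K where
  toFun v W := x W *ᵥ v W
  map_zero' := funext fun _ => mulVec_zero _
  map_add' _ _ := funext fun _ => mulVec_add _ _ _

theorem act_apply (x : datum₀.MatrixProduct K) (v : VectorProduct K) (W : datum₀.Tower) :
    act x v W = x W *ᵥ v W := rfl

theorem act_mul (x y : datum₀.MatrixProduct K) (v : VectorProduct K) :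
    act (x * y) v = act x (act y v) :=
  funext fun W => (mulVec_mulVec (v W) (x W) (y W)).symm

theorem act_add (x y : datum₀.MatrixProduct K) (v : VectorProduct K) :
    act (x + y) v = act x v + act y v :=
  funext fun W => add_mulVec (x W) (y W) (v W)

theorem act_one (v : VectorProduct K) : act (1 : datum₀.MatrixProduct K) v = v :=
  funext fun W => one_mulVec (v W)

/-- The truncations of a sequence, scaled by the entries of a sequence `a`. -/
def headVec (a g : ℕ → K) : VectorProduct K := fun W i => a (W.len - 1) * g i

/-- The reversals of the truncations of a sequence, scaled by the entries of a sequence `a`. -/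
def tailVec (a g : ℕ → K) : VectorProduct K := fun W i => a (W.len - 1) * g i.rev

/-- The lower triangular Toeplitz matrices `f(s)`, for a power series `f`. -/
def toeplitzFun (f : PowerSeries K) : datum₀.MatrixProduct K := fun _ =>
  Matrix.of fun i j => if (j : ℕ) ≤ i then PowerSeries.coeff (i - j) f else 0

theorem toeplitzFun_apply (f : PowerSeries K) (W : datum₀.Tower) (i j : Fin W.len) :
    toeplitzFun f W i j = PowerSeries.coeff i (PowerSeries.X ^ (j : ℕ) * f) := by
  rw [PowerSeries.coeff_X_pow_mul']
  rfl

/-- Lower triangularity makes multiplication of power series compatible with truncation. Applied to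
the columns of a second Toeplitz matrix, this also yields multiplicativity of `toeplitz`. -/
theorem toeplitzFun_headVec (f g : PowerSeries K) (a : ℕ → K) :
    act (toeplitzFun f) (headVec a fun n => PowerSeries.coeff n g) =
      headVec a fun n => PowerSeries.coeff n (f * g) := by
  funext W i
  have hentry : ∀ l : Fin W.len, toeplitzFun f W i l =
      if (l : ℕ) ≤ i then PowerSeries.coeff (i - l) f else 0 := fun _ => rfl
  simp only [act_apply, mulVec, dotProduct, headVec, hentry]
  rw [mul_comm f g, PowerSeries.coeff_mul, Finset.Nat.sum_antidiagonal_eq_sum_range_succ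
    (fun i j => PowerSeries.coeff i g * PowerSeries.coeff j f), Finset.mul_sum,
    Fin.sum_univ_eq_sum_range (fun l => (if l ≤ (i : ℕ) then PowerSeries.coeff (i - l) f else 0) *
      (a (W.len - 1) * PowerSeries.coeff l g)) W.len]
  have hi := i.2
  symm
  refine Finset.sum_subset_zero_on_sdiff (Finset.range_subset_range.2 (by omega)) ?_ ?_
  · intro l hl
    simp only [Finset.mem_sdiff, Finset.mem_range] at hl
    rw [if_neg (by omega), zero_mul]
  · intro l hl
    simp only [Finset.mem_range] at hl
    rw [if_pos (by omega)]
    ring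

theorem headVec_one_apply (g : ℕ → K) (W : datum₀.Tower) (i : Fin W.len) :
    headVec 1 g W i = g i := one_mul _

/-- `f ↦ f(s)` as a ring homomorphism. -/
def toeplitz : PowerSeries K →+* datum₀.MatrixProduct K where
  toFun := toeplitzFun
  map_one' := by
    funext W
    ext i j
    rw [toeplitzFun_apply, mul_one, PowerSeries.coeff_X_pow, Pi.one_apply, Matrix.one_apply]
    simp only [Fin.ext_iff]
  map_mul' f g := by
    funext W
    ext i j
    -- The j-th column of g(s) is the truncation of xʲg.
    have h := congrFun (congrFun (toeplitzFun_headVec f (PowerSeries.X ^ (j : ℕ) * g) 1) W) i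
    rw [headVec_one_apply] at h
    rw [toeplitzFun_apply, mul_left_comm, ← h]
    simp only [Pi.mul_apply, Matrix.mul_apply, act_apply, mulVec, dotProduct, headVec_one_apply]
    exact Finset.sum_congr rfl fun l _ => by rw [toeplitzFun_apply g]
  map_zero' := by
    funext W
    ext i j
    simp [toeplitzFun]
  map_add' f g := by
    funext W
    ext i j
    rw [Pi.add_apply, Matrix.add_apply]
    simp only [toeplitzFun_apply, mul_add, map_add]

theorem toeplitz_apply (f : PowerSeries K) (W : datum₀.Tower) (i j : Fin W.len) :
    toeplitz f W i j = if (j : ℕ) ≤ i then PowerSeries.coeff (i - j) f else 0 := rfl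

theorem toeplitz_headVec (f : PowerSeries K) (a g : ℕ → K) :
    act (toeplitz f) (headVec a g) =
      headVec a fun n => PowerSeries.coeff n (f * PowerSeries.mk g) := by
  rw [← toeplitzFun_headVec]
  congr 2
  funext n
  rw [PowerSeries.coeff_mk]

variable (K) in
/-- The projection `p_E = e_{00}`. -/
def cornerProj : datum₀.MatrixProduct K := fun _ =>
  Matrix.of fun i j => if (i : ℕ) = 0 ∧ (j : ℕ) = 0 then 1 else 0

theorem cornerProj_apply (W : datum₀.Tower) (i j : Fin W.len) :
    cornerProj K W i j = if (i : ℕ) = 0 ∧ (j : ℕ) = 0 then 1 else 0 := rfl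

theorem cornerProj_eq_single (W : datum₀.Tower) :
    cornerProj K W = Matrix.single (zeroIdx W) (zeroIdx W) 1 := by
  ext i j
  rw [cornerProj_apply, Matrix.single_apply]
  simp only [zeroIdx, Fin.ext_iff, eq_comm (a := (0 : ℕ))]

variable (K) in
/-- The central elements `Ψ(a) = (a_{k-1} h_k)_k`. -/
def centralHom : (ℕ → K) →+* datum₀.MatrixProduct K where
  toFun a := fun W => a (W.len - 1) • (1 : Matrix (Fin W.len) (Fin W.len) K)
  map_one' := funext fun W => one_smul _ _
  map_mul' a b := funext fun W => by simp only [Pi.mul_apply, smul_mul_smul_comm, one_mul]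
  map_zero' := funext fun W => zero_smul _ _
  map_add' a b := funext fun W => add_smul _ _ _

theorem centralHom_apply (a : ℕ → K) (W : datum₀.Tower) :
    centralHom K a W = a (W.len - 1) • (1 : Matrix (Fin W.len) (Fin W.len) K) := rfl

theorem centralHom_comm (a : ℕ → K) (x : datum₀.MatrixProduct K) :
    centralHom K a * x = x * centralHom K a := by
  funext W
  simp [centralHom_apply]

theorem cornerProj_mul_self : cornerProj K * cornerProj K = cornerProj K := by
  funext W
  rw [Pi.mul_apply, cornerProj_eq_single, Matrix.single_mul_single_same, one_mul]

theorem cornerProj_mul_mul (x : datum₀.MatrixProduct K) (a : ℕ → K)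
    (h : ∀ W, x W (zeroIdx W) (zeroIdx W) = a (W.len - 1)) :
    cornerProj K * x * cornerProj K = centralHom K a * cornerProj K := by
  funext W
  simp only [Pi.mul_apply, cornerProj_eq_single, centralHom_apply, Matrix.single_mul_mul_single, h,
    one_mul, mul_one, smul_mul_assoc, Matrix.smul_single, smul_eq_mul]

section Star

variable [StarRing K]

theorem star_cornerProj : star (cornerProj K) = cornerProj K := by
  funext W
  rw [Pi.star_apply, Matrix.star_eq_conjTranspose, cornerProj_eq_single,
    Matrix.conjTranspose_single, star_one]

theorem star_centralHom (a : ℕ → K) : star (centralHom K a) = centralHom K (star a) := by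
  funext W
  rw [Pi.star_apply, centralHom_apply, centralHom_apply, star_smul, star_one, Pi.star_apply]

/-- Positive definiteness is applied to each column of each component: the diagonal entries of x*x
are the sums of conj(x_ij) x_ij over i. -/
theorem matrixProduct_star_mul_self
    (hK : ∀ (n : ℕ) (x : Fin n → K), ∑ i, star (x i) * x i = 0 → ∀ i, x i = 0)
    (x : datum₀.MatrixProduct K) (h : star x * x = 0) : x = 0 := by
  funext W
  ext i j
  have h1 := congrFun (congrFun (congrFun h W) j) j
  exact hK W.len (fun i => x W i j) h1 i

end Star

end Toeplitz

/-! ### The columns of the closure -/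

section Columns

open Matrix Polynomial

variable {K : Type*} [Field K]

variable (K) in
/-- The span of the truncations of rational series, over `𝒬`. -/
def headColumns : AddSubgroup (VectorProduct K) :=
  AddSubgroup.closure {v | ∃ a ∈ agQSubring K, ∃ g ∈ rationalSubring K, v = headVec a g}

variable (K) in
/-- The span of the truncations of rational series and of their reversals, over `𝒬`. -/
def columns : AddSubgroup (VectorProduct K) :=
  headColumns K ⊔
    AddSubgroup.closure {v | ∃ a ∈ agQSubring K, ∃ g ∈ rationalSubring K, v = tailVec a g}

theorem headVec_mem {a g : ℕ → K} (ha : a ∈ agQSubring K) (hg : g ∈ rationalSubring K) :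
    headVec a g ∈ headColumns K := AddSubgroup.subset_closure ⟨a, ha, g, hg, rfl⟩

theorem headColumns_le : headColumns K ≤ columns K := le_sup_left

theorem tailVec_mem {a g : ℕ → K} (ha : a ∈ agQSubring K) (hg : g ∈ rationalSubring K) :
    tailVec a g ∈ columns K :=
  AddSubgroup.mem_sup_right (AddSubgroup.subset_closure ⟨a, ha, g, hg, rfl⟩)

theorem columns_le_of {S : AddSubgroup (VectorProduct K)}
    (h1 : ∀ a ∈ agQSubring K, ∀ g ∈ rationalSubring K, headVec a g ∈ S)
    (h2 : ∀ a ∈ agQSubring K, ∀ g ∈ rationalSubring K, tailVec a g ∈ S) : columns K ≤ S := by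
  refine sup_le ((AddSubgroup.closure_le _).2 ?_) ((AddSubgroup.closure_le _).2 ?_)
  · rintro _ ⟨a, ha, g, hg, rfl⟩
    exact h1 a ha g hg
  · rintro _ ⟨a, ha, g, hg, rfl⟩
    exact h2 a ha g hg

theorem toeplitz_mem_headColumns {f : PowerSeries K} (hf : f ∈ ratSeries K) {v : VectorProduct K}
    (hv : v ∈ headColumns K) : act (toeplitz f) v ∈ headColumns K := by
  have : headColumns K ≤ (headColumns K).comap (act (toeplitz f)) := by
    refine (AddSubgroup.closure_le _).2 ?_
    rintro _ ⟨a, ha, g, hg, rfl⟩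
    rw [SetLike.mem_coe, AddSubgroup.mem_comap, toeplitz_headVec]
    exact headVec_mem ha (coeff_mem_rationalHadamard (mul_mem hf (mem_rationalHadamard.1 hg)))
  exact this hv

/-- Moving a reversed sequence down by one place shifts the sequence, except at the top entry: there
the product is 0 whereas the shifted vector has a_{k-1} g(k). The second term removes this value. -/
theorem toeplitz_X_tailVec (a g : ℕ → K) :
    act (toeplitz PowerSeries.X) (tailVec a g) =
      tailVec a (seqShift K g) - headVec (a * seqShift K g) (Pi.single 0 1) := by
  funext W i
  simp only [act_apply, mulVec, dotProduct, toeplitz_apply, Pi.sub_apply, headVec, tailVec,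
    seqShift_apply, Pi.mul_apply, PowerSeries.coeff_X]
  have hi := i.2
  by_cases h0 : (i : ℕ) = 0
  · rw [Finset.sum_eq_zero]
    · rw [h0, Pi.single_eq_same, Fin.val_rev, h0]
      simp
    · intro l _
      rw [h0]
      simp
  · rw [Pi.single_eq_of_ne h0, mul_zero, sub_zero, Finset.sum_eq_single ⟨i - 1, by omega⟩]
    · simp only [Fin.val_rev]
      rw [if_pos (by omega), if_pos (by omega), one_mul]
      congr 2
      omega
    · intro l _ hl
      have : (l : ℕ) ≠ i - 1 := fun h => hl (Fin.ext h)
      by_cases hli : (l : ℕ) ≤ i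
      · rw [if_pos hli, if_neg (by omega), zero_mul]
      · rw [if_neg hli, zero_mul]
    · intro h
      exact absurd (Finset.mem_univ _) h

theorem single_zero_mem_rationalSubring : (Pi.single 0 1 : ℕ → K) ∈ rationalSubring K := by
  refine mem_rationalHadamard.2 ?_
  convert one_mem (ratSeries K)
  ext n
  rw [PowerSeries.coeff_mk, PowerSeries.coeff_one, Pi.single_apply]

theorem toeplitz_C_tailVec (c : K) (a g : ℕ → K) :
    act (toeplitz (PowerSeries.C c)) (tailVec a g) = tailVec a (c • g) := by
  have h : toeplitz (PowerSeries.C c) = fun W : datum₀.Tower =>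
      c • (1 : Matrix (Fin W.len) (Fin W.len) K) := by
    funext W
    ext i j
    rw [toeplitz_apply, PowerSeries.coeff_C, Matrix.smul_apply, Matrix.one_apply]
    simp only [Fin.ext_iff]
    split_ifs <;> first | omega | simp
  funext W i
  rw [act_apply, h, smul_mulVec, one_mulVec]
  simp only [tailVec, Pi.smul_apply, smul_eq_mul]
  ring

/-- Modulo truncations, u(s) acts on reversed sequences as u(σ). -/
theorem toeplitz_polynomial_tailVec (u : K[X]) :
    ∀ a ∈ agQSubring K, ∀ g ∈ rationalSubring K,
      act (toeplitz (u : PowerSeries K)) (tailVec a g) - tailVec a (aeval (seqShift K) u g) ∈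
        headColumns K := by
  induction u using Polynomial.induction_on with
  | C c =>
    intro a ha g hg
    rw [coe_C, toeplitz_C_tailVec, aeval_C, Module.algebraMap_end_apply, sub_self]
    exact zero_mem _
  | add u v hu hv =>
    intro a ha g hg
    have h : tailVec a (aeval (seqShift K) (u + v) g) =
        tailVec a (aeval (seqShift K) u g) + tailVec a (aeval (seqShift K) v g) := by
      rw [map_add, LinearMap.add_apply]
      funext W i
      simp only [tailVec, Pi.add_apply, mul_add]
    rw [coe_add, map_add, act_add, h, add_sub_add_comm]
    exact add_mem (hu a ha g hg) (hv a ha g hg)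
  | monomial n c h =>
    intro a ha g hg
    have h1 := h a ha (seqShift K g) (seqShift_mem_rationalSubring hg)
    rw [pow_succ, ← mul_assoc, coe_mul, map_mul, act_mul, coe_X, toeplitz_X_tailVec, map_sub,
      sub_right_comm, map_mul (aeval (seqShift K)), aeval_X, Module.End.mul_apply]
    refine sub_mem h1 (toeplitz_mem_headColumns (coe_mem_ratSeries _) (headVec_mem ?_ ?_))
    · exact mul_mem ha (rationalSubring_le_agQSubring (seqShift_mem_rationalSubring hg))
    · exact single_zero_mem_rationalSubring

theorem toeplitz_mem_columns {f : PowerSeries K} (hf : f ∈ ratSeries K) {v : VectorProduct K}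
    (hv : v ∈ columns K) : act (toeplitz f) v ∈ columns K := by
  have hpoly : ∀ u : K[X], columns K ≤ (columns K).comap (act (toeplitz (u : PowerSeries K))) := by
    intro u
    refine columns_le_of (fun a ha g hg => ?_) fun a ha g hg => ?_
    · exact headColumns_le (toeplitz_mem_headColumns (coe_mem_ratSeries u) (headVec_mem ha hg))
    · have h1 := headColumns_le (toeplitz_polynomial_tailVec u a ha g hg)
      have h2 := add_mem h1 (tailVec_mem ha (aeval_seqShift_mem_rationalSubring u hg))
      rwa [sub_add_cancel] at h2
  have hinv : ∀ u : K[X], u.coeff 0 ≠ 0 →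
      columns K ≤ (columns K).comap (act (toeplitz (u : PowerSeries K)⁻¹)) := by
    intro u hu
    have hu' : PowerSeries.constantCoeff (u : PowerSeries K) ≠ 0 := by rwa [constantCoeff_coe]
    have hr := inv_mem_ratSeries (coe_mem_ratSeries u) hu'
    refine columns_le_of (fun a ha g hg => ?_) fun a ha g hg => ?_
    · exact headColumns_le (toeplitz_mem_headColumns hr (headVec_mem ha hg))
    · have hu0 : u ≠ 0 := by
        rintro rfl
        exact hu (coeff_zero 0)
      -- Since u(σ) is onto the rational series, the vector equals u(s) applied to the reversal of
      -- g' modulo truncations, and u(s)⁻¹ preserves the span of truncations.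
      obtain ⟨g', hg', rfl⟩ := exists_aeval_seqShift_eq hu0 hg
      have h1 := toeplitz_mem_headColumns hr (toeplitz_polynomial_tailVec u a ha g' hg')
      rw [map_sub, ← act_mul, ← map_mul, PowerSeries.inv_mul_cancel _ hu', map_one, act_one] at h1
      have h2 := sub_mem (tailVec_mem ha hg') (headColumns_le h1)
      rwa [sub_sub_cancel] at h2
  obtain ⟨N, D, hD, h⟩ := hf
  have hD' : PowerSeries.constantCoeff (D : PowerSeries K) ≠ 0 := by rwa [constantCoeff_coe]
  have hf' : f = (D : PowerSeries K)⁻¹ * N := by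
    rw [← h, ← mul_assoc, PowerSeries.inv_mul_cancel _ hD', one_mul]
  rw [hf', map_mul, act_mul]
  exact hinv D hD (hpoly N hv)

/-- In size k the top entries of the two kinds of vectors are a_{k-1} g(0) and a_{k-1} g(k-1). The
reversals are thus the source of the Hadamard products. -/
theorem columns_zero_entry {v : VectorProduct K} (hv : v ∈ columns K) :
    ∃ b ∈ agQSubring K, ∀ W, v W (zeroIdx W) = b (W.len - 1) := by
  let S : AddSubgroup (VectorProduct K) :=
    { carrier := {v | ∃ b ∈ agQSubring K, ∀ W, v W (zeroIdx W) = b (W.len - 1)}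
      add_mem' := by
        rintro v w ⟨b, hb, h⟩ ⟨c, hc, h'⟩
        exact ⟨b + c, add_mem hb hc, fun W => by rw [Pi.add_apply, Pi.add_apply, h, h']; rfl⟩
      zero_mem' := ⟨0, zero_mem _, fun W => rfl⟩
      neg_mem' := by
        rintro v ⟨b, hb, h⟩
        exact ⟨-b, neg_mem hb, fun W => by rw [Pi.neg_apply, Pi.neg_apply, h]; rfl⟩ }
  have : columns K ≤ S := by
    refine columns_le_of (fun a ha g hg => ?_) fun a ha g hg => ?_
    · exact ⟨a * fun _ => g 0, mul_mem ha
        (rationalSubring_le_agQSubring (const_mem_rationalSubring _)), fun W => rfl⟩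
    · refine ⟨a * g, mul_mem ha (rationalSubring_le_agQSubring hg), fun W => ?_⟩
      simp [tailVec, zeroIdx, Fin.val_rev]
  exact this hv

theorem central_cornerProj_mem_columns {a : ℕ → K} (ha : a ∈ agQSubring K) {v : VectorProduct K}
    (hv : v ∈ columns K) : act (centralHom K a * cornerProj K) v ∈ columns K := by
  obtain ⟨b, hb, h⟩ := columns_zero_entry hv
  have : act (centralHom K a * cornerProj K) v = headVec (a * b) (Pi.single 0 1) := by
    funext W i
    rw [act_mul, act_apply, act_apply, centralHom_apply, smul_mulVec, one_mulVec,
      cornerProj_eq_single, Matrix.single_mulVec, one_mul, h, headVec, Pi.smul_apply, smul_eq_mul,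
      Pi.mul_apply, mul_assoc]
    congr 2
    rw [Function.update_apply, Pi.single_apply, zeroIdx]
    simp only [Fin.ext_iff]
    split_ifs <;> simp
  rw [this]
  exact headColumns_le (headVec_mem (mul_mem ha hb) single_zero_mem_rationalSubring)

variable [StarRing K]

/-- Reversal of column vectors. -/
def revVec : VectorProduct K →+ VectorProduct K where
  toFun v W i := v W i.rev
  map_zero' := rfl
  map_add' _ _ := rfl

theorem revVec_mem_columns {v : VectorProduct K} (hv : v ∈ columns K) : revVec v ∈ columns K := by
  have : columns K ≤ (columns K).comap revVec := by
    refine columns_le_of (fun a ha g hg => tailVec_mem ha hg) fun a ha g hg => ?_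
    have : revVec (tailVec a g) = headVec a g := by
      funext W i
      simp [revVec, tailVec, headVec]
    rw [AddSubgroup.mem_comap, this]
    exact headColumns_le (headVec_mem ha hg)
  exact this hv

/-- A Toeplitz matrix is symmetric about the antidiagonal, so transposition is conjugation by the
reversal of coordinates. -/
theorem star_toeplitz_act (f : PowerSeries K) (v : VectorProduct K) :
    act (star (toeplitz f)) v =
      revVec (act (toeplitz (PowerSeries.map (starRingEnd K) f)) (revVec v)) := by
  funext W i
  simp only [act_apply, revVec, AddMonoidHom.coe_mk, ZeroHom.coe_mk, mulVec, dotProduct]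
  rw [← Equiv.sum_comp Fin.revPerm]
  refine Finset.sum_congr rfl fun j _ => ?_
  rw [Fin.revPerm_apply, Pi.star_apply, Matrix.star_apply, toeplitz_apply,
    toeplitz_apply]
  have hi := i.2
  have hj := j.2
  simp only [Fin.val_rev, PowerSeries.coeff_map, starRingEnd_apply]
  congr 1
  by_cases h : (i : ℕ) ≤ W.len - (j + 1)
  · rw [if_pos h, if_pos (by omega)]
    congr 3
    omega
  · rw [if_neg h, if_neg (by omega), star_zero]

theorem star_toeplitz_mem_columns {f : PowerSeries K} (hf : f ∈ ratSeries K) {v : VectorProduct K}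
    (hv : v ∈ columns K) : act (star (toeplitz f)) v ∈ columns K := by
  rw [star_toeplitz_act]
  exact revVec_mem_columns (toeplitz_mem_columns (star_mem_ratSeries hf) (revVec_mem_columns hv))

end Columns

/-! ### Fractions in a ring with an invertible element -/

section Fractions

variable {K : Type*} [Field K] {Q : Type*} [Ring Q] (τ : ratSeries K →+* Q)

theorem X_mem_ratSeries : (PowerSeries.X : PowerSeries K) ∈ ratSeries K := by
  rw [← Polynomial.coe_X]
  exact coe_mem_ratSeries _

variable (K) in
/-- The series `x`. -/
def ratX : ratSeries K := ⟨PowerSeries.X, X_mem_ratSeries⟩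

theorem ratX_commute (f : ratSeries K) {t : Q} (h1 : τ (ratX K) * t = 1) (h2 : t * τ (ratX K) = 1) :
    t * τ f = τ f * t := by
  have h3 : t * τ f = t * τ f * (τ (ratX K) * t) := by rw [h1, mul_one]
  rw [h3, ← mul_assoc, mul_assoc t, ← map_mul, mul_comm f, map_mul, ← mul_assoc, h2, one_mul]

/-- The subring `{f(s) s⁻ʲ}`, for rational series `f`, where `t = s⁻¹`. -/
def fractionSubring {t : Q} (h1 : τ (ratX K) * t = 1) (h2 : t * τ (ratX K) = 1) : Subring Q where
  carrier := {x | ∃ f j, x = τ f * t ^ j}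
  mul_mem' := by
    rintro _ _ ⟨f, j, rfl⟩ ⟨g, l, rfl⟩
    refine ⟨f * g, j + l, ?_⟩
    have hc : Commute (t ^ j) (τ g) := Commute.pow_left (ratX_commute τ g h1 h2) j
    rw [map_mul, pow_add, mul_assoc, ← mul_assoc (t ^ j), hc.eq, mul_assoc, mul_assoc]
  one_mem' := ⟨1, 0, by simp⟩
  add_mem' := by
    rintro _ _ ⟨f, j, rfl⟩ ⟨g, l, rfl⟩
    refine ⟨f * ratX K ^ l + g * ratX K ^ j, j + l, ?_⟩
    have hp : ∀ n, τ (ratX K) ^ n * t ^ n = 1 := fun n => by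
      have hc : Commute (τ (ratX K)) t := by rw [Commute, SemiconjBy, h1, h2]
      rw [← hc.mul_pow, h1, one_pow]
    rw [map_add, map_mul, map_mul, map_pow, map_pow, add_mul, mul_assoc, mul_assoc]
    conv_rhs => rw [add_comm j l, pow_add, ← mul_assoc (τ (ratX K) ^ l), hp, one_mul, ← pow_add,
      add_comm l j, pow_add, ← mul_assoc (τ (ratX K) ^ j), hp, one_mul]
  zero_mem' := ⟨0, 0, by simp⟩
  neg_mem' := by
    rintro _ ⟨f, j, rfl⟩
    exact ⟨-f, j, by rw [map_neg, neg_mul]⟩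

/-- A nonzero rational series is xᵐ times a rational series with nonzero constant term, so its image
is a power of the invertible element s times a unit. -/
theorem exists_inverse_of_mem_fractionSubring {t : Q} (h1 : τ (ratX K) * t = 1)
    (h2 : t * τ (ratX K) = 1) {x : Q} (hx : x ∈ fractionSubring τ h1 h2) :
    x = 0 ∨ ∃ y ∈ fractionSubring τ h1 h2, x * y = 1 ∧ y * x = 1 := by
  obtain ⟨⟨f, hf⟩, j, rfl⟩ := hx
  by_cases hf0 : f = 0
  · left
    subst hf0
    have : (⟨0, hf⟩ : ratSeries K) = 0 := rfl
    rw [this, map_zero, zero_mul]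
  right
  obtain ⟨m, g, hg0, hfg⟩ : ∃ (m : ℕ) (g : PowerSeries K), PowerSeries.constantCoeff g ≠ 0 ∧
      f = PowerSeries.X ^ m * g := by
    refine ⟨f.order.toNat, PowerSeries.divXPowOrder f, ?_, ?_⟩
    · rw [ne_eq, PowerSeries.constantCoeff_divXPowOrder_eq_zero_iff]
      exact hf0
    · exact (PowerSeries.X_pow_order_mul_divXPowOrder (f := f)).symm
  -- The power xᵐ divides the numerator, because the denominator has nonzero constant term; it can
  -- be cancelled there.
  have hg : g ∈ ratSeries K := by
    obtain ⟨N, D, hD, h⟩ := hf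
    have h3 : (N : PowerSeries K) = PowerSeries.X ^ m * ((D : PowerSeries K) * g) := by
      rw [← h, hfg]; ring
    have h4 : (Polynomial.X ^ m : K[X]) ∣ N := by
      rw [Polynomial.X_pow_dvd_iff]
      intro d hd
      rw [← Polynomial.coeff_coe, h3, PowerSeries.coeff_X_pow_mul', if_neg (not_le.2 hd)]
    obtain ⟨N', rfl⟩ := h4
    refine ⟨N', D, hD, ?_⟩
    rw [Polynomial.coe_mul, Polynomial.coe_pow, Polynomial.coe_X] at h3
    exact (mul_left_cancel₀ (pow_ne_zero _ PowerSeries.X_ne_zero) h3).symm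
  have hgi := inv_mem_ratSeries hg hg0
  have hfX : (⟨f, hf⟩ : ratSeries K) = ratX K ^ m * ⟨g, hg⟩ := Subtype.ext hfg
  have hgg : τ ⟨g, hg⟩ * τ ⟨g⁻¹, hgi⟩ = 1 := by
    rw [← map_mul, ← map_one τ]
    congr 1
    exact Subtype.ext (PowerSeries.mul_inv_cancel _ hg0)
  have hgg' : τ ⟨g⁻¹, hgi⟩ * τ ⟨g, hg⟩ = 1 := by
    rw [← hgg, ← map_mul, ← map_mul, mul_comm]
  let s : Qˣ := ⟨τ (ratX K), t, h1, h2⟩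
  let u : Qˣ := ⟨τ ⟨g, hg⟩, τ ⟨g⁻¹, hgi⟩, hgg, hgg'⟩
  have hval : τ ⟨f, hf⟩ * t ^ j = ((s ^ m * u * s⁻¹ ^ j : Qˣ) : Q) := by
    rw [hfX, map_mul, map_pow]
    simp [s, u]
  rw [hval]
  have hs : (s : Q) ∈ fractionSubring τ h1 h2 := ⟨ratX K, 0, by simp [s]⟩
  have ht : ((s⁻¹ : Qˣ) : Q) ∈ fractionSubring τ h1 h2 := ⟨1, 1, by simp [s]⟩
  have hu : ((u⁻¹ : Qˣ) : Q) ∈ fractionSubring τ h1 h2 := ⟨⟨g⁻¹, hgi⟩, 0, by simp [u]⟩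
  refine ⟨((s ^ j * u⁻¹ * s⁻¹ ^ m : Qˣ) : Q), ?_, ?_, ?_⟩
  · simp only [Units.val_mul, Units.val_pow_eq_pow_val]
    exact mul_mem (mul_mem (pow_mem hs _) hu) (pow_mem ht _)
  · rw [← Units.val_mul, ← Units.val_one]
    congr 1
    group
  · rw [← Units.val_mul, ← Units.val_one]
    congr 1
    group

end Fractions

/-! ### The `*`-regular algebra generated by rational Toeplitz matrices and `Ψ(𝒬) p_E` -/

section Regular

open Matrix

variable {K : Type*} [Field K]

theorem toeplitz_X_apply (W : datum₀.Tower) (i j : Fin W.len) :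
    toeplitz (PowerSeries.X : PowerSeries K) W i j = if (i : ℕ) = j + 1 then 1 else 0 := by
  rw [toeplitz_apply, PowerSeries.coeff_X]
  split_ifs <;> first | rfl | omega

theorem toeplitz_C (c : K) :
    toeplitz (PowerSeries.C c) = algebraMap K (datum₀.MatrixProduct K) c := by
  funext W
  ext i j
  rw [toeplitz_apply, PowerSeries.coeff_C, Pi.algebraMap_apply, Matrix.algebraMap_matrix_apply]
  simp only [Fin.ext_iff, Algebra.algebraMap_self, RingHom.id_apply]
  split_ifs <;> first | rfl | omega

theorem mk_one_mem_ratSeries : (PowerSeries.mk 1 : PowerSeries K) ∈ ratSeries K :=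
  mem_rationalHadamard.1 (one_mem (rationalSubring K))

variable [StarRing K]

theorem one_sub_shift_mul_star :
    1 - toeplitz PowerSeries.X * star (toeplitz PowerSeries.X) = cornerProj K := by
  funext W
  ext i j
  rw [Pi.sub_apply, Pi.mul_apply, Matrix.sub_apply, Matrix.mul_apply, cornerProj_apply,
    Pi.one_apply, Matrix.one_apply]
  have hterm : ∀ l : Fin W.len, toeplitz (PowerSeries.X : PowerSeries K) W i l *
      star (toeplitz (PowerSeries.X : PowerSeries K)) W l j =
      if (i : ℕ) = l + 1 ∧ (j : ℕ) = l + 1 then 1 else 0 := by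
    intro l
    rw [Pi.star_apply, Matrix.star_apply, toeplitz_X_apply, toeplitz_X_apply]
    split_ifs <;> first | omega | simp
  simp only [hterm, Fin.ext_iff]
  have hi := i.2
  by_cases h0 : (i : ℕ) = 0
  · rw [Finset.sum_eq_zero]
    · rw [sub_zero]
      split_ifs <;> first | omega | rfl
    · intro l _
      rw [if_neg (by omega)]
  · rw [Finset.sum_eq_single ⟨i - 1, by omega⟩]
    · change (if (i : ℕ) = j then (1 : K) else 0) -
        (if (i : ℕ) = i - 1 + 1 ∧ (j : ℕ) = i - 1 + 1 then 1 else 0) = _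
      split_ifs <;> first | omega | simp
    · intro l _ hl
      have : (l : ℕ) ≠ i - 1 := fun h => hl (Fin.ext h)
      rw [if_neg (by omega)]
    · intro h
      exact absurd (Finset.mem_univ _) h

/-- The last index of a tower. -/
def lastIdx (W : datum₀.Tower) : Fin W.len :=
  ⟨W.len - 1, Nat.sub_lt W.one_le_len Nat.one_pos⟩

variable (K) in
/-- The projection `1 - s* s`. -/
def topProj : datum₀.MatrixProduct K := 1 - star (toeplitz PowerSeries.X) * toeplitz PowerSeries.X

theorem topProj_apply (W : datum₀.Tower) :
    topProj K W = Matrix.single (lastIdx W) (lastIdx W) 1 := by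
  ext i j
  rw [topProj, Pi.sub_apply, Pi.mul_apply, Matrix.sub_apply, Matrix.mul_apply,
    Pi.one_apply, Matrix.one_apply, Matrix.single_apply]
  have hterm : ∀ l : Fin W.len, star (toeplitz (PowerSeries.X : PowerSeries K)) W i l *
      toeplitz (PowerSeries.X : PowerSeries K) W l j =
      if (l : ℕ) = i + 1 ∧ (l : ℕ) = j + 1 then 1 else 0 := by
    intro l
    rw [Pi.star_apply, Matrix.star_apply, toeplitz_X_apply, toeplitz_X_apply]
    split_ifs <;> first | omega | simp
  simp only [hterm, Fin.ext_iff, lastIdx]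
  have hi := i.2
  have hj := j.2
  by_cases h0 : (i : ℕ) = W.len - 1
  · rw [Finset.sum_eq_zero]
    · rw [sub_zero]
      split_ifs <;> first | omega | rfl
    · intro l _
      rw [if_neg (by omega)]
  · rw [Finset.sum_eq_single ⟨i + 1, by omega⟩]
    · change (if (i : ℕ) = j then (1 : K) else 0) -
        (if (i : ℕ) + 1 = i + 1 ∧ (i : ℕ) + 1 = j + 1 then 1 else 0) = _
      split_ifs <;> first | omega | simp
    · intro l _ hl
      have : (l : ℕ) ≠ i + 1 := fun h => hl (Fin.ext h)
      rw [if_neg (by omega)]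
    · intro h
      exact absurd (Finset.mem_univ _) h

theorem topProj_mul_toeplitz_mul (f : PowerSeries K) (W : datum₀.Tower) :
    (topProj K * toeplitz f * cornerProj K) W =
      Matrix.single (lastIdx W) (zeroIdx W) (PowerSeries.coeff (W.len - 1) f) := by
  rw [Pi.mul_apply, Pi.mul_apply, topProj_apply, cornerProj_eq_single,
    Matrix.single_mul_mul_single, one_mul, mul_one, toeplitz_apply,
    if_pos (show (zeroIdx W : ℕ) ≤ lastIdx W from Nat.zero_le _)]
  rfl

variable (K) in
/-- The matrix units `e_{k-1,0}`. -/
def linkUnit : datum₀.MatrixProduct K :=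
  topProj K * toeplitz (PowerSeries.mk 1) * cornerProj K

/-- The matrix of 1/(1-x) has all entries on and below the diagonal equal to 1, so cutting out its
lower left entry leaves a matrix unit in every size simultaneously. -/
theorem linkUnit_apply (W : datum₀.Tower) :
    linkUnit K W = Matrix.single (lastIdx W) (zeroIdx W) 1 := by
  rw [linkUnit, topProj_mul_toeplitz_mul, PowerSeries.coeff_mk]
  rfl

theorem star_linkUnit_apply (W : datum₀.Tower) :
    star (linkUnit K) W = Matrix.single (zeroIdx W) (lastIdx W) 1 := by
  rw [Pi.star_apply, linkUnit_apply, Matrix.star_eq_conjTranspose, Matrix.conjTranspose_single,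
    star_one]

/-- Consequently 1 - s*s lies in the ideal generated by p_E, and s becomes invertible modulo that
ideal. -/
theorem linkUnit_mul_star : linkUnit K * cornerProj K * star (linkUnit K) = topProj K := by
  funext W
  rw [Pi.mul_apply, Pi.mul_apply, linkUnit_apply, star_linkUnit_apply, topProj_apply,
    cornerProj_eq_single, Matrix.single_mul_single_same, Matrix.single_mul_single_same,
    one_mul, one_mul]

/-- The lower left entry of f(s) in size k is the coefficient of index k-1 of f; moved to the
corner, it realises f as an element of the Hadamard algebra. -/
theorem star_linkUnit_mul_toeplitz_mul (f : PowerSeries K) :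
    star (linkUnit K) * toeplitz f * cornerProj K =
      centralHom K (fun n => PowerSeries.coeff n f) * cornerProj K := by
  funext W
  simp only [Pi.mul_apply, star_linkUnit_apply, cornerProj_eq_single, centralHom_apply,
    Matrix.single_mul_mul_single, one_mul, mul_one, smul_mul_assoc, Matrix.smul_single,
    smul_eq_mul]
  rw [toeplitz_apply, if_pos (show (zeroIdx W : ℕ) ≤ lastIdx W from Nat.zero_le _)]
  rfl

variable (K) in
/-- The `*`-algebra generated by the rational Toeplitz matrices `f(s)` and `Ψ(𝒬) p_E`. -/
def toeplitzAlgebra : StarSubalgebra K (datum₀.MatrixProduct K) :=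
  StarAlgebra.adjoin K ({r | ∃ f ∈ ratSeries K, r = toeplitz f} ∪
    {r | ∃ a ∈ agQSubring K, r = centralHom K a * cornerProj K})

theorem toeplitz_mem {f : PowerSeries K} (hf : f ∈ ratSeries K) :
    toeplitz f ∈ toeplitzAlgebra K := StarAlgebra.subset_adjoin K _ (Or.inl ⟨f, hf, rfl⟩)

theorem central_cornerProj_mem {a : ℕ → K} (ha : a ∈ agQSubring K) :
    centralHom K a * cornerProj K ∈ toeplitzAlgebra K :=
  StarAlgebra.subset_adjoin K _ (Or.inr ⟨a, ha, rfl⟩)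

theorem cornerProj_mem : cornerProj K ∈ toeplitzAlgebra K := by
  have := central_cornerProj_mem (one_mem (agQSubring K))
  rwa [map_one, one_mul] at this

theorem topProj_mem : topProj K ∈ toeplitzAlgebra K :=
  sub_mem (one_mem _) (mul_mem (star_mem (toeplitz_mem X_mem_ratSeries))
    (toeplitz_mem X_mem_ratSeries))

theorem linkUnit_mem : linkUnit K ∈ toeplitzAlgebra K :=
  mul_mem (mul_mem topProj_mem (toeplitz_mem mk_one_mem_ratSeries)) cornerProj_mem

theorem star_central_cornerProj (a : ℕ → K) :
    star (centralHom K a * cornerProj K) = centralHom K (star a) * cornerProj K := by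
  rw [star_mul, star_cornerProj, star_centralHom, centralHom_comm]

/-- The adjoint is carried along so that the induction passes through the star of an element. -/
theorem act_mem_columns {x : datum₀.MatrixProduct K} (hx : x ∈ toeplitzAlgebra K) :
    (∀ v ∈ columns K, act x v ∈ columns K) ∧ ∀ v ∈ columns K, act (star x) v ∈ columns K := by
  have hscalar : ∀ c : K, ∀ v ∈ columns K,
      act (algebraMap K (datum₀.MatrixProduct K) c) v ∈ columns K := by
    intro c v hv
    rw [← toeplitz_C]
    exact toeplitz_mem_columns (C_mem_ratSeries c) hv
  induction hx using StarAlgebra.adjoin_induction with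
  | mem x hx =>
    rcases hx with ⟨f, hf, rfl⟩ | ⟨a, ha, rfl⟩
    · exact ⟨fun v hv => toeplitz_mem_columns hf hv, fun v hv => star_toeplitz_mem_columns hf hv⟩
    · refine ⟨fun v hv => central_cornerProj_mem_columns ha hv, fun v hv => ?_⟩
      rw [star_central_cornerProj]
      exact central_cornerProj_mem_columns (star_mem_agQSubring ha) hv
  | algebraMap c =>
    refine ⟨hscalar c, fun v hv => ?_⟩
    rw [← algebraMap_star_comm]
    exact hscalar _ v hv
  | add x y _ _ hx hy =>
    refine ⟨fun v hv => ?_, fun v hv => ?_⟩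
    · rw [act_add]
      exact add_mem (hx.1 v hv) (hy.1 v hv)
    · rw [star_add, act_add]
      exact add_mem (hx.2 v hv) (hy.2 v hv)
  | mul x y _ _ hx hy =>
    refine ⟨fun v hv => ?_, fun v hv => ?_⟩
    · rw [act_mul]
      exact hx.1 _ (hy.1 v hv)
    · rw [star_mul, act_mul]
      exact hy.2 _ (hx.2 v hv)
  | star x _ hx =>
    refine ⟨hx.2, fun v hv => ?_⟩
    rw [star_star]
    exact hx.1 v hv

/-- The corner `p_E 𝓔 p_E` is `Ψ(𝒬) p_E`. -/
theorem corner_eq {x : datum₀.MatrixProduct K} (hx : x ∈ toeplitzAlgebra K) :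
    ∃ b ∈ agQSubring K, cornerProj K * x * cornerProj K = centralHom K b * cornerProj K := by
  -- The family of first basis vectors is the truncation of the series 1, so the first column of x
  -- lies in the span.
  obtain ⟨b, hb, h⟩ := columns_zero_entry ((act_mem_columns hx).1 _
    (headColumns_le (headVec_mem (one_mem _) single_zero_mem_rationalSubring)))
  refine ⟨b, hb, cornerProj_mul_mul x b fun W => ?_⟩
  rw [← h, act_apply, mulVec, dotProduct, Finset.sum_eq_single (zeroIdx W)]
  · rw [headVec_one_apply, zeroIdx, Pi.single_eq_same, mul_one]
  · intro j _ hj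
    have : (j : ℕ) ≠ 0 := fun h => hj (Fin.ext h)
    rw [headVec_one_apply, Pi.single_eq_of_ne this, mul_zero]
  · intro h
    exact absurd (Finset.mem_univ _) h

/-- The map b ↦ Ψ(b)p_E carries the regularity of 𝒬 to the corner. -/
theorem corner_regular [CharZero K] {x : datum₀.MatrixProduct K} (hx : x ∈ toeplitzAlgebra K) :
    ∃ g ∈ toeplitzAlgebra K, (cornerProj K * x * cornerProj K) * g *
      (cornerProj K * x * cornerProj K) = cornerProj K * x * cornerProj K := by
  obtain ⟨b, hb, h⟩ := corner_eq hx
  obtain ⟨y, hy, hby⟩ := agQSubring_regular hb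
  refine ⟨_, central_cornerProj_mem hy, ?_⟩
  rw [h]
  conv_rhs => rw [← hby, map_mul, map_mul]
  have hp := cornerProj_mul_self (K := K)
  generalize cornerProj K = p at hp ⊢
  rw [mul_assoc (centralHom K b) p, ← mul_assoc p, ← centralHom_comm y p, mul_assoc _ p p, hp,
    mul_assoc (centralHom K b), mul_assoc (centralHom K y), ← mul_assoc p, ← centralHom_comm b p,
    mul_assoc _ p p, hp]
  simp only [mul_assoc]

end Regular

/-! ### The quotient by the ideal generated by p_E, and regularity -/

section Quotient

variable {K : Type*} [Field K] [StarRing K]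

variable (K) in
/-- The ideal generated by `p_E`. -/
def cornerIdeal : TwoSidedIdeal (toeplitzAlgebra K) :=
  TwoSidedIdeal.span {⟨cornerProj K, cornerProj_mem⟩}

variable (K) in
/-- The quotient map by the ideal generated by `p_E`. -/
def cornerQuot : toeplitzAlgebra K →+* (cornerIdeal K).ringCon.Quotient :=
  (cornerIdeal K).ringCon.mk'

theorem cornerQuot_eq_zero {x : toeplitzAlgebra K} : cornerQuot K x = 0 ↔ x ∈ cornerIdeal K := by
  rw [← map_zero (cornerQuot K)]
  exact (RingCon.eq _).trans (TwoSidedIdeal.mem_iff _ _).symm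

theorem mem_closure_of_mem_cornerIdeal {x : toeplitzAlgebra K} (hx : x ∈ cornerIdeal K) :
    (x : datum₀.MatrixProduct K) ∈ AddSubgroup.closure {r | ∃ c ∈ (toeplitzAlgebra K).toSubring,
      ∃ d ∈ (toeplitzAlgebra K).toSubring, r = c * cornerProj K * d} := by
  rw [cornerIdeal, TwoSidedIdeal.mem_span_iff_mem_addSubgroup_closure] at hx
  induction hx using AddSubgroup.closure_induction with
  | mem x hx =>
    obtain ⟨_, ⟨c, -, _, rfl, rfl⟩, d, -, rfl⟩ := hx
    exact AddSubgroup.subset_closure ⟨c, c.2, d, d.2, rfl⟩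
  | zero => exact zero_mem _
  | add x y _ _ hx hy => exact add_mem hx hy
  | neg x _ hx => exact neg_mem hx

variable (K) in
/-- The rational Toeplitz matrices inside the algebra they generate. -/
def ratToeplitz : ratSeries K →+* toeplitzAlgebra K :=
  (toeplitz.comp (ratSeries K).subtype).codRestrict (toeplitzAlgebra K) fun f => toeplitz_mem f.2

theorem cornerQuot_cornerProj :
    cornerQuot K ⟨cornerProj K, cornerProj_mem⟩ = 0 :=
  cornerQuot_eq_zero.2 (TwoSidedIdeal.subset_span rfl)

theorem cornerQuot_shift_mul_star :
    cornerQuot K (ratToeplitz K (ratX K)) * cornerQuot K (star (ratToeplitz K (ratX K))) = 1 := by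
  rw [← map_mul, ← map_one (cornerQuot K), eq_comm, ← sub_eq_zero, ← map_sub,
    ← cornerQuot_cornerProj]
  congr 1
  exact Subtype.ext one_sub_shift_mul_star

theorem cornerQuot_star_mul_shift :
    cornerQuot K (star (ratToeplitz K (ratX K))) * cornerQuot K (ratToeplitz K (ratX K)) = 1 := by
  have h : cornerQuot K (⟨linkUnit K, linkUnit_mem⟩ * ⟨cornerProj K, cornerProj_mem⟩ *
      star ⟨linkUnit K, linkUnit_mem⟩) = 0 := by
    rw [map_mul, map_mul, cornerQuot_cornerProj, mul_zero, zero_mul]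
  rw [← map_mul, ← map_one (cornerQuot K), eq_comm, ← sub_eq_zero, ← map_sub, ← h]
  congr 1
  exact Subtype.ext linkUnit_mul_star.symm

variable (K) in
/-- The classes of the fractions `f(s) s⁻ʲ` modulo the ideal generated by `p_E`. -/
def quotFractions : Subring (cornerIdeal K).ringCon.Quotient :=
  fractionSubring ((cornerQuot K).comp (ratToeplitz K)) (t := cornerQuot K (star (ratToeplitz K (ratX K))))
    cornerQuot_shift_mul_star cornerQuot_star_mul_shift

theorem ratToeplitz_mem_quotFractions (f : ratSeries K) :
    cornerQuot K (ratToeplitz K f) ∈ quotFractions K := ⟨f, 0, by simp⟩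

theorem star_shift_mem_quotFractions :
    cornerQuot K (star (ratToeplitz K (ratX K))) ∈ quotFractions K := ⟨1, 1, by simp⟩

theorem algebraMap_mem_quotFractions (c : K) :
    cornerQuot K (algebraMap K (toeplitzAlgebra K) c) ∈ quotFractions K := by
  have : algebraMap K (toeplitzAlgebra K) c =
      ratToeplitz K ⟨PowerSeries.C c, C_mem_ratSeries c⟩ := Subtype.ext (toeplitz_C c).symm
  rw [this]
  exact ratToeplitz_mem_quotFractions _

/-- Modulo the ideal s* is s⁻¹, so the adjoint of u(s) becomes a polynomial in s⁻¹. -/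
theorem star_polynomial_mem_quotFractions (u : K[X]) :
    cornerQuot K (star (ratToeplitz K ⟨u, coe_mem_ratSeries u⟩)) ∈ quotFractions K := by
  have hmul : ∀ (u v : K[X]), ratToeplitz K ⟨(u * v : K[X]), coe_mem_ratSeries _⟩ =
      ratToeplitz K ⟨u, coe_mem_ratSeries u⟩ * ratToeplitz K ⟨v, coe_mem_ratSeries v⟩ := by
    intro u v
    rw [← map_mul]
    congr 1
    exact Subtype.ext (Polynomial.coe_mul u v)
  induction u using Polynomial.induction_on with
  | C c =>
    have : star (ratToeplitz K ⟨(Polynomial.C c : K[X]), coe_mem_ratSeries _⟩) =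
        algebraMap K (toeplitzAlgebra K) (star c) := by
      rw [algebraMap_star_comm]
      congr 1
      apply Subtype.ext
      rw [← show toeplitz (PowerSeries.C c) = ((algebraMap K (toeplitzAlgebra K) c :
        toeplitzAlgebra K) : datum₀.MatrixProduct K) from toeplitz_C c, ← Polynomial.coe_C]
      rfl
    rw [this]
    exact algebraMap_mem_quotFractions _
  | add u v hu hv =>
    have : ratToeplitz K ⟨(u + v : K[X]), coe_mem_ratSeries _⟩ =
        ratToeplitz K ⟨u, coe_mem_ratSeries u⟩ + ratToeplitz K ⟨v, coe_mem_ratSeries v⟩ := by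
      rw [← map_add]
      congr 1
    rw [this, star_add, map_add]
    exact add_mem hu hv
  | monomial n c h =>
    have hX : ratToeplitz K ⟨(Polynomial.X : K[X]), coe_mem_ratSeries _⟩ =
        ratToeplitz K (ratX K) := by
      congr 1
      exact Subtype.ext Polynomial.coe_X
    have h1 := hmul (Polynomial.C c * Polynomial.X ^ n) Polynomial.X
    have h2 : ratToeplitz K ⟨(Polynomial.C c * Polynomial.X ^ (n + 1) : K[X]),
        coe_mem_ratSeries _⟩ = ratToeplitz K
        ⟨(Polynomial.C c * Polynomial.X ^ n * Polynomial.X : K[X]), coe_mem_ratSeries _⟩ := by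
      congr 3
      rw [pow_succ, mul_assoc]
    rw [h2, h1, star_mul, map_mul, hX]
    exact mul_mem star_shift_mem_quotFractions h

/-- From D·f = N follows f(s)*D(s)* = N(s)* modulo the ideal, where the classes of D(s)* and N(s)*
are fractions; the former can be inverted among the fractions. -/
theorem star_ratToeplitz_mem_quotFractions (f : ratSeries K) :
    cornerQuot K (star (ratToeplitz K f)) ∈ quotFractions K := by
  obtain ⟨N, D, hD, h⟩ := f.2
  have hD' : PowerSeries.constantCoeff (D : PowerSeries K) ≠ 0 := by
    rwa [Polynomial.constantCoeff_coe]
  have hprod : ratToeplitz K ⟨D, coe_mem_ratSeries D⟩ * ratToeplitz K f =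
      ratToeplitz K ⟨N, coe_mem_ratSeries N⟩ := by
    rw [← map_mul]
    congr 1
    exact Subtype.ext h
  have hinv : ratToeplitz K ⟨_, inv_mem_ratSeries (coe_mem_ratSeries D) hD'⟩ *
      ratToeplitz K ⟨D, coe_mem_ratSeries D⟩ = 1 := by
    rw [← map_mul, ← map_one (ratToeplitz K)]
    congr 1
    exact Subtype.ext (PowerSeries.inv_mul_cancel _ hD')
  have hDstar := star_polynomial_mem_quotFractions D
  have hNstar := star_polynomial_mem_quotFractions N
  rw [← hprod, star_mul, map_mul] at hNstar
  have hinv' := congrArg (fun x => cornerQuot K (star x)) hinv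
  simp only [star_mul, star_one, map_mul, map_one] at hinv'
  rcases exists_inverse_of_mem_fractionSubring _ _ _ hDstar with h0 | ⟨y, hy, hy1, -⟩
  -- The class of D(s)* is invertible in the quotient, so it can vanish only if the quotient is the
  -- zero ring.
  · rw [h0, zero_mul] at hinv'
    rw [← one_mul (cornerQuot K (star (ratToeplitz K f))), ← hinv', zero_mul]
    exact zero_mem _
  · have := mul_mem hNstar hy
    rwa [mul_assoc, hy1, mul_one] at this

theorem toeplitzAlgebra_induction {p : toeplitzAlgebra K → Prop}
    (hT : ∀ f : ratSeries K, p (ratToeplitz K f))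
    (hC : ∀ (a : ℕ → K) (ha : a ∈ agQSubring K),
      p ⟨centralHom K a * cornerProj K, central_cornerProj_mem ha⟩)
    (hK : ∀ c : K, p (algebraMap K (toeplitzAlgebra K) c))
    (hadd : ∀ x y, p x → p y → p (x + y)) (hmul : ∀ x y, p x → p y → p (x * y))
    (hstar : ∀ x, p x → p (star x)) (x : toeplitzAlgebra K) : p x := by
  obtain ⟨x, hx⟩ := x
  refine StarAlgebra.adjoin_induction (p := fun x hx => p ⟨x, hx⟩) ?_ ?_ ?_ ?_ ?_ hx
  · rintro x (⟨f, hf, rfl⟩ | ⟨a, ha, rfl⟩)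
    · exact hT ⟨f, hf⟩
    · exact hC a ha
  · exact hK
  · exact fun x y hx hy h1 h2 => hadd ⟨x, hx⟩ ⟨y, hy⟩ h1 h2
  · exact fun x y hx hy h1 h2 => hmul ⟨x, hx⟩ ⟨y, hy⟩ h1 h2
  · exact fun x hx h1 => hstar ⟨x, hx⟩ h1

/-- The elements Ψ(a)p_E die in the quotient, so only Toeplitz matrices and their adjoints matter.
Together with the inverses of nonzero fractions, this makes every nonzero class invertible. -/
theorem cornerQuot_mem_quotFractions (x : toeplitzAlgebra K) :
    cornerQuot K x ∈ quotFractions K ∧ cornerQuot K (star x) ∈ quotFractions K := by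
  have hzero : ∀ (a : ℕ → K) (ha : a ∈ agQSubring K),
      cornerQuot K ⟨centralHom K a * cornerProj K, central_cornerProj_mem ha⟩ = 0 := by
    intro a ha
    have : (⟨centralHom K a * cornerProj K, central_cornerProj_mem ha⟩ : toeplitzAlgebra K) =
        ⟨centralHom K a * cornerProj K, central_cornerProj_mem ha⟩ *
          ⟨cornerProj K, cornerProj_mem⟩ := by
      apply Subtype.ext
      change _ = centralHom K a * cornerProj K * cornerProj K
      rw [mul_assoc, cornerProj_mul_self]
    rw [this, map_mul, cornerQuot_cornerProj, mul_zero]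
  induction x using toeplitzAlgebra_induction with
  | hT f => exact ⟨ratToeplitz_mem_quotFractions f, star_ratToeplitz_mem_quotFractions f⟩
  | hC a ha =>
    refine ⟨?_, ?_⟩
    · rw [hzero a ha]
      exact zero_mem _
    · have h2 : star (⟨centralHom K a * cornerProj K, central_cornerProj_mem ha⟩ :
          toeplitzAlgebra K) = ⟨centralHom K (star a) * cornerProj K,
            central_cornerProj_mem (star_mem_agQSubring ha)⟩ :=
        Subtype.ext (star_central_cornerProj a)
      rw [h2, hzero (star a) (star_mem_agQSubring ha)]
      exact zero_mem _
  | hK c =>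
    refine ⟨algebraMap_mem_quotFractions c, ?_⟩
    rw [← algebraMap_star_comm]
    exact algebraMap_mem_quotFractions _
  | hadd x y hx hy =>
    rw [star_add, map_add, map_add]
    exact ⟨add_mem hx.1 hy.1, add_mem hx.2 hy.2⟩
  | hmul x y hx hy =>
    rw [star_mul, map_mul, map_mul]
    exact ⟨mul_mem hx.1 hy.1, mul_mem hy.2 hx.2⟩
  | hstar x hx =>
    rw [star_star]
    exact ⟨hx.2, hx.1⟩

theorem exists_preimage_of_mem_quotFractions {y : (cornerIdeal K).ringCon.Quotient}
    (hy : y ∈ quotFractions K) : ∃ x, cornerQuot K x = y := by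
  obtain ⟨f, j, rfl⟩ := hy
  exact ⟨ratToeplitz K f * star (ratToeplitz K (ratX K)) ^ j, by rw [map_mul, map_pow]; rfl⟩

/-- The `*`-algebra generated by the rational Toeplitz matrices and `Ψ(𝒬) p_E` is `*`-regular. -/
theorem toeplitzAlgebra_isStarRegular [CharZero K]
    (hK : ∀ (n : ℕ) (x : Fin n → K), ∑ i, star (x i) * x i = 0 → ∀ i, x i = 0) :
    IsStarRegularSubring (toeplitzAlgebra K).toSubring := by
  have hproper := matrixProduct_star_mul_self hK
  refine ⟨fun x hx => (toeplitzAlgebra K).star_mem' hx, fun x hx => ?_,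
    fun x _ => hproper x⟩
  have hideal : ∀ y : toeplitzAlgebra K, cornerQuot K y = 0 → ∃ z : toeplitzAlgebra K,
      y * z * y = y := by
    intro y hy
    obtain ⟨z, hz, h⟩ := regular_of_mem_ideal (E := (toeplitzAlgebra K).toSubring) hproper
      (fun x hx => (toeplitzAlgebra K).star_mem' hx)
      cornerProj_mem star_cornerProj cornerProj_mul_self (fun x hx => corner_regular hx)
      (mem_closure_of_mem_cornerIdeal (cornerQuot_eq_zero.1 hy))
    exact ⟨⟨z, hz⟩, Subtype.ext h⟩
  obtain ⟨r, hr⟩ : ∃ r : toeplitzAlgebra K, (r : datum₀.MatrixProduct K) = x := ⟨⟨x, hx⟩, rfl⟩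
  suffices ∃ z : toeplitzAlgebra K, r * z * r = r by
    obtain ⟨z, hz⟩ := this
    refine ⟨z, z.2, ?_⟩
    rw [← hr]
    exact congrArg Subtype.val hz
  rcases exists_inverse_of_mem_fractionSubring _ _ _ (cornerQuot_mem_quotFractions r).1 with
    h0 | ⟨y, hy, hy1, -⟩
  · exact hideal r h0
  · obtain ⟨y, rfl⟩ := exists_preimage_of_mem_quotFractions hy
    -- As y inverts r modulo the ideal, the defect r - ryr lies in the ideal, where relative
    -- inverses exist.
    obtain ⟨z, hz⟩ := hideal (r - r * y * r) (by
      rw [map_sub, map_mul, map_mul, hy1, one_mul, sub_self])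
    exact ⟨_, regular_of_regular_sub hz⟩

end Quotient

/-! ### Towers of the first lamplighter approximating algebra -/

section Towers

/-- The translate `Tⁿ x`. -/
def trans (n : ℤ) (x : ℤ → Fin 2) : ℤ → Fin 2 := fun i => x (i + n)

theorem trans_trans (m n : ℤ) (x : ℤ → Fin 2) : trans m (trans n x) = trans (m + n) x := by
  funext i
  simp only [trans]
  congr 1
  ring

theorem trans_zero (x : ℤ → Fin 2) : trans 0 x = x := by
  funext i
  simp [trans]

theorem datum_T_zpow (n : ℤ) (x : ℤ → Fin 2) : (datum₀.T ^ n) x = trans n x :=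
  funext fun i => shift_pow n x i

theorem mem_tr_iff (n : ℤ) (U : Set (ℤ → Fin 2)) (x : ℤ → Fin 2) :
    x ∈ datum₀.tr n U ↔ trans (-n) x ∈ U := mem_tr₀ n U x

theorem mem_E_iff (x : ℤ → Fin 2) : x ∈ datum₀.E ↔ x 0 = 1 := Iff.rfl

theorem eq_zero_iff_ne_one (a : Fin 2) : a = 0 ↔ a ≠ 1 := by
  revert a
  decide

theorem off_eq_zeros (i : ℕ) : datum₀.off i = zeros i := by
  ext x
  simp only [Datum.off, zeros, mem_tr_iff, mem_E_iff, trans, Set.mem_ofPred_eq, zero_add]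
  exact forall₂_congr fun j _ => (eq_zero_iff_ne_one _).symm

theorem mem_base_iff (W : datum₀.Tower) (x : ℤ → Fin 2) :
    x ∈ W.base ↔ x 0 = 1 ∧ (∀ j : ℕ, 1 ≤ j → j < W.len → x j = 0) ∧ x W.len = 1 := by
  obtain ⟨Z, hZ, h⟩ := W.exists_pieces
  rw [h, and_assoc.symm]
  simp only [Set.mem_inter_iff, mem_tr_iff, mem_E_iff, Set.mem_ofPred_eq, trans, neg_neg, zero_add]
  refine and_congr_left' (and_congr_right' (forall₃_congr fun j h1 h2 => ?_))
  have : Z j = {x | x 0 = 0} := hZ j h1 h2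
  rw [this]
  change (trans j x) 0 = 0 ↔ _
  simp [trans]

/-- The tower of length `k + 1`. -/
def tower (k : ℕ) : datum₀.Tower where
  len := k + 1
  base := datum₀.E ∩ {x | ∀ j : ℕ, 1 ≤ j → j < k + 1 → x ∈ datum₀.tr (-j) {x | x 0 = 0}} ∩
    datum₀.tr (-(k + 1 : ℕ)) datum₀.E
  one_le_len := by omega
  nonempty := by
    refine ⟨fun i => if 1 ≤ i ∧ i < k + 1 then 0 else 1, ⟨?_, fun j h1 h2 => ?_⟩, ?_⟩
    · simp [mem_E_iff]
    · rw [mem_tr_iff]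
      change (if _ then _ else _) = _
      rw [if_pos (by omega)]
    · rw [mem_tr_iff]
      change (if _ then _ else _) = _
      rw [if_neg (by omega)]
  exists_pieces := ⟨fun _ => {x | x 0 = 0}, fun _ _ _ => rfl, rfl⟩

theorem isClopen_base (W : datum₀.Tower) : IsClopen W.base := by
  have : W.base = datum₀.E ∩ (⋂ j ∈ Finset.Ico 1 W.len, datum₀.tr (-(j : ℕ)) datum₀.Eᶜ) ∩
      datum₀.tr (-(W.len : ℤ)) datum₀.E := by
    ext x
    rw [mem_base_iff]
    simp only [Set.mem_inter_iff, mem_tr_iff, mem_E_iff, Set.mem_iInter, Finset.mem_Ico,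
      Set.mem_compl_iff, trans, neg_neg, zero_add, and_imp, ← eq_zero_iff_ne_one, and_assoc,
      ← ne_eq]
  rw [this]
  exact (datum₀.isClopen_E.inter ((Finset.Ico 1 W.len).finite_toSet.isClopen_biInter
    fun j _ => datum₀.isClopen_tr datum₀.isClopen_E.compl _)).inter
    (datum₀.isClopen_tr datum₀.isClopen_E _)

variable {W : datum₀.Tower} {x : ℤ → Fin 2}

theorem base_zero (hx : x ∈ W.base) : x 0 = 1 := ((mem_base_iff W x).1 hx).1

theorem base_len (hx : x ∈ W.base) : x W.len = 1 := ((mem_base_iff W x).1 hx).2.2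

theorem base_mid (hx : x ∈ W.base) {n : ℤ} (h1 : 1 ≤ n) (h2 : n < W.len) : x n = 0 := by
  have := ((mem_base_iff W x).1 hx).2.1 n.toNat (by omega) (by omega)
  rwa [Int.toNat_of_nonneg (by omega)] at this

theorem trans_mem_zeros (hx : x ∈ W.base) {i : ℕ} (hi : i < W.len) : trans i x ∈ zeros i := by
  intro j hj
  exact base_mid hx (by omega) (by omega)

theorem trans_not_mem_off (hx : x ∈ W.base) {i n : ℕ} (hn : i < n) :
    trans i x ∉ datum₀.off n := by
  rw [off_eq_zeros]
  intro h
  have h0 : x (-(i : ℤ) + i) = 0 := h i hn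
  rw [neg_add_cancel, base_zero hx] at h0
  exact absurd h0 (by decide)

theorem trans_mem_off (hx : x ∈ W.base) {i n : ℕ} (hn : n ≤ i) (hi : i < W.len) :
    trans i x ∈ datum₀.off n := by
  rw [off_eq_zeros]
  intro j hj
  exact base_mid hx (by omega) (by omega)

/-- The levels of a tower are disjoint. -/
theorem level_unique (hx : x ∈ W.base) {i j : ℕ} (hi : i < W.len) (hj : j < W.len)
    (h : trans ((i : ℤ) - j) x ∈ W.base) : i = j := by
  rcases lt_trichotomy i j with hij | hij | hij
  · have h1 := base_mid h (n := (j : ℤ) - i) (by omega) (by omega)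
    rw [trans, sub_add_sub_cancel, sub_self, base_zero hx] at h1
    exact absurd h1 (by decide)
  · exact hij
  · have h1 := base_zero h
    rw [trans, zero_add, base_mid hx (by omega) (by omega)] at h1
    exact absurd h1 (by decide)

end Towers

/-! ### Images in the product of matrix algebras -/

section Images

open SkewMonoidAlgebra Multiplicative CrossedProduct

variable {K : Type*} [Field K] [StarRing K]

theorem coef_act_apply (n : ℤ) (f : Coef datum₀.T K) (x : ℤ → Fin 2) :
    (ofAdd n • f) x = f (trans (-n) x) := by
  rw [Coef.act_apply, datum_T_zpow, toAdd_ofAdd]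

theorem coef_sum_apply {ι : Type*} (s : Finset ι) (f : ι → Coef datum₀.T K) (x : ℤ → Fin 2) :
    (∑ i ∈ s, f i) x = ∑ i ∈ s, f i x :=
  map_sum (AddMonoidHom.mk' (fun g : Coef datum₀.T K => g x) fun _ _ => rfl) f s

/-- The value at `x` of the coefficient of `tⁿ`. -/
def value (n : ℤ) (x : ℤ → Fin 2) : CrossedProduct datum₀.T K →+ K where
  toFun a := a.coeff (ofAdd n) x
  map_zero' := by rw [coeff_zero]; rfl
  map_add' a b := by rw [coeff_add]; rfl

theorem eq_of_value {a b : CrossedProduct datum₀.T K} (h : ∀ n x, value n x a = value n x b) :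
    a = b :=
  SkewMonoidAlgebra.ext fun n => Coef.ext fun x => h (toAdd n) x

theorem value_smul (n : ℤ) (x : ℤ → Fin 2) (c : K) (a : CrossedProduct datum₀.T K) :
    value n x (c • a) = c * value n x a := by
  change (c • a).coeff (ofAdd n) x = _
  rw [coeff_smul]
  rfl

theorem value_mono (m n : ℤ) (f : Coef datum₀.T K) (x : ℤ → Fin 2) :
    value n x (mono m f) = if m = n then f x else 0 := by
  classical
  change (single (ofAdd m) f).coeff (ofAdd n) x = _
  rw [coeff_single_apply]
  simp only [ofAdd.injective.eq_iff]
  split_ifs <;> rfl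

theorem value_mono_mul (m n : ℤ) (f : Coef datum₀.T K) (a : CrossedProduct datum₀.T K)
    (x : ℤ → Fin 2) : value n x (mono m f * a) = f x * value (n - m) (trans (-m) x) a := by
  change (single (ofAdd m) f * a).coeff (ofAdd n) x = _
  rw [coeff_single_mul_aux a (z := ofAdd (n - m)) fun b => by
    rw [ofAdd_sub, eq_div_iff_mul_eq', mul_comm], Coef.mul_apply, coef_act_apply]
  rfl

open Classical in
theorem value_unit (W : datum₀.Tower) (i j : Fin W.len) (n : ℤ) (y : ℤ → Fin 2) :
    value n y (datum₀.unit K W i j) =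
      if (i : ℤ) - j = n ∧ trans (-i) y ∈ W.base then 1 else 0 := by
  rw [Datum.unit, ← star_pow, Datum.s_pow, Datum.s_pow, const_apply, star_mono, mono_mul, mono_mul,
    value_mono, add_zero, ← sub_eq_add_neg]
  rw [ite_and]
  refine if_congr Iff.rfl ?_ rfl
  rw [Coef.mul_apply, Coef.mul_apply, coef_act_apply, coef_act_apply, coef_act_apply,
    Datum.star_chi, Coef.chi_apply (datum₀.isClopen_off _), Coef.chi_apply (datum₀.isClopen_off _),
    Coef.chi_apply (isClopen_base W), trans_trans, neg_neg]
  by_cases h : trans (-i) y ∈ W.base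
  · have hy : y = trans i (trans (-i) y) := by rw [trans_trans, add_neg_cancel, trans_zero]
    have h1 := trans_mem_off h le_rfl i.2
    have h2 : trans (j + -i) y ∈ datum₀.off j := by
      rw [← trans_trans]
      exact trans_mem_off h le_rfl j.2
    rw [← hy] at h1
    rw [if_pos h, if_pos h1, if_pos h2, mul_one, mul_one]
  · rw [if_neg h, mul_zero, zero_mul]

theorem unit_eq_mono (W : datum₀.Tower) (i j : Fin W.len) :
    datum₀.unit K W i j = mono ((i : ℤ) - j) (datum₀.chi K (datum₀.tr i W.base)) := by
  classical
  refine eq_of_value fun n y => ?_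
  rw [value_unit, value_mono, Coef.chi_apply (datum₀.isClopen_tr (isClopen_base W) _), mem_tr_iff,
    ite_and]

/-- Multiplication by h_W restricts coefficients to the levels of the tower over W; since these are
disjoint, exactly one diagonal unit contributes at a given point. -/
theorem h_mul_value (W : datum₀.Tower) (a : CrossedProduct datum₀.T K) (n : ℤ) {x : ℤ → Fin 2}
    (hx : x ∈ W.base) (i : Fin W.len) :
    value n (trans i x) (datum₀.h K W * a) = value n (trans i x) a := by
  classical
  have hunit (j : Fin W.len) : datum₀.unit K W j j = mono 0 (datum₀.chi K (datum₀.tr j W.base)) := by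
    rw [unit_eq_mono, sub_self]
  rw [Datum.h, Finset.sum_mul, _root_.map_sum, Finset.sum_eq_single i]
  · rw [hunit, value_mono_mul, Coef.chi_apply (datum₀.isClopen_tr (isClopen_base W) _), mem_tr_iff,
      trans_trans, neg_add_cancel, trans_zero, if_pos hx, one_mul, sub_zero, neg_zero, trans_zero]
  · intro j _ hj
    rw [hunit, value_mono_mul, Coef.chi_apply (datum₀.isClopen_tr (isClopen_base W) _), mem_tr_iff,
      trans_trans, if_neg, zero_mul]
    intro h
    rw [neg_add_eq_sub] at h
    exact hj (Fin.ext (level_unique hx i.2 j.2 h)).symm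
  · simp

theorem sum_unit_value (W : datum₀.Tower) (r : Matrix (Fin W.len) (Fin W.len) K) (n : ℤ)
    {x : ℤ → Fin 2} (hx : x ∈ W.base) (i : Fin W.len) :
    value n (trans i x) (∑ i, ∑ j, r i j • datum₀.unit K W i j) =
      ∑ j : Fin W.len, if (i : ℤ) - j = n then r i j else 0 := by
  classical
  rw [_root_.map_sum, Finset.sum_eq_single i]
  · rw [_root_.map_sum]
    refine Finset.sum_congr rfl fun j _ => ?_
    rw [value_smul, value_unit, trans_trans, neg_add_cancel, trans_zero]
    simp [hx]
  · intro k _ hk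
    rw [_root_.map_sum]
    refine Finset.sum_eq_zero fun j _ => ?_
    rw [value_smul, value_unit, trans_trans, if_neg, mul_zero]
    rintro ⟨-, h⟩
    rw [neg_add_eq_sub] at h
    exact hk (Fin.ext (level_unique hx i.2 k.2 h)).symm
  · simp

theorem h_mul_value_of_not_mem (W : datum₀.Tower) (a : CrossedProduct datum₀.T K) (n : ℤ)
    {y : ℤ → Fin 2} (hy : ∀ i : Fin W.len, trans (-i) y ∉ W.base) :
    value n y (datum₀.h K W * a) = 0 := by
  classical
  have hunit (j : Fin W.len) : datum₀.unit K W j j = mono 0 (datum₀.chi K (datum₀.tr j W.base)) := by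
    rw [unit_eq_mono, sub_self]
  rw [Datum.h, Finset.sum_mul, _root_.map_sum]
  refine Finset.sum_eq_zero fun j _ => ?_
  rw [hunit, value_mono_mul, Coef.chi_apply (datum₀.isClopen_tr (isClopen_base W) _), mem_tr_iff,
    if_neg (hy j), zero_mul]

theorem sum_unit_value_of_not_mem (W : datum₀.Tower) (r : Matrix (Fin W.len) (Fin W.len) K) (n : ℤ)
    {y : ℤ → Fin 2} (hy : ∀ i : Fin W.len, trans (-i) y ∉ W.base) :
    value n y (∑ i, ∑ j, r i j • datum₀.unit K W i j) = 0 := by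
  classical
  rw [_root_.map_sum]
  refine Finset.sum_eq_zero fun i _ => ?_
  rw [_root_.map_sum]
  refine Finset.sum_eq_zero fun j _ => ?_
  rw [value_smul, value_unit, if_neg fun h => hy i h.2, mul_zero]

/-- The component of the image at a tower, in terms of the values of the coefficients. -/
theorem h_mul_eq_iff (W : datum₀.Tower) (a : CrossedProduct datum₀.T K)
    (r : Matrix (Fin W.len) (Fin W.len) K) :
    datum₀.h K W * a = ∑ i, ∑ j, r i j • datum₀.unit K W i j ↔
      ∀ x ∈ W.base, ∀ (i : Fin W.len) (n : ℤ), value n (trans i x) a =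
        ∑ j : Fin W.len, if (i : ℤ) - j = n then r i j else 0 := by
  constructor
  · intro h x hx i n
    rw [← h_mul_value W a n hx i, h, sum_unit_value W r n hx i]
  · intro h
    refine eq_of_value fun n y => ?_
    by_cases hy : ∃ i : Fin W.len, trans (-i) y ∈ W.base
    · obtain ⟨i, hi⟩ := hy
      have hy : y = trans i (trans (-i) y) := by rw [trans_trans, add_neg_cancel, trans_zero]
      rw [hy, h_mul_value W a n hi i, sum_unit_value W r n hi i]
      exact h _ hi i n
    · rw [not_exists] at hy
      rw [h_mul_value_of_not_mem W a n hy, sum_unit_value_of_not_mem W r n hy]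

theorem isImage_iff {a : CrossedProduct datum₀.T K} {r : datum₀.MatrixProduct K} :
    datum₀.IsImage K a r ↔ ∀ W : datum₀.Tower, ∀ x ∈ W.base, ∀ (i : Fin W.len) (n : ℤ),
      value n (trans i x) a = ∑ j : Fin W.len, if (i : ℤ) - j = n then r W i j else 0 :=
  forall_congr' fun W => h_mul_eq_iff W a (r W)

theorem sum_diagonal {k : ℕ} (i j : Fin k) (f : Fin k → K) :
    (∑ l : Fin k, if (i : ℤ) - l = (i : ℤ) - j then f l else 0) = f j := by
  rw [Finset.sum_eq_single j]
  · rw [if_pos rfl]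
  · intro l _ hl
    rw [if_neg]
    intro h
    exact hl (Fin.ext (by omega))
  · simp

theorem isImage_apply {a : CrossedProduct datum₀.T K} {r : datum₀.MatrixProduct K}
    (h : datum₀.IsImage K a r) {W : datum₀.Tower} {x : ℤ → Fin 2} (hx : x ∈ W.base)
    (i j : Fin W.len) : r W i j = value ((i : ℤ) - j) (trans i x) a := by
  rw [isImage_iff.1 h W x hx i, sum_diagonal]

theorem isImage_unique {a : CrossedProduct datum₀.T K} {r r' : datum₀.MatrixProduct K}
    (h : datum₀.IsImage K a r) (h' : datum₀.IsImage K a r') : r = r' := by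
  funext W
  ext i j
  obtain ⟨x, hx⟩ := W.nonempty
  rw [isImage_apply h hx, isImage_apply h' hx]

theorem isImage_add {a b : CrossedProduct datum₀.T K} {r r' : datum₀.MatrixProduct K}
    (h : datum₀.IsImage K a r) (h' : datum₀.IsImage K b r') :
    datum₀.IsImage K (a + b) (r + r') := by
  rw [isImage_iff] at *
  intro W x hx i n
  rw [map_add, h W x hx, h' W x hx, ← Finset.sum_add_distrib]
  refine Finset.sum_congr rfl fun j _ => ?_
  rw [Pi.add_apply, Matrix.add_apply]
  split_ifs <;> simp

theorem isImage_algebraMap (c : K) :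
    datum₀.IsImage K (algebraMap K _ c) (algebraMap K (datum₀.MatrixProduct K) c) := by
  rw [isImage_iff]
  intro W x hx i n
  have h1 : algebraMap K (CrossedProduct datum₀.T K) c = mono 0 (algebraMap K _ c) := rfl
  have h2 : ∀ j, (algebraMap K (datum₀.MatrixProduct K) c) W i j = if i = j then c else 0 := by
    intro j
    rw [Pi.algebraMap_apply, Matrix.algebraMap_matrix_apply]
    rfl
  have h3 : (algebraMap K (Coef datum₀.T K) c) (trans i x) = c := rfl
  simp only [h1, h2, value_mono, h3]
  rw [Finset.sum_eq_single i]
  · simp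
  · intro j _ hj
    rw [if_neg hj.symm, ite_self]
  · simp

/-- Right multiplication by b acts on every matrix unit through the matrix of b, not only on the sum
h_W; this is what makes π multiplicative. -/
theorem unit_mul_of_isImage {b : CrossedProduct datum₀.T K} {r : datum₀.MatrixProduct K}
    (h : datum₀.IsImage K b r) (W : datum₀.Tower) (i j : Fin W.len) :
    datum₀.unit K W i j * b = ∑ l, r W j l • datum₀.unit K W i l := by
  classical
  refine eq_of_value fun n y => ?_
  rw [unit_eq_mono, value_mono_mul, _root_.map_sum, Coef.chi_apply (datum₀.isClopen_tr (isClopen_base W) _),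
    mem_tr_iff]
  simp only [value_smul, value_unit]
  by_cases hy : trans (-i) y ∈ W.base
  · have hy' : trans (-((i : ℤ) - j)) y = trans j (trans (-i) y) := by
      rw [trans_trans]
      congr 1
      ring
    rw [if_pos hy, one_mul, hy', isImage_iff.1 h W _ hy]
    refine Finset.sum_congr rfl fun l _ => ?_
    rw [mul_ite, mul_one, mul_zero]
    refine if_congr ?_ rfl rfl
    rw [and_iff_left hy]
    omega
  · simp [hy]

theorem isImage_mul {a b : CrossedProduct datum₀.T K} {r r' : datum₀.MatrixProduct K}
    (h : datum₀.IsImage K a r) (h' : datum₀.IsImage K b r') :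
    datum₀.IsImage K (a * b) (r * r') := by
  intro W
  rw [← mul_assoc, h W, Finset.sum_mul]
  refine Finset.sum_congr rfl fun i _ => ?_
  simp only [Finset.sum_mul, smul_mul_assoc, unit_mul_of_isImage h', Pi.mul_apply, Matrix.mul_apply,
    Finset.smul_sum, Finset.sum_smul, smul_smul]
  rw [Finset.sum_comm]

theorem s_eq : datum₀.s K = mono 1 (datum₀.chi K datum₀.Eᶜ) := rfl

theorem isImage_s : datum₀.IsImage K (datum₀.s K) (toeplitz PowerSeries.X) := by
  classical
  rw [isImage_iff]
  intro W x hx i n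
  rw [s_eq, value_mono, Coef.chi_apply datum₀.isClopen_E.compl]
  simp only [toeplitz_X_apply]
  have hE : trans i x ∈ datum₀.Eᶜ ↔ (i : ℕ) ≠ 0 := by
    rw [Set.mem_compl_iff, mem_E_iff, trans, zero_add]
    by_cases h : (i : ℕ) = 0
    · simp [h, base_zero hx]
    · have := i.2
      rw [base_mid hx (by omega) (by omega)]
      simp [h]
  simp only [hE]
  by_cases hi : (i : ℕ) = 0
  · rw [Finset.sum_eq_zero]
    · simp [hi]
    · intro j _
      rw [if_neg (by omega : ¬ (i : ℕ) = j + 1), ite_self]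
  · rw [if_pos hi, Finset.sum_eq_single ⟨i - 1, by omega⟩]
    · have h1 : (((i : ℕ) - 1 : ℕ) : ℤ) = i - 1 := by omega
      rw [if_pos (by omega : (i : ℕ) = (i : ℕ) - 1 + 1)]
      exact if_congr (by rw [h1]; omega) rfl rfl
    · intro j _ hj
      exact ite_eq_right_iff.2 fun _ => if_neg fun h => hj (Fin.ext (by change (j : ℕ) = i - 1; omega))
    · simp

theorem isImage_star_s :
    datum₀.IsImage K (star (datum₀.s K)) (star (toeplitz PowerSeries.X)) := by
  classical
  rw [isImage_iff]
  intro W x hx i n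
  have hstar : ∀ j, star (toeplitz (PowerSeries.X : PowerSeries K)) W i j =
      if (j : ℕ) = i + 1 then 1 else 0 := by
    intro j
    rw [Pi.star_apply, Matrix.star_apply, toeplitz_X_apply]
    split_ifs <;> simp
  rw [s_eq, star_mono, Datum.star_chi, value_mono, coef_act_apply,
    Coef.chi_apply datum₀.isClopen_E.compl, neg_neg, trans_trans]
  simp only [hstar]
  -- From the top level i = |W| - 1 the next translate falls into E, because the coordinate |W| of x
  -- is 1.
  have hE : trans (1 + i) x ∈ datum₀.Eᶜ ↔ (i : ℕ) + 1 < W.len := by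
    rw [Set.mem_compl_iff, mem_E_iff, trans, zero_add]
    have := i.2
    by_cases h : (i : ℕ) + 1 < W.len
    · rw [base_mid hx (by omega) (by omega)]
      simp [h]
    · have h1 : (1 : ℤ) + i = W.len := by omega
      rw [h1, base_len hx]
      simp [h]
  simp only [hE]
  by_cases hi : (i : ℕ) + 1 < W.len
  · rw [if_pos hi, Finset.sum_eq_single ⟨i + 1, hi⟩]
    · rw [if_pos rfl]
      exact if_congr (by simp only; omega) rfl rfl
    · intro j _ hj
      exact ite_eq_right_iff.2 fun _ => if_neg fun h => hj (Fin.ext h)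
    · simp
  · rw [if_neg hi, ite_self, Finset.sum_eq_zero]
    intro j _
    exact ite_eq_right_iff.2 fun _ => if_neg (by have := j.2; omega)

theorem isImage_const_chi_E :
    datum₀.IsImage K (const (datum₀.chi K datum₀.E)) (cornerProj K) := by
  classical
  rw [isImage_iff]
  intro W x hx i n
  rw [const_apply, value_mono, Coef.chi_apply datum₀.isClopen_E]
  simp only [cornerProj_apply]
  have hE : trans i x ∈ datum₀.E ↔ (i : ℕ) = 0 := by
    rw [mem_E_iff, trans, zero_add]
    by_cases h : (i : ℕ) = 0
    · simp [h, base_zero hx]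
    · have := i.2
      rw [base_mid hx (by omega) (by omega)]
      simp [h]
  simp only [hE]
  rw [Finset.sum_eq_single (zeroIdx W)]
  · by_cases h : (i : ℕ) = 0 <;> simp [h, zeroIdx]
  · intro j _ hj
    exact ite_eq_right_iff.2 fun _ => if_neg fun h => hj (Fin.ext h.2)
  · simp

theorem isImage_sub {a b : CrossedProduct datum₀.T K} {r r' : datum₀.MatrixProduct K}
    (h : datum₀.IsImage K a r) (h' : datum₀.IsImage K b r') :
    datum₀.IsImage K (a - b) (r - r') := by
  have := isImage_add h (isImage_mul (isImage_algebraMap (-1)) h')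
  rwa [map_neg, map_neg, map_one, map_one, neg_one_mul, neg_one_mul, ← sub_eq_add_neg,
    ← sub_eq_add_neg] at this

theorem isImage_one_sub : datum₀.IsImage K (1 - datum₀.s K * star (datum₀.s K)) (cornerProj K) := by
  have h1 : datum₀.IsImage K 1 1 := by
    have := isImage_algebraMap (K := K) 1
    rwa [map_one, map_one] at this
  rw [← one_sub_shift_mul_star]
  exact isImage_sub h1 (isImage_mul isImage_s isImage_star_s)

theorem isImage_aeval (f : K[X]) :
    datum₀.IsImage K (Polynomial.aeval (datum₀.s K) f) (toeplitz f) := by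
  induction f using Polynomial.induction_on with
  | C c =>
    rw [Polynomial.aeval_C, Polynomial.coe_C, toeplitz_C]
    exact isImage_algebraMap c
  | add f g hf hg =>
    rw [map_add, Polynomial.coe_add, map_add]
    exact isImage_add hf hg
  | monomial n c h =>
    rw [pow_succ, ← mul_assoc, map_mul, Polynomial.aeval_X, Polynomial.coe_mul, Polynomial.coe_X,
      map_mul toeplitz]
    exact isImage_mul h isImage_s

theorem datum_B_eq : datum₀.B K = StarAlgebra.adjoin K {datum₀.s K} := by
  have hE : datum₀.Eᶜ = {x | x 0 = 0} := by
    ext x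
    rw [Set.mem_compl_iff, mem_E_iff, Set.mem_ofPred_eq, eq_zero_iff_ne_one]
  have hP : datum₀.P = {datum₀.Eᶜ} := by rw [hE]; rfl
  rw [Datum.B, s_eq, hP, Set.image_singleton]

/-- The elements of `B` have images, in the `*`-algebra generated by the image of `s`. -/
theorem exists_image {S : Subring (datum₀.MatrixProduct K)}
    (halg : ∀ c : K, algebraMap K _ c ∈ S) (hX : toeplitz PowerSeries.X ∈ S)
    (hX' : star (toeplitz PowerSeries.X) ∈ S) {a : CrossedProduct datum₀.T K}
    (ha : a ∈ datum₀.B K) : ∃ r ∈ S, datum₀.IsImage K a r := by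
  have ha' : a ∈ (datum₀.B K).toSubalgebra := ha
  rw [datum_B_eq, StarAlgebra.adjoin_toSubalgebra] at ha'
  clear ha
  induction ha' using Algebra.adjoin_induction with
  | mem x hx =>
    rcases hx with rfl | hx
    · exact ⟨_, hX, isImage_s⟩
    · obtain rfl : x = star (datum₀.s K) := eq_star_of_eq_star (Set.mem_star.1 hx).symm
      exact ⟨_, hX', isImage_star_s⟩
  | algebraMap c => exact ⟨_, halg c, isImage_algebraMap c⟩
  | add x y _ _ hx hy =>
    obtain ⟨r, hr, h⟩ := hx
    obtain ⟨r', hr', h'⟩ := hy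
    exact ⟨_, add_mem hr hr', isImage_add h h'⟩
  | mul x y _ _ hx hy =>
    obtain ⟨r, hr, h⟩ := hx
    obtain ⟨r', hr', h'⟩ := hy
    exact ⟨_, mul_mem hr hr', isImage_mul h h'⟩

end Images

/-! ### Images of series -/

section Series

open SkewMonoidAlgebra Multiplicative CrossedProduct

variable {K : Type*} [Field K] [StarRing K]

theorem exists_image_of_mem_B {a : CrossedProduct datum₀.T K} (ha : a ∈ datum₀.B K) :
    ∃ r, datum₀.IsImage K a r := by
  obtain ⟨r, -, h⟩ := exists_image (S := ⊤) (fun _ => trivial) trivial trivial ha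
  exact ⟨r, h⟩

/-- The elements of `B₀` are constant on the levels of the towers. -/
theorem B₀_apply_eq {b : Coef datum₀.T K} (hb : b ∈ datum₀.B₀ K) {W : datum₀.Tower}
    {x y : ℤ → Fin 2} (hx : x ∈ W.base) (hy : y ∈ W.base) (i : Fin W.len) :
    b (trans i x) = b (trans i y) := by
  obtain ⟨r, hr⟩ := exists_image_of_mem_B (a := const b) hb
  have h : ∀ z ∈ W.base, b (trans i z) = r W i i := by
    intro z hz
    rw [isImage_apply hr hz, const_apply, value_mono, if_pos (sub_self _).symm]
  rw [h x hx, h y hy]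

/-- A coefficient in the n-th part carries a factor vanishing on the levels below n. Row i of a
component therefore involves only the coefficients of index at most i, which is why infinite series
have images. -/
theorem Bpart_apply_eq_zero {n : ℕ} {b : Coef datum₀.T K} (hb : b ∈ datum₀.Bpart K n)
    {W : datum₀.Tower} {x : ℤ → Fin 2} (hx : x ∈ W.base) {i : ℕ} (hi : i < n) :
    b (trans i x) = 0 := by
  classical
  obtain ⟨b, -, rfl⟩ := hb
  rw [Coef.mul_apply, Coef.chi_apply (datum₀.isClopen_off n), if_neg (trans_not_mem_off hx hi),
    zero_mul]

theorem Bpart_apply_eq {n : ℕ} {b : Coef datum₀.T K} (hb : b ∈ datum₀.Bpart K n)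
    {W : datum₀.Tower} {x y : ℤ → Fin 2} (hx : x ∈ W.base) (hy : y ∈ W.base) (i : Fin W.len) :
    b (trans i x) = b (trans i y) := by
  classical
  by_cases hi : (i : ℕ) < n
  · rw [Bpart_apply_eq_zero hb hx hi, Bpart_apply_eq_zero hb hy hi]
  · obtain ⟨b, hb, rfl⟩ := hb
    rw [not_lt] at hi
    rw [Coef.mul_apply, Coef.mul_apply, Coef.chi_apply (datum₀.isClopen_off n),
      Coef.chi_apply (datum₀.isClopen_off n), if_pos (trans_mem_off hx hi i.2),
      if_pos (trans_mem_off hy hi i.2), B₀_apply_eq hb hx hy]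

theorem value_sum_mono (b : datum₀.Bseries K) {M : ℕ} {W : datum₀.Tower}
    (hM : ∀ n, M ≤ n → n < W.len → b.1.coeff n = 0) {x : ℤ → Fin 2} (hx : x ∈ W.base)
    (i : Fin W.len) (n : ℤ) :
    value n (trans i x) (∑ m ∈ Finset.range M, mono (m : ℤ) (b.1.coeff m)) =
      if 0 ≤ n then b.1.coeff n.toNat (trans i x) else 0 := by
  rw [_root_.map_sum]
  simp only [value_mono]
  have hi := i.2
  split_ifs with h
  · by_cases hn : n.toNat < M
    · rw [Finset.sum_eq_single n.toNat]
      · rw [if_pos (Int.toNat_of_nonneg h)]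
      · intro m _ hm
        rw [if_neg (by omega)]
      · exact fun h' => absurd (Finset.mem_range.2 hn) h'
    · rw [Finset.sum_eq_zero]
      · by_cases hl : n.toNat < W.len
        · rw [hM _ (not_lt.1 hn) hl, Coef.zero_apply]
        · rw [Bpart_apply_eq_zero (b.2 _) hx (by omega)]
      · intro m hm
        rw [Finset.mem_range] at hm
        rw [if_neg (by omega)]
  · refine Finset.sum_eq_zero fun m _ => ?_
    rw [if_neg (by omega)]

/-- The cut-off M is left free because it is used twice: at |W| for the definition of π₊, and just
above the degree for a finite sum regarded as an element of the crossed product. -/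
theorem h_mul_sum_eq_iff (b : datum₀.Bseries K) {M : ℕ} {W : datum₀.Tower}
    (hM : ∀ n, M ≤ n → n < W.len → b.1.coeff n = 0) (r : Matrix (Fin W.len) (Fin W.len) K) :
    datum₀.h K W * ∑ m ∈ Finset.range M, mono (m : ℤ) (b.1.coeff m) =
        ∑ i, ∑ j, r i j • datum₀.unit K W i j ↔
      ∀ x ∈ W.base, ∀ i j : Fin W.len,
        r i j = if (j : ℕ) ≤ i then b.1.coeff (i - j) (trans i x) else 0 := by
  rw [h_mul_eq_iff]
  refine forall₃_congr fun x hx i => ?_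
  have key : ∀ j : Fin W.len,
      (if 0 ≤ (i : ℤ) - j then b.1.coeff ((i : ℤ) - j).toNat (trans i x) else 0) =
        if (j : ℕ) ≤ i then b.1.coeff (i - j) (trans i x) else 0 := by
    intro j
    have h1 : ((i : ℤ) - j).toNat = i - j := by omega
    rw [h1]
    exact if_congr (by omega) rfl rfl
  constructor
  · intro h j
    have := h ((i : ℤ) - j)
    rwa [value_sum_mono b hM hx, sum_diagonal, key, eq_comm] at this
  · intro h n
    rw [value_sum_mono b hM hx]
    by_cases hn : ∃ j : Fin W.len, (i : ℤ) - j = n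
    · obtain ⟨j, rfl⟩ := hn
      rw [sum_diagonal, h, key]
    · rw [not_exists] at hn
      rw [Finset.sum_eq_zero fun j _ => if_neg (hn j)]
      split_ifs with h0
      · refine Bpart_apply_eq_zero (b.2 _) hx ?_
        by_contra hlt
        have := i.2
        exact hn ⟨i - n.toNat, by omega⟩ (by simp only; omega)
      · rfl

/-- The matrices `π₊(b)`. -/
def piPlusFun (b : datum₀.Bseries K) : datum₀.MatrixProduct K := fun W =>
  Matrix.of fun i j =>
    if (j : ℕ) ≤ i then b.1.coeff (i - j) (trans i W.nonempty.some) else 0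

theorem piPlusFun_apply (b : datum₀.Bseries K) {W : datum₀.Tower} {x : ℤ → Fin 2}
    (hx : x ∈ W.base) (i j : Fin W.len) :
    piPlusFun b W i j = if (j : ℕ) ≤ i then b.1.coeff (i - j) (trans i x) else 0 := by
  change (if _ then _ else _) = _
  rw [Bpart_apply_eq (b.2 _) W.nonempty.some_mem hx]

/-- The ring homomorphism `π₊`. -/
def piPlus : datum₀.Bseries K →+* datum₀.MatrixProduct K where
  toFun := piPlusFun
  map_one' := by
    funext W
    ext i j
    rw [piPlusFun_apply _ W.nonempty.some_mem, Pi.one_apply, Matrix.one_apply]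
    change (if _ then (if _ then (1 : Coef datum₀.T K) else 0 : Coef datum₀.T K) _ else _) = _
    by_cases h : i = j
    · subst h
      simp
    · have h' : (i : ℕ) ≠ j := fun h' => h (Fin.ext h')
      rw [if_neg h]
      split_ifs with h1 h2
      · omega
      · rfl
      · rfl
  map_zero' := by
    funext W
    ext i j
    rw [piPlusFun_apply _ W.nonempty.some_mem]
    exact ite_self _
  map_add' b c := by
    funext W
    ext i j
    rw [Pi.add_apply, Matrix.add_apply]
    simp only [piPlusFun_apply _ W.nonempty.some_mem]
    split_ifs
    · rfl
    · rw [add_zero]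
  map_mul' b c := by
    funext W
    obtain ⟨x, hx⟩ := W.nonempty
    ext i j
    rw [Pi.mul_apply, Matrix.mul_apply]
    simp only [piPlusFun_apply _ hx]
    have hi := i.2
    have hj := j.2
    rw [Fin.sum_univ_eq_sum_range (fun l =>
      (if l ≤ (i : ℕ) then b.1.coeff (i - l) (trans i x) else 0) *
        (if (j : ℕ) ≤ l then c.1.coeff (l - j) (trans l x) else 0)) W.len]
    split_ifs with h
    · change (b.1 * c.1).coeff (i - j) (trans i x) = _
      rw [SkewSeries.coeff_mul, Finset.Nat.sum_antidiagonal_eq_sum_range_succ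
        (fun p q => b.1.coeff p * (ofAdd (p : ℤ) • c.1.coeff q)), coef_sum_apply]
      -- The term with factors of degrees p and i-j-p in the skew product corresponds to the
      -- intermediate index l = i - p of the matrix product.
      refine Finset.sum_of_injOn (fun p => i - p) ?_ ?_ ?_ ?_
      · intro p hp q hq hpq
        simp only [Finset.coe_range, Set.mem_Iio] at hp hq hpq
        omega
      · intro p hp
        simp only [Finset.coe_range, Set.mem_Iio] at hp ⊢
        omega
      · intro l hl hl'
        simp only [Finset.coe_range, Set.mem_image, Set.mem_Iio, not_exists, not_and] at hl'
        by_cases h1 : l ≤ i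
        · rw [if_neg (c := (j : ℕ) ≤ l), mul_zero]
          intro h2
          exact hl' (i - l) (by omega) (by omega)
        · rw [if_neg h1, zero_mul]
      · intro p hp
        rw [Finset.mem_range] at hp
        have h1 : i - (i - p) = p := by omega
        have h2 : i - p - j = i - j - p := by omega
        have h3 : trans (-(p : ℤ)) (trans i x) = trans ((i - p : ℕ) : ℤ) x := by
          rw [trans_trans]
          congr 1
          omega
        rw [if_pos (by omega), if_pos (by omega), Coef.mul_apply, coef_act_apply, h1, h2, h3]
    · symm
      refine Finset.sum_eq_zero fun l _ => ?_
      by_cases h1 : l ≤ i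
      · rw [if_neg (c := (j : ℕ) ≤ l) (by omega), mul_zero]
      · rw [if_neg h1, zero_mul]

theorem piPlus_apply (b : datum₀.Bseries K) {W : datum₀.Tower} {x : ℤ → Fin 2}
    (hx : x ∈ W.base) (i j : Fin W.len) :
    piPlus b W i j = if (j : ℕ) ≤ i then b.1.coeff (i - j) (trans i x) else 0 :=
  piPlusFun_apply b hx i j

theorem isSeriesImage_iff {b : datum₀.Bseries K} {r : datum₀.MatrixProduct K} :
    datum₀.IsSeriesImage K b r ↔ r = piPlus b := by
  constructor
  · intro h
    funext W
    obtain ⟨x, hx⟩ := W.nonempty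
    ext i j
    rw [piPlus_apply b hx]
    exact (h_mul_sum_eq_iff b (fun n h1 h2 => absurd h2 (not_lt.2 h1)) (r W)).1 (h W) x hx i j
  · rintro rfl W
    exact (h_mul_sum_eq_iff b (fun n h1 h2 => absurd h2 (not_lt.2 h1)) _).2
      fun x hx i j => piPlus_apply b hx i j

/-- The images of the elements of `B₊` are images of elements of `B`. -/
theorem piPlus_mem_imageB {b : datum₀.Bseries K} (hb : b ∈ datum₀.Bplus K) :
    piPlus b ∈ datum₀.imageB K := by
  obtain ⟨N, hN⟩ := hb
  refine ⟨∑ m ∈ Finset.range (N + 1), mono (m : ℤ) (b.1.coeff m), sum_mem fun m _ => ?_, ?_⟩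
  · obtain ⟨c, hc, h⟩ := b.2 m
    have h1 : mono (m : ℤ) (b.1.coeff m) = const c * datum₀.s K ^ m := by
      rw [h, Datum.s_pow, const_apply, mono_mul, zero_add, ofAdd_zero, one_smul, mul_comm]
    rw [h1]
    exact mul_mem hc (pow_mem (datum₀.s_mem K) m)
  · intro W
    exact (h_mul_sum_eq_iff b (fun n h1 _ => hN n (by omega)) _).2
      fun x hx i j => piPlus_apply b hx i j

/-- The series `∑ f_i sⁱ`. -/
def sSeries : PowerSeries K →+* datum₀.Bseries K where
  toFun f := ⟨⟨fun i => PowerSeries.coeff i f • datum₀.chi K (datum₀.off i)⟩, fun i =>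
    ⟨algebraMap K _ (PowerSeries.coeff i f), (datum₀.B₀ K).algebraMap_mem _, by
      exact (Algebra.smul_def _ _).trans (mul_comm _ _)⟩⟩
  map_one' := by
    classical
    refine Subtype.ext (SkewSeries.ext (funext fun n => Coef.ext fun x => ?_))
    change (PowerSeries.coeff n (1 : PowerSeries K) • datum₀.chi K (datum₀.off n)) x =
      (if n = 0 then (1 : Coef datum₀.T K) else 0 : Coef datum₀.T K) x
    rw [PowerSeries.coeff_one, Coef.smul_apply]
    split_ifs with h
    · subst h
      rw [Coef.chi_apply (datum₀.isClopen_off 0), if_pos (by simp [Datum.off]), mul_one,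
        Coef.one_apply]
    · rw [zero_mul, Coef.zero_apply]
  map_zero' := Subtype.ext (SkewSeries.ext (funext fun n => by
    change PowerSeries.coeff n (0 : PowerSeries K) • datum₀.chi K (datum₀.off n) = 0
    rw [_root_.map_zero, zero_smul]))
  map_add' f g := Subtype.ext (SkewSeries.ext (funext fun n => by
    change PowerSeries.coeff n (f + g) • datum₀.chi K (datum₀.off n) =
      PowerSeries.coeff n f • datum₀.chi K (datum₀.off n) +
        PowerSeries.coeff n g • datum₀.chi K (datum₀.off n)
    rw [_root_.map_add, add_smul]))
  map_mul' f g := Subtype.ext (SkewSeries.ext (funext fun n => by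
    change PowerSeries.coeff n (f * g) • datum₀.chi K (datum₀.off n) =
      ∑ p ∈ Finset.HasAntidiagonal.antidiagonal n,
        (PowerSeries.coeff p.1 f • datum₀.chi K (datum₀.off p.1)) *
          (ofAdd (p.1 : ℤ) • PowerSeries.coeff p.2 g • datum₀.chi K (datum₀.off p.2))
    rw [PowerSeries.coeff_mul, Finset.sum_smul]
    refine Finset.sum_congr rfl fun p hp => ?_
    rw [← Finset.HasAntidiagonal.mem_antidiagonal.1 hp, smul_comm (ofAdd (p.1 : ℤ)),
      smul_mul_smul_comm, ← Datum.chi_tr _ _ (datum₀.isClopen_off _), datum₀.off_add,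
      datum₀.chi_inter K (datum₀.isClopen_off _) (datum₀.isClopen_tr (datum₀.isClopen_off _) _)]))

theorem coeff_sSeries (f : PowerSeries K) (n : ℕ) :
    (sSeries f).1.coeff n = PowerSeries.coeff n f • datum₀.chi K (zeros n) := by
  rw [← off_eq_zeros]
  rfl

theorem piPlus_sSeries (f : PowerSeries K) : piPlus (sSeries f) = toeplitz f := by
  classical
  funext W
  obtain ⟨x, hx⟩ := W.nonempty
  ext i j
  rw [piPlus_apply _ hx, toeplitz_apply]
  refine if_congr Iff.rfl ?_ rfl
  have hcl : IsClopen (zeros (i - j)) := by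
    rw [← off_eq_zeros]
    exact datum₀.isClopen_off _
  rw [coeff_sSeries, Coef.smul_apply, Coef.chi_apply hcl, if_pos, mul_one]
  rw [← off_eq_zeros]
  exact trans_mem_off hx (Nat.sub_le _ _) i.2

theorem subset_divisionClosure {A : Type*} [Ring A] (S : Set A) : S ⊆ divisionClosure S :=
  fun _ hx => Subring.mem_sInf.2 fun _ hQ => hQ.1 hx

theorem divisionClosure_le {A : Type*} [Ring A] {S : Set A} {Q : Subring A} (hS : S ⊆ Q)
    (h : ∀ x ∈ Q, ∀ y : A, x * y = 1 → y * x = 1 → y ∈ Q) : divisionClosure S ≤ Q :=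
  sInf_le ⟨hS, h⟩

theorem inverse_mem_divisionClosure {A : Type*} [Ring A] {S : Set A} {x y : A}
    (hx : x ∈ divisionClosure S) (h1 : x * y = 1) (h2 : y * x = 1) : y ∈ divisionClosure S :=
  Subring.mem_sInf.2 fun Q hQ => hQ.2 x (Subring.mem_sInf.1 hx Q hQ) y h1 h2

/-- The preimage of the division closure under f ↦ f(s) contains the polynomials and is closed under
inverses, hence contains the division closure of K[x]. -/
theorem sSeries_mem_Dplus {f : PowerSeries K} (hf : f ∈ ratSeries K) :
    sSeries f ∈ datum₀.Dplus K := by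
  rw [← divisionClosure_eq_ratSeries] at hf
  refine (divisionClosure_le (Q := (datum₀.Dplus K).comap sSeries) ?_ ?_ :
    divisionClosure _ ≤ _) hf
  · rintro _ ⟨p, rfl⟩
    refine subset_divisionClosure _ ⟨p.natDegree, fun i hi => ?_⟩
    rw [coeff_sSeries, Polynomial.coeff_coe, Polynomial.coeff_eq_zero_of_natDegree_lt hi, zero_smul]
  · intro x hx y h1 h2
    refine inverse_mem_divisionClosure hx ?_ ?_
    · rw [← map_mul, h1, map_one]
    · rw [← map_mul, h2, map_one]

/-- A relative inverse of an invertible element is its inverse. -/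
theorem inverse_mem_of_isStarRegularSubring {A : Type*} [Ring A] [StarRing A] {Q : Subring A}
    (hQ : IsStarRegularSubring Q) {x y : A} (hx : x ∈ Q) (h1 : x * y = 1) (h2 : y * x = 1) :
    y ∈ Q := by
  obtain ⟨z, hz, h⟩ := hQ.2.1 x hx
  have : y * (x * z * x) * y = z := by
    rw [mul_assoc x z x, ← mul_assoc y, h2, one_mul, mul_assoc, h1, mul_one]
  rw [h, h2, one_mul] at this
  rwa [this]

/-- A `*`-regular subring that contains the image of `B` contains the image of `D₊`. -/
theorem piPlus_mem {Q : Subring (datum₀.MatrixProduct K)} (hB : datum₀.imageB K ⊆ Q)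
    (hQ : IsStarRegularSubring Q) {b : datum₀.Bseries K} (hb : b ∈ datum₀.Dplus K) :
    piPlus b ∈ Q := by
  refine (divisionClosure_le (Q := Q.comap piPlus) ?_ ?_ : divisionClosure _ ≤ _) hb
  · exact fun c hc => hB (piPlus_mem_imageB hc)
  · intro x hx y h1 h2
    refine inverse_mem_of_isStarRegularSubring hQ hx ?_ ?_
    · rw [← map_mul, h1, map_one]
    · rw [← map_mul, h2, map_one]

end Series

/-! ### Identification of the algebras -/

section Identification

open SkewMonoidAlgebra Multiplicative CrossedProduct

variable {K : Type*} [Field K] [StarRing K]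

/-- If n = 0 in K with n > 0, the sum of n terms 1·1 contradicts positive definiteness. -/
theorem charZero_of_positive_definite
    (hK : ∀ (n : ℕ) (x : Fin n → K), ∑ i, star (x i) * x i = 0 → ∀ i, x i = 0) : CharZero K := by
  refine charZero_of_inj_zero fun n hn => ?_
  by_contra h0
  refine one_ne_zero (α := K) (hK n (fun _ => 1) ?_ ⟨0, Nat.pos_of_ne_zero h0⟩)
  simpa using hn

theorem isClopen_zeros (i : ℕ) : IsClopen (zeros i) := by
  rw [← off_eq_zeros]
  exact datum₀.isClopen_off i

theorem chi_zeros_apply {W : datum₀.Tower} {x : ℤ → Fin 2} (hx : x ∈ W.base) {i : ℕ}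
    (hi : i < W.len) : datum₀.chi K (zeros i) (trans i x) = 1 := by
  classical
  rw [Coef.chi_apply (isClopen_zeros i), if_pos (trans_mem_zeros hx hi)]

/-! #### The Hadamard algebra of special series -/

theorem ofPowerSeries_coeff (a : ℕ → K) (i : ℕ) :
    (ofPowerSeries K a).1 i = a i • datum₀.chi K (zeros i) := rfl

theorem ofPowerSeries_injective : Function.Injective (ofPowerSeries K) := by
  intro a b h
  funext i
  obtain ⟨x, hx⟩ := (tower i).nonempty
  have h1 := congrArg (fun q : datum₀.specialSeries K => q.1 i (trans i x)) h
  simpa [ofPowerSeries_coeff, chi_zeros_apply hx (Nat.lt_succ_self i)] using h1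

/-- There is a single special set in each degree, so each space V_i is a line. -/
theorem ofPowerSeries_surjective : Function.Surjective (ofPowerSeries K) := by
  intro q
  have h : ∀ i, ∃ c : K, c • datum₀.chi K (zeros i) = q.1 i := by
    intro i
    have := q.2 i
    rw [Datum.V, special₀, Set.image_singleton] at this
    exact Submodule.mem_span_singleton.1 this
  choose a ha using h
  exact ⟨a, Subtype.ext (funext ha)⟩

theorem ofPowerSeries_mul (a b : ℕ → K) :
    ofPowerSeries K (a * b) = ofPowerSeries K a * ofPowerSeries K b := by
  refine Subtype.ext (funext fun i => ?_)
  change (a i * b i) • datum₀.chi K (zeros i) =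
    (a i • datum₀.chi K (zeros i)) * (b i • datum₀.chi K (zeros i))
  rw [smul_mul_smul_comm, ← datum₀.chi_inter K (isClopen_zeros i) (isClopen_zeros i),
    Set.inter_self]

variable (K) in
/-- The isomorphism of `(K[[x]], ⊙)` with `(S₀[[t; T]], ⊙)`, as a ring homomorphism. -/
def ofPowerSeriesHom : (ℕ → K) →+* datum₀.specialSeries K where
  toFun := ofPowerSeries K
  map_one' := by
    obtain ⟨u, hu⟩ := ofPowerSeries_surjective (1 : datum₀.specialSeries K)
    rw [← mul_one (ofPowerSeries K 1), ← hu, ← ofPowerSeries_mul, one_mul]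
  map_mul' := ofPowerSeries_mul
  map_zero' := Subtype.ext (funext fun i => zero_smul _ _)
  map_add' a b := Subtype.ext (funext fun i => add_smul _ _ _)

theorem star_ofPowerSeries (a : ℕ → K) :
    star (ofPowerSeries K a) = ofPowerSeries K (star a) := by
  refine Subtype.ext (funext fun i => ?_)
  change star (a i • datum₀.chi K (zeros i)) = star (a i) • datum₀.chi K (zeros i)
  rw [star_smul, Datum.star_chi]

theorem psi_ofPowerSeries (a : ℕ → K) : datum₀.psi K (ofPowerSeries K a) = centralHom K a := by
  funext W
  have hlen := W.one_le_len
  have h : (datum₀.T ^ (W.len - 1)) W.nonempty.some =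
      trans ((W.len - 1 : ℕ) : ℤ) W.nonempty.some := by
    rw [← datum_T_zpow, zpow_natCast]
  rw [Datum.psi, h, ofPowerSeries_coeff, Coef.smul_apply,
    chi_zeros_apply W.nonempty.some_mem (by omega), mul_one, centralHom_apply]

/-! #### `π(B)` and the regular closure -/

theorem imageB_subset_toeplitzAlgebra :
    datum₀.imageB K ⊆ (toeplitzAlgebra K).toSubring := by
  rintro r ⟨a, ha, h⟩
  have hX : toeplitz PowerSeries.X ∈ toeplitzAlgebra K := toeplitz_mem X_mem_ratSeries
  obtain ⟨r', hr', h'⟩ := exists_image (S := (toeplitzAlgebra K).toSubring)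
    (fun c => (toeplitzAlgebra K).algebraMap_mem c) hX ((toeplitzAlgebra K).star_mem' hX) ha
  rwa [isImage_unique h h']

theorem toeplitz_X_mem_imageB : toeplitz (PowerSeries.X : PowerSeries K) ∈ datum₀.imageB K :=
  ⟨_, datum₀.s_mem K, isImage_s⟩

theorem algebraMap_mem_imageB (c : K) : algebraMap K _ c ∈ datum₀.imageB K :=
  ⟨_, (datum₀.B K).algebraMap_mem c, isImage_algebraMap c⟩

/-- The series f(s) come from the division closure, p_E and the matrix units e_{k-1,0} are
expressions in s, s* and (1-s)⁻¹, and these give Ψ(a)p_E for rational a. Denominators are inverted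
inside the corner by relative inverses. -/
theorem toeplitzAlgebra_le {Q : Subring (datum₀.MatrixProduct K)} (hB : datum₀.imageB K ⊆ Q)
    (hQ : IsStarRegularSubring Q) : (toeplitzAlgebra K).toSubring ≤ Q := by
  have hX : toeplitz (PowerSeries.X : PowerSeries K) ∈ Q := hB toeplitz_X_mem_imageB
  have htoep : ∀ f ∈ ratSeries K, toeplitz f ∈ Q := fun f hf => by
    rw [← piPlus_sSeries]
    exact piPlus_mem hB hQ (sSeries_mem_Dplus hf)
  have hp : cornerProj K ∈ Q := by
    rw [← one_sub_shift_mul_star]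
    exact sub_mem (one_mem _) (mul_mem hX (hQ.1 _ hX))
  have hlink : linkUnit K ∈ Q := by
    rw [linkUnit, topProj]
    exact mul_mem (mul_mem (sub_mem (one_mem _) (mul_mem (hQ.1 _ hX) hX))
      (htoep _ mk_one_mem_ratSeries)) hp
  have hrat : ∀ a ∈ rationalSubring K, centralHom K a * cornerProj K ∈ Q := by
    intro a ha
    have h := mul_mem (mul_mem (hQ.1 _ hlink) (htoep _ (mem_rationalHadamard.1 ha))) hp
    rw [star_linkUnit_mul_toeplitz_mul] at h
    simpa only [PowerSeries.coeff_mk] using h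
  have hcentral : ∀ a ∈ agQSubring K, centralHom K a * cornerProj K ∈ Q := by
    rintro a ha
    obtain ⟨u, hu, b, hb, b', hbb', rfl⟩ := mem_agQ.1 (mem_agQSubring.1 ha)
    obtain ⟨y, hy, h⟩ := hQ.2.1 _ (hrat b hb)
    have hinv : centralHom K b' * centralHom K b = 1 := by
      rw [← map_mul, mul_comm b', hbb', map_one]
    -- The element Ψ(b) is central and invertible in the whole product, though it need not lie in Q.
    -- Cancelling it twice from Ψ(b)² p_E y p_E = Ψ(b) p_E identifies the compression of y with
    -- Ψ(b⁻¹)p_E.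
    have h1 : cornerProj K * y * cornerProj K = centralHom K b' * cornerProj K := by
      have h2 : centralHom K b * (centralHom K b * (cornerProj K * y * cornerProj K)) =
          centralHom K b * cornerProj K := by
        rw [← h]
        rw [mul_assoc (centralHom K b * cornerProj K) y, ← mul_assoc y, ← centralHom_comm b y]
        simp only [mul_assoc]
        rw [← mul_assoc (cornerProj K) (centralHom K b), ← centralHom_comm b (cornerProj K)]
        simp only [mul_assoc]
      have h3 := congrArg (fun z => centralHom K b' * (centralHom K b' * z)) h2
      rwa [← mul_assoc (centralHom K b') (centralHom K b) (_ * _), hinv, one_mul, ← mul_assoc,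
        hinv, one_mul, ← mul_assoc (centralHom K b') (centralHom K b), hinv, one_mul] at h3
    have h4 : centralHom K (u * b') * cornerProj K =
        centralHom K u * cornerProj K * (centralHom K b' * cornerProj K) := by
      rw [mul_assoc, ← mul_assoc (cornerProj K), ← centralHom_comm, mul_assoc (centralHom K b'),
        cornerProj_mul_self, map_mul, mul_assoc]
    rw [h4, ← h1]
    exact mul_mem (hrat u hu) (mul_mem (mul_mem hp hy) hp)
  intro x hx
  refine StarAlgebra.adjoin_induction (p := fun x _ => x ∈ Q) ?_ ?_ ?_ ?_ ?_ hx
  · rintro x (⟨f, hf, rfl⟩ | ⟨a, ha, rfl⟩)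
    · exact htoep f hf
    · exact hcentral a ha
  · exact fun c => hB (algebraMap_mem_imageB c)
  · exact fun x y _ _ h1 h2 => add_mem h1 h2
  · exact fun x y _ _ h1 h2 => mul_mem h1 h2
  · exact fun x _ h1 => hQ.1 x h1

theorem R_eq_toeplitzAlgebra (hA : IsStarRegularSubring (toeplitzAlgebra K).toSubring) :
    datum₀.R K = (toeplitzAlgebra K).toSubring :=
  le_antisymm (sInf_le ⟨imageB_subset_toeplitzAlgebra, hA⟩)
    (le_sInf fun _ hQ => toeplitzAlgebra_le hQ.1 hQ.2)

/-! #### The projections of the elements of `D₊` -/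

/-- The elements of `V'_i` vanish at the points `Tⁱ x` with `x` in the tower of length `i + 1`. -/
theorem V'_apply_eq_zero {i : ℕ} {b : Coef datum₀.T K} (hb : b ∈ datum₀.V' K i) {x : ℤ → Fin 2}
    (hx : x ∈ (tower i).base) : b (trans i x) = 0 := by
  classical
  have hcyl : ∀ (C : Set (ℤ → Fin 2)) (r s : ℕ), (i < s ∨ 0 < r) → datum₀.IsCylinder r s C →
      datum₀.chi K C (trans i x) = 0 := by
    rintro C r s hrs ⟨-, Z, hZ, rfl⟩
    by_cases hcl : IsClopen {x | ∀ j, -(r : ℤ) ≤ j → j < s → x ∈ datum₀.tr j (Z j)}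
    · rw [Coef.chi_apply hcl, if_neg]
      intro h
      have key : ∀ j, -(r : ℤ) ≤ j → j < s → x (-j + i) = 0 := by
        intro j h1 h2
        have h3 := h j h1 h2
        have : Z j = {x | x 0 = 0} := hZ j h1 h2
        rw [this, mem_tr_iff, trans_trans] at h3
        have h4 : x (0 + (-j + i)) = 0 := h3
        rwa [zero_add] at h4
      -- A cylinder of V'_i forces a zero at coordinate 0 of x (when s > i) or at coordinate i+1
      -- (when r > 0), but both coordinates of a point of this tower are 1.
      rcases hrs with h1 | h1
      · have := key i (by omega) (by omega)
        rw [neg_add_cancel, base_zero hx] at this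
        exact absurd this (by decide)
      · have := key (-1) (by omega) (by omega)
        have hl := base_len hx
        have h2 : ((tower i).len : ℤ) = - -1 + i := by
          change ((i + 1 : ℕ) : ℤ) = _
          push_cast
          ring
        rw [h2, this] at hl
        exact absurd hl (by decide)
    · have h0 : datum₀.chi K {x | ∀ j, -(r : ℤ) ≤ j → j < s → x ∈ datum₀.tr j (Z j)} = 0 :=
        dif_neg hcl
      rw [h0, Coef.zero_apply]
  have hspan : ∀ F : Set (Set (ℤ → Fin 2)), (∀ C ∈ F, datum₀.chi K C (trans i x) = 0) →
      ∀ b ∈ Submodule.span K (datum₀.chi K '' F), b (trans i x) = 0 := by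
    intro F hF b h
    induction h using Submodule.span_induction with
    | mem y hy =>
      obtain ⟨C, hC, rfl⟩ := hy
      exact hF C hC
    | zero => rfl
    | add y z _ _ hy hz => rw [Coef.add_apply, hy, hz, add_zero]
    | smul c y _ hy => rw [Coef.smul_apply, hy, mul_zero]
  rw [Datum.V'] at hb
  split_ifs at hb with h1 h2
  · refine hspan _ ?_ _ hb
    rintro C ⟨r, s, hrs, hC⟩
    exact hcyl C r s (by omega) hC
  -- The constant sequence 1 lies in E ∩ T⁻¹(E), so the alternative V'_0 = B₀ does not arise.
  · exact absurd ⟨fun _ => 1, rfl, (mem_tr₀ _ _ _).2 rfl⟩ h2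
  · refine hspan _ ?_ _ hb
    rintro C ⟨r, s, -, hrs, hC⟩
    exact hcyl C r s hrs hC

theorem isProj_apply {b : datum₀.Bseries K} {a : ℕ → K}
    (h : datum₀.IsProj K b (ofPowerSeries K a)) (i : ℕ) {x : ℤ → Fin 2}
    (hx : x ∈ (tower i).base) : a i = b.1.coeff i (trans i x) := by
  have h1 := V'_apply_eq_zero (h i) hx
  have h2 : b.1.coeff i (trans i x) - (ofPowerSeries K a).1 i (trans i x) = 0 := h1
  rw [ofPowerSeries_coeff, Coef.smul_apply, chi_zeros_apply hx (Nat.lt_succ_self i), mul_one,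
    sub_eq_zero] at h2
  exact h2.symm

/-- The i-th coefficient of the projection is the value of b_i on the top level of the tower of
length i+1, that is, the lower left entry of π₊(b). Multiplying by the adjoint of `linkUnit` moves
it to the corner, where `corner_eq` applies. -/
theorem isProj_mem_agQSubring (hA : IsStarRegularSubring (toeplitzAlgebra K).toSubring)
    {b : datum₀.Bseries K} (hb : b ∈ datum₀.Dplus K) {a : ℕ → K}
    (h : datum₀.IsProj K b (ofPowerSeries K a)) : a ∈ agQSubring K := by
  have hmem : piPlus b ∈ toeplitzAlgebra K := piPlus_mem imageB_subset_toeplitzAlgebra hA hb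
  obtain ⟨c, hc, hcb⟩ := corner_eq (mul_mem (star_mem linkUnit_mem) hmem)
  suffices a = c by rwa [this]
  funext i
  obtain ⟨x, hx⟩ := (tower i).nonempty
  have h1 := congrFun (congrFun (congrFun hcb (tower i)) (zeroIdx _)) (zeroIdx _)
  have hlast : ((lastIdx (tower i) : Fin _) : ℕ) = i := rfl
  have hzero : ((zeroIdx (tower i) : Fin _) : ℕ) = 0 := rfl
  have hlen : (tower i).len - 1 = i := rfl
  simp only [Pi.mul_apply, cornerProj_eq_single, centralHom_apply, star_linkUnit_apply,
    Matrix.single_mul_mul_single, ← mul_assoc, Matrix.single_mul_single_same, one_mul, mul_one,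
    smul_mul_assoc, Matrix.smul_single, smul_eq_mul, Matrix.single_apply_same,
    piPlus_apply b hx, hlast, hzero, hlen, Nat.zero_le, if_true, Nat.sub_zero] at h1
  rw [isProj_apply h i hx, h1]

theorem isProj_sSeries (f : PowerSeries K) :
    datum₀.IsProj K (sSeries f) (ofPowerSeries K fun n => PowerSeries.coeff n f) := by
  intro i
  rw [coeff_sSeries, ofPowerSeries_coeff, sub_self]
  exact zero_mem _

/-- For the reverse inclusion, P fixes the series Σ a_i sⁱ with a rational, so every *-regular
subring containing the projections contains these series and the inverses of the invertible ones. -/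
theorem algQ_eq [CharZero K]
    (hK : ∀ (n : ℕ) (x : Fin n → K), ∑ i, star (x i) * x i = 0 → ∀ i, x i = 0)
    (hA : IsStarRegularSubring (toeplitzAlgebra K).toSubring) :
    datum₀.algQ K = (agQSubring K).map (ofPowerSeriesHom K) := by
  refine le_antisymm (sInf_le ⟨?_, ?_, ?_, ?_⟩) (le_sInf ?_)
  · rintro q ⟨b, hb, h⟩
    obtain ⟨a, rfl⟩ := ofPowerSeries_surjective q
    exact ⟨a, isProj_mem_agQSubring hA hb h, rfl⟩
  · rintro _ ⟨a, ha, rfl⟩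
    exact ⟨star a, star_mem_agQSubring ha, (star_ofPowerSeries a).symm⟩
  · rintro _ ⟨a, ha, rfl⟩
    obtain ⟨y, hy, h⟩ := agQSubring_regular ha
    exact ⟨_, ⟨y, hy, rfl⟩, by rw [← map_mul, ← map_mul, h]⟩
  · rintro _ ⟨a, ha, rfl⟩ h
    have h0 : star a * a = 0 := by
      apply ofPowerSeries_injective
      rw [ofPowerSeries_mul, ← star_ofPowerSeries]
      exact h.trans (map_zero (ofPowerSeriesHom K)).symm
    have h1 : a = 0 := funext fun n => hK 1 (fun _ => a n) (by
      rw [Fin.sum_univ_one]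
      exact congrFun h0 n) 0
    rw [h1, map_zero]
  · rintro Q ⟨hP, hQ⟩ _ ⟨a, ha, rfl⟩
    have hrat : ∀ u ∈ rationalSubring K, ofPowerSeriesHom K u ∈ Q := by
      intro u hu
      refine hP ⟨_, sSeries_mem_Dplus (mem_rationalHadamard.1 hu), ?_⟩
      have := isProj_sSeries (PowerSeries.mk u)
      simp only [PowerSeries.coeff_mk] at this
      exact this
    obtain ⟨u, hu, b, hb, b', hbb', rfl⟩ := mem_agQ.1 (mem_agQSubring.1 ha)
    rw [map_mul]
    refine mul_mem (hrat u hu) (inverse_mem_of_isStarRegularSubring hQ (hrat b hb) ?_ ?_)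
    · rw [← map_mul, hbb', map_one]
    · rw [← map_mul, mul_comm, hbb', map_one]

/-! #### The algebras `ℰ` -/

/-- ℰ is generated without adjoints, so its stability under * rests on the algebra generated by
π₊(D₊) being a *-algebra and on 𝒬 being closed under conjugation. -/
theorem algE_eq [CharZero K]
    (hK : ∀ (n : ℕ) (x : Fin n → K), ∑ i, star (x i) * x i = 0 → ∀ i, x i = 0)
    (hA : IsStarRegularSubring (toeplitzAlgebra K).toSubring) :
    datum₀.algE K = (toeplitzAlgebra K).toSubalgebra := by
  have hcentral : ∀ a ∈ agQSubring K, centralHom K a * cornerProj K ∈ datum₀.algE K := by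
    intro a ha
    refine Algebra.subset_adjoin (Or.inr ⟨ofPowerSeriesHom K a, ?_, _, isImage_const_chi_E, ?_⟩)
    · rw [algQ_eq hK hA]
      exact ⟨a, ha, rfl⟩
    · exact congrArg (· * cornerProj K) (psi_ofPowerSeries a).symm
  have htoep : ∀ f ∈ ratSeries K, toeplitz f ∈ datum₀.algD K := fun f hf =>
    StarAlgebra.subset_adjoin K _ ⟨_, sSeries_mem_Dplus hf,
      isSeriesImage_iff.2 (piPlus_sSeries f).symm⟩
  refine le_antisymm (Algebra.adjoin_le ?_) ?_
  · rintro r (hr | ⟨q, hq, p, hp, rfl⟩)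
    · refine (StarAlgebra.adjoin_le ?_ : datum₀.algD K ≤ toeplitzAlgebra K) hr
      rintro r ⟨b, hb, h⟩
      rw [isSeriesImage_iff.1 h]
      exact piPlus_mem imageB_subset_toeplitzAlgebra hA hb
    · rw [algQ_eq hK hA] at hq
      obtain ⟨a, ha, rfl⟩ := hq
      have h1 : datum₀.psi K (ofPowerSeriesHom K a) = centralHom K a := psi_ofPowerSeries a
      rw [isImage_unique hp isImage_const_chi_E, h1]
      exact central_cornerProj_mem ha
  · rw [toeplitzAlgebra, StarAlgebra.adjoin_toSubalgebra]
    refine Algebra.adjoin_le ?_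
    rintro r ((⟨f, hf, rfl⟩ | ⟨a, ha, rfl⟩) | hr)
    · exact Algebra.subset_adjoin (Or.inl (htoep f hf))
    · exact hcentral a ha
    · rcases Set.mem_star.1 hr with ⟨f, hf, h⟩ | ⟨a, ha, h⟩
      · rw [eq_star_of_eq_star h.symm]
        exact Algebra.subset_adjoin (Or.inl (star_mem (htoep f hf)))
      · rw [eq_star_of_eq_star h.symm, star_central_cornerProj]
        exact hcentral _ (star_mem_agQSubring ha)

theorem toeplitz_inv_mem_locB {f : K[X]} (hf : f.coeff 0 = 1) :
    toeplitz (f : PowerSeries K)⁻¹ ∈ datum₀.locB K := by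
  have h0 : PowerSeries.constantCoeff (f : PowerSeries K) ≠ 0 := by
    rw [Polynomial.constantCoeff_coe, hf]
    exact one_ne_zero
  refine Algebra.subset_adjoin (Or.inr ⟨f, hf, toeplitz f, isImage_aeval f, ?_, ?_⟩)
  · rw [← map_mul, PowerSeries.mul_inv_cancel _ h0, map_one]
  · rw [← map_mul, PowerSeries.inv_mul_cancel _ h0, map_one]

theorem toeplitz_mem_locB {f : PowerSeries K} (hf : f ∈ ratSeries K) :
    toeplitz f ∈ datum₀.locB K := by
  obtain ⟨N, D, hD, h⟩ := hf
  have haeval : ∀ p : K[X], toeplitz (p : PowerSeries K) ∈ datum₀.locB K := fun p =>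
    Algebra.subset_adjoin (Or.inl ⟨_, by
      have := Polynomial.aeval_mem_adjoin_singleton K (datum₀.s K) (p := p)
      exact (Algebra.adjoin_le (Set.singleton_subset_iff.2 (datum₀.s_mem K)) :
        Algebra.adjoin K {datum₀.s K} ≤ (datum₀.B K).toSubalgebra) this, isImage_aeval p⟩)
  -- The localization inverts only polynomials with constant term 1, so the denominator is
  -- normalised.
  have hc : (Polynomial.C (D.coeff 0)⁻¹ * D).coeff 0 = 1 := by
    rw [Polynomial.coeff_C_mul, inv_mul_cancel₀ hD]
  have h1 : PowerSeries.constantCoeff ((Polynomial.C (D.coeff 0)⁻¹ * D : K[X]) : PowerSeries K) ≠ 0 := by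
    rw [Polynomial.constantCoeff_coe, hc]
    exact one_ne_zero
  have hfeq : f = ((Polynomial.C (D.coeff 0)⁻¹ * D : K[X]) : PowerSeries K)⁻¹ *
      ((Polynomial.C (D.coeff 0)⁻¹ * N : K[X]) : PowerSeries K) := by
    rw [Polynomial.coe_mul _ N, ← h, ← mul_assoc (Polynomial.C _ : K[X]).toPowerSeries,
      ← Polynomial.coe_mul, ← mul_assoc, PowerSeries.inv_mul_cancel _ h1, one_mul]
  rw [hfeq, map_mul]
  exact mul_mem (toeplitz_inv_mem_locB hc) (haeval _)

theorem agE_eq (hA : IsStarRegularSubring (toeplitzAlgebra K).toSubring) :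
    agE K = toeplitzAlgebra K := by
  refine le_antisymm (StarAlgebra.adjoin_le ?_) (StarAlgebra.adjoin_le ?_)
  · rintro r (hr | ⟨a, ha, p, hp, rfl⟩)
    · refine (StarAlgebra.adjoin_le ?_ : datum₀.algT K ≤ toeplitzAlgebra K) hr
      refine (Algebra.adjoin_le ?_ : datum₀.locB K ≤ (toeplitzAlgebra K).toSubalgebra)
      rintro r (hr | ⟨f, hf, y, hy, h1, h2⟩)
      · exact imageB_subset_toeplitzAlgebra hr
      · refine inverse_mem_of_isStarRegularSubring hA (x := y) ?_ h1 h2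
        rw [isImage_unique hy (isImage_aeval f)]
        exact toeplitz_mem (coe_mem_ratSeries f)
    · rw [isImage_unique hp isImage_one_sub, psi_ofPowerSeries]
      exact central_cornerProj_mem ha
  · rintro r (⟨f, hf, rfl⟩ | ⟨a, ha, rfl⟩)
    · exact StarAlgebra.subset_adjoin K _
        (Or.inl (StarAlgebra.subset_adjoin K _ (toeplitz_mem_locB hf)))
    · exact StarAlgebra.subset_adjoin K _
        (Or.inr ⟨a, ha, _, isImage_one_sub, by rw [psi_ofPowerSeries]⟩)

end Identification

end Lamplighter

end

theorem mainTheorem9 (K : Type*) [Field K] [StarRing K]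
    (hK : ∀ (n : ℕ) (x : Fin n → K), ∑ i, star (x i) * x i = 0 → ∀ i, x i = 0) :
    ((Lamplighter.datum₀.algE K : Set (Lamplighter.datum₀.MatrixProduct K)) =
        (Lamplighter.agE K : Set (Lamplighter.datum₀.MatrixProduct K)) ∧
      (Lamplighter.agE K : Set (Lamplighter.datum₀.MatrixProduct K)) =
        (Lamplighter.datum₀.R K : Set (Lamplighter.datum₀.MatrixProduct K))) ∧
    Lamplighter.ofPowerSeries K '' Lamplighter.agQ K =
      (Lamplighter.datum₀.algQ K : Set (Lamplighter.datum₀.specialSeries K)) := by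
  have := Lamplighter.charZero_of_positive_definite hK
  have hA := Lamplighter.toeplitzAlgebra_isStarRegular hK
  rw [Lamplighter.algE_eq hK hA, Lamplighter.agE_eq hA, Lamplighter.R_eq_toeplitzAlgebra hA,
    Lamplighter.algQ_eq hK hA]
  exact ⟨⟨rfl, rfl⟩, rfl⟩
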